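/- **Setting.** Let $n\ge 1$ and represent $\mathbb S^{n+1}$ minus the south pole by $\mathbb R^{n+1}$ with the metric $\bar g=\frac{4}{(1+|x|^2)^2}|dx|^2$. For $R\in(0,\pi)$ the closed geodesic ball $\bar B_R$ of radius $R$ about the north pole is the Euclidean ball $\{|x|\le r_0\}$ with $r_0=\sqrt{\frac{1-\cos R}{1+\cos R}}$; let $\bar N$ be the outward unit normal of $\partial B_R$ with respect to $\bar g$. For a constant vector $a\in\mathbb R^{n+1}$ with $|a|=1$ put $$X_a=\frac{2}{1+r_0^2}\Big[\langle x,a\rangle x-\tfrac12(|x|^2+r_0^2)a\Big],\qquad Y_a=\tfrac12(1-|x|^2)a+\langle x,a\rangle x,\qquad V_a=\frac{2\langle x,a\rangle}{1+|x|^2},$$ where $\langle\,,\rangle$ is the Euclidean inner product. **Proposition 2.2.** Let $M$ be a compact smooth $n$-dimensional manifold with (possibly empty) boundary, and let $x:M\to\bar B_R$ be a smooth immersion with $x(\partial M)\subset\partial B_R$, endowed with the induced metric with area element $dA$, and with a smooth unit normal field $\nu$ along $x$ (so that $M$ is orientable). Let $\theta\in(0,\pi)$ and suppose that $\Sigma=x(M)$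 meets $\partial B_R$ at the constant contact angle $\theta$, i.e. $\bar g(\nu,\bar N)=\cos(\pi-\theta)$ along $\partial M$. Let $h(X,Y)=\bar g(\bar\nabla_X\nu,Y)$ be the second fundamental form, where $\bar\nabla$ is the Levi-Civita connection of $\bar g$, and let $\sigma_j$ be the $j$-th elementary symmetric polynomial of the principal curvatures, i.e. of the eigenvalues of the Weingarten matrix $(h_i^j)$, with $\sigma_0=1$. Then for every $1\le k\le n$ the integrands below are integrable, and $$(n-k+1)\int_{\Sigma}\big[\sigma_{k-1}V_a+\sin R\cos\theta\,\sigma_{k-1}\,\bar g(Y_a,\nu)\big]\,dA=k\int_{\Sigma}\sigma_k\,\bar g(X_a,\nu)\,dA,$$ the integrals over $\Sigma$ being taken over $M$ by means of $x$. -/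

import Mathlib

open scoped Manifold ContDiff

noncomputable section

namespace SphericalCapillary

/-- The coordinate space `ℝ^{n+1}`.  With the metric `gbar` below it is the stereographic model of
the sphere `𝕊^{n+1}` with one point (the south pole) removed. -/
abbrev Ambient (n : ℕ) : Type := EuclideanSpace ℝ (Fin (n + 1))

section AmbientGeometry

variable {n : ℕ}

/-- The spherical metric `4 / (1 + |x|²)² ⟨u, w⟩` at the point `x`. -/
def gbar (x u w : Ambient n) : ℝ := 4 / (1 + ‖x‖ ^ 2) ^ 2 * inner ℝ u w

/-- The Christoffel symbols `Γ_x(u, w)` of the spherical metric, so that its Levi-Civita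
connection is `∇̄_u W = D_u W + Γ_x(u, W)`.  See `christoffel_symm` and `fderiv_gbar`. -/
def christoffel (x u w : Ambient n) : Ambient n :=
  (-2 / (1 + ‖x‖ ^ 2)) • (inner ℝ x u • w + inner ℝ x w • u - inner ℝ u w • x)

/-- The connection given by `christoffel` is torsion free. -/
theorem christoffel_symm (x u w : Ambient n) : christoffel x u w = christoffel x w u := by
  unfold christoffel
  rw [real_inner_comm u w, add_comm (inner ℝ x u • w)]

/-- The connection given by `christoffel` is compatible with the metric `gbar`; together with
`christoffel_symm` this says that it is the Levi-Civita connection. -/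
theorem fderiv_gbar (x z u w : Ambient n) :
    fderiv ℝ (fun y => gbar y u w) x z =
      gbar x (christoffel x z u) w + gbar x u (christoffel x z w) := by
  have hpos : (1 + ‖x‖ ^ 2) ≠ 0 := by positivity
  have h1 : HasFDerivAt (fun y : Ambient n => 1 + ‖y‖ ^ 2) (2 • (innerSL ℝ x)) x :=
    ((hasStrictFDerivAt_norm_sq x).hasFDerivAt).const_add 1
  have h2 := (((hasDerivAt_inv (pow_ne_zero 2 hpos)).comp_hasFDerivAt x
    (h1.pow 2)).const_mul 4).mul_const (inner ℝ u w)
  have h3 : HasFDerivAt (fun y => gbar y u w) _ x := h2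
  rw [h3.fderiv]
  simp only [gbar, christoffel, inner_smul_left, inner_smul_right, inner_sub_left, inner_sub_right,
    inner_add_left, inner_add_right, real_inner_comm u z, real_inner_comm x u]
  simp
  rw [real_inner_comm w z]
  field_simp
  ring

/-- The Euclidean radius `r₀` of the geodesic ball of radius `R` about the north pole, which is the
origin of the model. -/
def euclRadius (R : ℝ) : ℝ := Real.sqrt ((1 - Real.cos R) / (1 + Real.cos R))

/-- The closed geodesic ball of radius `R`, in the model. -/
def geodesicBall (n : ℕ) (R : ℝ) : Set (Ambient n) := Metric.closedBall 0 (euclRadius R)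

/-- The boundary `∂B_R` of the geodesic ball, in the model. -/
def geodesicSphere (n : ℕ) (R : ℝ) : Set (Ambient n) := Metric.sphere 0 (euclRadius R)

/-- The outward unit normal, with respect to `gbar`, of the geodesic sphere about the origin that
passes through `x ≠ 0`. -/
def outwardNormal (x : Ambient n) : Ambient n := ((1 + ‖x‖ ^ 2) / (2 * ‖x‖)) • x

/-- The conformal Killing field `X_a`. -/
def fieldX (R : ℝ) (a x : Ambient n) : Ambient n :=
  (2 / (1 + euclRadius R ^ 2)) •
    (inner ℝ x a • x - ((1 / 2 : ℝ) * (‖x‖ ^ 2 + euclRadius R ^ 2)) • a)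

/-- The field `Y_a`. -/
def fieldY (a x : Ambient n) : Ambient n :=
  ((1 / 2 : ℝ) * (1 - ‖x‖ ^ 2)) • a + inner ℝ x a • x

/-- The function `V_a`. -/
def fieldV (a x : Ambient n) : ℝ := 2 * inner ℝ x a / (1 + ‖x‖ ^ 2)

end AmbientGeometry

section Hypersurface

variable {n : ℕ} [NeZero n] {M : Type*} [TopologicalSpace M]
  [ChartedSpace (EuclideanHalfSpace n) M]

/-- The partial derivative `∂_i f` of `f : M → ℝ^{n+1}` in the preferred chart around `q`, at the
point of `M` with coordinates `y`. -/
def coordDeriv (f : M → Ambient n) (q : M) (y : EuclideanSpace ℝ (Fin n)) (i : Fin n) :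
    Ambient n :=
  fderivWithin ℝ (f ∘ (extChartAt (𝓡∂ n) q).symm) (Set.range (𝓡∂ n)) y
    (EuclideanSpace.single i 1)

/-- The matrix `g_ij = ḡ(∂_i x, ∂_j x)` of the induced metric, in the chart around `q`. -/
def gramMatrix (x : M → Ambient n) (q : M) (y : EuclideanSpace ℝ (Fin n)) :
    Matrix (Fin n) (Fin n) ℝ :=
  Matrix.of fun i j =>
    gbar (x ((extChartAt (𝓡∂ n) q).symm y)) (coordDeriv x q y i) (coordDeriv x q y j)

/-- The covariant derivative `∇̄_{∂_i} ν = ∂_i ν + Γ(∂_i x, ν)` of a vector field `ν` along `x`. -/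
def covDeriv (x ν : M → Ambient n) (q : M) (y : EuclideanSpace ℝ (Fin n)) (i : Fin n) :
    Ambient n :=
  coordDeriv ν q y i +
    christoffel (x ((extChartAt (𝓡∂ n) q).symm y)) (coordDeriv x q y i)
      (ν ((extChartAt (𝓡∂ n) q).symm y))

/-- The matrix `h_ij = ḡ(∇̄_{∂_i} ν, ∂_j x)` of the second fundamental form. -/
def secondFundamentalForm (x ν : M → Ambient n) (q : M) (y : EuclideanSpace ℝ (Fin n)) :
    Matrix (Fin n) (Fin n) ℝ :=
  Matrix.of fun i j =>
    gbar (x ((extChartAt (𝓡∂ n) q).symm y)) (covDeriv x ν q y i) (coordDeriv x q y j)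

/-- The Weingarten matrix `g^{jl} h_{li}`. -/
def weingarten (x ν : M → Ambient n) (q : M) (y : EuclideanSpace ℝ (Fin n)) :
    Matrix (Fin n) (Fin n) ℝ :=
  (gramMatrix x q y)⁻¹ * secondFundamentalForm x ν q y

/-- The principal curvatures at `p`: the eigenvalues of the Weingarten matrix, listed with
multiplicity. -/
def principalCurvatures (x ν : M → Ambient n) (p : M) : Multiset ℝ :=
  (weingarten x ν p (extChartAt (𝓡∂ n) p p)).charpoly.roots

/-- The `k`-th mean curvature at `p`: the `k`-th elementary symmetric polynomial of the principal
curvatures (not normalized, and equal to `1` for `k = 0`). -/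
def sigma (k : ℕ) (x ν : M → Ambient n) (p : M) : ℝ :=
  (principalCurvatures x ν p).esymm k

variable [MeasurableSpace M]

/-- The measure `√(det g_ij) dy` on the domain of the preferred chart around `q`, seen as a measure
on `M`. -/
def chartArea (x : M → Ambient n) (q : M) : MeasureTheory.Measure M :=
  ((MeasureTheory.volume.restrict (extChartAt (𝓡∂ n) q).target).withDensity
    fun y => ENNReal.ofReal (Real.sqrt (gramMatrix x q y).det)).map (extChartAt (𝓡∂ n) q).symm

/-- The area measure `dA` of the induced metric: the least measure on `M` that dominates
`√(det g_ij) dy` on each chart domain.  As these measures agree on the overlaps of the charts, it is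
the measure given by `√(det g_ij) dy` in every chart. -/
def area (x : M → Ambient n) : MeasureTheory.Measure M := ⨆ q : M, chartArea x q

end Hypersurface

end SphericalCapillary

end

/-! The computation takes place in ℝ^{n+2}. Inverse stereographic projection is an isometry onto the
unit sphere minus a point. Hence `P = stereoInv x` is a hypersurface of the sphere with unit normal
`N = stereoDeriv x ν`, and it has the same induced metric and second fundamental form as `x`. Let e
be the north pole, write a also for (0, a), and let A v = ⟨v, e⟩ a - ⟨v, a⟩ e, an antisymmetric map.
Then V_a = ⟨P, a⟩, the field Y_a becomes A P, and X_a becomes cos R · A P minus the tangential part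
of a. With r = cos R, c = sin R cos θ and Z = -a + A (r P + c N), antisymmetry of A gives -⟨Z, P⟩ =
V_a + c ḡ(Y_a, ν) and ⟨Z, N⟩ = ḡ(X_a, ν). Both integrands thus come from the single field Z.

All k are treated at once through a parameter t. Put w_j = ∂_j (P + t N) and let F^i be the
determinant with rows P, N, w_0, …, w_{n-1} in which w_i is replaced by Z. Up to sign and density, F
is the generating function of the Newton tensors applied to the tangential part of Z. In its
divergence the mixed derivatives ∂_i w_j cancel, being symmetric in i, j while the determinant is
antisymmetric (`sum_offDiag_frameDet_eq_zero`). The derivatives of P yield the terms (n - k) σ_k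
(-⟨Z, P⟩) t^k, those of N yield -(k + 1) σ_{k+1} ⟨Z, N⟩ t^k, and those of Z yield nothing, because
they pair antisymmetric with symmetric matrices (`sum_frameDet_update_infRot`, `sum_frameDet_eq`).

Along the boundary ⟨P, e⟩ = r, and the contact angle condition says ⟨N, e⟩ = c. The vector e - (r P
+ c N) is then orthogonal to P, N, Z and to every w_j tangent to the boundary. It is nonzero because
its product with e is 1 - r² - c² = (sin R sin θ)². So the normal component of F vanishes
(`frameDet_capillaryField_eq_zero`) and there is no boundary flux.

A partition of unity reduces the divergence theorem to a half-space; the extra terms containing dρ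
add up to zero (`integral_localizedIntegrand_eq_zero`, `integral_minkowskiIntegrand_eq_zero`). The
resulting polynomial in t vanishes for all t ≠ 0, so each coefficient is zero, and that of t^(k-1)
is the formula. -/

noncomputable section

namespace SphericalCapillary

/-! ### Frame determinants, and elementary symmetric functions of g⁻¹h -/

section LinearAlgebra

open Matrix
open scoped MatrixOrder

/-- The determinant of a square matrix, as a continuous multilinear map of its rows. -/
def detRows (m : ℕ) : ContinuousMultilinearMap ℝ (fun _ : Fin m => Fin m → ℝ) ℝ :=
  { (Matrix.detRowAlternating (R := ℝ) (n := Fin m)).toMultilinearMap with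
    cont := Continuous.matrix_det (A := fun M : Fin m → Fin m → ℝ => Matrix.of M) continuous_id }

theorem detRows_apply {m : ℕ} (v : Fin m → Fin m → ℝ) : detRows m v = (Matrix.of v).det := rfl

theorem det_updateRow_eq_sum_adjugate {m : ℕ} (A : Matrix (Fin m) (Fin m) ℝ) (i : Fin m)
    (b : Fin m → ℝ) : (A.updateRow i b).det = ∑ j, b j * A.adjugate j i := by
  rw [← cramer_transpose_apply, cramer_eq_adjugate_mulVec, ← adjugate_transpose]
  simp [mulVec, dotProduct, mul_comm]

theorem sum_det_updateRow {m : ℕ} (A B : Matrix (Fin m) (Fin m) ℝ) :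
    ∑ i, (A.updateRow i (B i)).det = (B * A.adjugate).trace := by
  simp [det_updateRow_eq_sum_adjugate, trace, mul_apply]

/-- Jacobi's formula: the determinant is multilinear in its rows, and expanding along a replaced row
produces the adjugate. -/
theorem hasDerivAt_det_add_smul {m : ℕ} (g h : Matrix (Fin m) (Fin m) ℝ) (t : ℝ) :
    HasDerivAt (fun s : ℝ => (g + s • h).det) (h * (g + t • h).adjugate).trace t := by
  have hrow : ∀ i : Fin m, HasFDerivAt (fun s : ℝ => (g + s • h) i)
      ((ContinuousLinearMap.id ℝ ℝ).smulRight (h i)) t := by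
    intro i
    have := (((hasDerivAt_id t).smul_const (h i)).const_add (g i)).hasFDerivAt
    refine this.congr_fderiv ?_
    ext
    simp
  have := (HasFDerivAt.multilinear_comp (f := detRows m) hrow).hasDerivAt
  refine this.congr_deriv ?_
  rw [← sum_det_updateRow]
  simp [detRows_apply]
  rfl

/-- The determinant of the matrix with rows `p`, `ν`, `v 0`, …, `v (n - 1)`. -/
def frameDet {n : ℕ} (p ν : Fin (n + 2) → ℝ) (v : Fin n → Fin (n + 2) → ℝ) : ℝ :=
  (Matrix.of (vecCons p (vecCons ν v))).det

theorem det_eq_of_col_zero {m : ℕ} (A : Matrix (Fin (m + 1)) (Fin (m + 1)) ℝ)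
    (h : ∀ i : Fin m, A i.succ 0 = 0) :
    A.det = A 0 0 * (A.submatrix Fin.succ Fin.succ).det := by
  rw [det_succ_column_zero, Fin.sum_univ_succ]
  simp [h]

theorem det_eq_of_row_zero {m : ℕ} (A : Matrix (Fin (m + 1)) (Fin (m + 1)) ℝ)
    (h : ∀ i : Fin m, A 0 i.succ = 0) :
    A.det = A 0 0 * (A.submatrix Fin.succ Fin.succ).det := by
  rw [← det_transpose, det_eq_of_col_zero _ h, ← det_transpose]
  rfl

theorem frameDet_mul_frameDet {n : ℕ} (a b p ν : Fin (n + 2) → ℝ)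
    (v e : Fin n → Fin (n + 2) → ℝ) :
    frameDet a b v * frameDet p ν e =
      (Matrix.of fun i j => vecCons a (vecCons b v) i ⬝ᵥ vecCons p (vecCons ν e) j).det := by
  unfold frameDet
  rw [← det_transpose (Matrix.of (vecCons p _)), ← det_mul]
  rfl

/-- The matrix of the dot products of two families of vectors. -/
def dotMatrix {n m : ℕ} (v e : Fin n → Fin m → ℝ) : Matrix (Fin n) (Fin n) ℝ :=
  Matrix.of fun i j => v i ⬝ᵥ e j

theorem dotMatrix_apply {n m : ℕ} (v e : Fin n → Fin m → ℝ) (i j : Fin n) :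
    dotMatrix v e i j = v i ⬝ᵥ e j := rfl

/-- The product is the determinant of the mixed Gram matrix of the two frames. The relations
satisfied by p, ν and e clear its first two rows to the right of the diagonal, so `v` may be
arbitrary. -/
theorem frameDet_mul_of_normal {n : ℕ} {p ν : Fin (n + 2) → ℝ} {e : Fin n → Fin (n + 2) → ℝ}
    (hpp : p ⬝ᵥ p = 1) (hνν : ν ⬝ᵥ ν = 1) (hpν : p ⬝ᵥ ν = 0)
    (hpe : ∀ i, p ⬝ᵥ e i = 0) (hνe : ∀ i, ν ⬝ᵥ e i = 0) (v : Fin n → Fin (n + 2) → ℝ) :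
    frameDet p ν v * frameDet p ν e = (dotMatrix v e).det := by
  rw [frameDet_mul_frameDet, det_eq_of_row_zero, det_eq_of_row_zero]
  · simp [hpp, hνν]
    rfl
  · intro i; simp [hνe]
  · intro i
    refine Fin.cases ?_ (fun j => ?_) i <;> simp [hpν, hpe]

/-- The same Gram matrix, now with its first two columns cleared below the diagonal because `v` is
tangential. Only the component of `z` along `p` survives. -/
theorem frameDet_mul_of_tangent {n : ℕ} {p ν : Fin (n + 2) → ℝ} (hνν : ν ⬝ᵥ ν = 1)
    (hpν : p ⬝ᵥ ν = 0) {v : Fin n → Fin (n + 2) → ℝ}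
    (hpv : ∀ i, v i ⬝ᵥ p = 0) (hνv : ∀ i, v i ⬝ᵥ ν = 0) (z : Fin (n + 2) → ℝ)
    (e : Fin n → Fin (n + 2) → ℝ) :
    frameDet z ν v * frameDet p ν e = (z ⬝ᵥ p) * (dotMatrix v e).det := by
  rw [frameDet_mul_frameDet, det_eq_of_col_zero, det_eq_of_col_zero]
  · simp [hνν]
    left
    rfl
  · intro i; simp [hνv]
  · intro i
    refine Fin.cases ?_ (fun j => ?_) i
    · simp [dotProduct_comm ν p, hpν]
    · simp [hpv]

theorem frameDet_swap {n : ℕ} (p ν : Fin (n + 2) → ℝ) (v : Fin n → Fin (n + 2) → ℝ) :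
    frameDet p ν v = -frameDet ν p v := by
  have := (Matrix.detRowAlternating (R := ℝ) (n := Fin (n + 2))).map_swap
    (vecCons ν (vecCons p v)) (i := 0) (j := 1) (by simp)
  refine Eq.trans ?_ this
  unfold frameDet
  change _ = (Matrix.of ((vecCons ν (vecCons p v)) ∘ ⇑(Equiv.swap 0 1))).det
  congr 2
  funext i
  refine Fin.cases ?_ (fun j => Fin.cases ?_ (fun k => ?_) j) i
  · simp
  · simp
  · rw [Function.comp, Equiv.swap_apply_of_ne_of_ne] <;> simp [Fin.ext_iff]

theorem frameDet_update_swap {n : ℕ} (w ν : Fin (n + 2) → ℝ) (v : Fin n → Fin (n + 2) → ℝ)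
    (i : Fin n) (z : Fin (n + 2) → ℝ) :
    frameDet w ν (Function.update v i z) = -frameDet z ν (Function.update v i w) := by
  have hne : (0 : Fin (n + 2)) ≠ i.succ.succ := by simp [Fin.ext_iff]
  have := (Matrix.detRowAlternating (R := ℝ) (n := Fin (n + 2))).map_swap
    (vecCons z (vecCons ν (Function.update v i w))) hne
  refine Eq.trans ?_ this
  unfold frameDet
  change _ = (Matrix.of ((vecCons z (vecCons ν (Function.update v i w))) ∘
    ⇑(Equiv.swap 0 i.succ.succ))).det
  congr 2
  funext j
  refine Fin.cases ?_ (fun j => Fin.cases ?_ (fun k => ?_) j) j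
  · simp
  · rw [Function.comp, Equiv.swap_apply_of_ne_of_ne] <;> simp [Fin.ext_iff]
  · by_cases hk : k = i
    · subst hk; simp
    · rw [Function.comp, Equiv.swap_apply_of_ne_of_ne]
      · simp [hk]
      · simp [Fin.ext_iff]
      · simpa [Fin.ext_iff] using hk

/-- A common orthogonal vector lies in the kernel of the matrix of rows. This is the mechanism
behind the vanishing of the boundary flux. -/
theorem frameDet_eq_zero_of_orthogonal {n : ℕ} {p ν q : Fin (n + 2) → ℝ}
    {v : Fin n → Fin (n + 2) → ℝ} (hq : q ≠ 0) (hp : p ⬝ᵥ q = 0) (hν : ν ⬝ᵥ q = 0)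
    (hv : ∀ i, v i ⬝ᵥ q = 0) : frameDet p ν v = 0 := by
  refine Matrix.exists_mulVec_eq_zero_iff.mp ⟨q, hq, ?_⟩
  funext i
  refine Fin.cases ?_ (fun j => Fin.cases ?_ (fun k => ?_) j) i
  · exact hp
  · exact hν
  · exact hv k

theorem eq_zero_of_frameDet_ne_zero {n : ℕ} {p ν d : Fin (n + 2) → ℝ}
    {e : Fin n → Fin (n + 2) → ℝ} (h0 : frameDet p ν e ≠ 0) (hp : p ⬝ᵥ d = 0) (hν : ν ⬝ᵥ d = 0)
    (he : ∀ i, e i ⬝ᵥ d = 0) : d = 0 := by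
  by_contra hd
  exact h0 (frameDet_eq_zero_of_orthogonal hd hp hν he)

theorem frameDet_update_update {n : ℕ} (p ν : Fin (n + 2) → ℝ) (v : Fin n → Fin (n + 2) → ℝ)
    {i j : Fin n} (hij : i ≠ j) (z w : Fin (n + 2) → ℝ) :
    frameDet p ν (Function.update (Function.update v i z) j w) =
      -frameDet p ν (Function.update (Function.update v j z) i w) := by
  have hne : i.succ.succ ≠ j.succ.succ := by simpa using hij
  have := (Matrix.detRowAlternating (R := ℝ) (n := Fin (n + 2))).map_swap
    (vecCons p (vecCons ν (Function.update (Function.update v j z) i w))) hne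
  refine Eq.trans ?_ this
  unfold frameDet
  change _ = (Matrix.of ((vecCons p (vecCons ν (Function.update (Function.update v j z) i w))) ∘
    ⇑(Equiv.swap i.succ.succ j.succ.succ))).det
  congr 2
  funext k
  refine Fin.cases ?_ (fun k => Fin.cases ?_ (fun k => ?_) k) k
  · rw [Function.comp, Equiv.swap_apply_of_ne_of_ne] <;> simp [Fin.ext_iff]
  · rw [Function.comp, Equiv.swap_apply_of_ne_of_ne] <;> simp [Fin.ext_iff]
  · by_cases hki : k = i
    · subst hki; simp [hij, Function.update_of_ne hij.symm]
    · by_cases hkj : k = j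
      · subst hkj; simp
      · rw [Function.comp, Equiv.swap_apply_of_ne_of_ne]
        · simp [hki, hkj]
        · simpa using hki
        · simpa using hkj

theorem dotMatrix_update {n m : ℕ} (v e : Fin n → Fin m → ℝ) (i : Fin n) (w : Fin m → ℝ) :
    dotMatrix (Function.update v i w) e = (dotMatrix v e).updateRow i (fun j => w ⬝ᵥ e j) := by
  ext k j
  by_cases hk : k = i
  · subst hk; simp [dotMatrix]
  · simp [dotMatrix, hk]

theorem trace_mul_eq_zero_of_symm_antisymm {n : ℕ} {A S : Matrix (Fin n) (Fin n) ℝ}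
    (hA : A.IsSymm) (hS : Sᵀ = -S) : (S * A).trace = 0 := by
  have h1 : (S * A).trace = -(S * A).trace := by
    conv_lhs => rw [← trace_transpose, transpose_mul, hS, hA.eq, mul_neg, trace_neg, trace_mul_comm]
  linarith

/-- Elementary symmetric polynomials of the eigenvalues as coefficients of `det (1 + t W)`. -/
theorem det_one_add_smul_eq_sum_esymm {n : ℕ} {W : Matrix (Fin n) (Fin n) ℝ}
    (hW : W.charpoly.Splits) (t : ℝ) :
    (1 + t • W).det = ∑ k ∈ Finset.range (n + 1), W.charpoly.roots.esymm k * t ^ k := by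
  have hdeg : W.charpoly.natDegree = n := by simp [charpoly_natDegree_eq_dim]
  have hcard : Multiset.card W.charpoly.roots = W.charpoly.natDegree :=
    hW.natDegree_eq_card_roots.symm
  by_cases ht : t = 0
  · subst ht
    rw [Finset.sum_eq_single 0]
    · simp [Multiset.esymm]
    · intro k _ hk; simp [hk]
    · simp
  -- This turns the determinant into the characteristic polynomial evaluated at -1/t.
  have h1 : (1 + t • W) = (-t) • (scalar (Fin n) (-t⁻¹) - W) := by
    ext i j
    by_cases hij : i = j
    · subst hij; simp; field_simp; ring
    · simp [hij]
  rw [h1, det_smul, Fintype.card_fin, ← eval_charpoly, Polynomial.eval_eq_sum_range, hdeg,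
    Finset.mul_sum, ← Finset.sum_range_reflect]
  refine Finset.sum_congr rfl fun k hk => ?_
  have hk' : k ≤ n := by simpa [Nat.lt_succ_iff] using hk
  have e1 : n + 1 - 1 - k = n - k := by omega
  rw [e1, Polynomial.coeff_eq_esymm_roots_of_card hcard (by rw [hdeg]; omega), hdeg,
    (charpoly_monic W).leadingCoeff, Nat.sub_sub_self hk', one_mul]
  have e2 : (-t) ^ n = (-t) ^ k * (-t) ^ (n - k) := by rw [← pow_add]; congr 1; omega
  rw [e2]
  have e3 : (-t) ^ (n - k) * (-t⁻¹) ^ (n - k) = 1 := by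
    rw [← mul_pow]; simp [ht]
  calc (-t) ^ k * (-t) ^ (n - k) * ((-1) ^ k * W.charpoly.roots.esymm k * (-t⁻¹) ^ (n - k))
      = ((-t) ^ (n - k) * (-t⁻¹) ^ (n - k)) * ((-1) ^ k * (-t) ^ k) *
        W.charpoly.roots.esymm k := by ring
    _ = _ := by rw [e3, ← mul_pow]; ring

theorem esymm_roots_charpoly {n : ℕ} {W : Matrix (Fin n) (Fin n) ℝ}
    (hW : W.charpoly.Splits) {k : ℕ} (hk : k ≤ n) :
    W.charpoly.roots.esymm k = (-1) ^ k * W.charpoly.coeff (n - k) := by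
  have hdeg : W.charpoly.natDegree = n := by simp [charpoly_natDegree_eq_dim]
  have hcard : Multiset.card W.charpoly.roots = W.charpoly.natDegree :=
    hW.natDegree_eq_card_roots.symm
  rw [Polynomial.coeff_eq_esymm_roots_of_card hcard (by rw [hdeg]; omega), hdeg,
    (charpoly_monic W).leadingCoeff, Nat.sub_sub_self hk, one_mul, ← mul_assoc, ← mul_pow]
  simp

/-- Writing g = BᵀB, the matrix g⁻¹h is conjugate to the symmetric matrix B⁻ᵀhB⁻¹. So all n
eigenvalues are real, and the multiset of real roots that defines the curvatures loses none of them.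
-/
theorem splits_charpoly_inv_mul {n : ℕ} {g h : Matrix (Fin n) (Fin n) ℝ} (hg : g.PosDef)
    (hh : h.IsSymm) : (g⁻¹ * h).charpoly.Splits := by
  obtain ⟨B, hB⟩ := CStarAlgebra.nonneg_iff_eq_star_mul_self.mp hg.posSemidef.nonneg
  have hBT : g = Bᵀ * B := by simpa [star_eq_conjTranspose] using hB
  have hdet : IsUnit B.det := by
    have := hg.det_pos
    rw [hBT, det_mul, det_transpose] at this
    exact (isUnit_iff_ne_zero).mpr (by rintro h0; simp [h0] at this)
  have hdT : IsUnit Bᵀ.det := by rwa [det_transpose]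
  obtain ⟨U, hU⟩ := (isUnit_iff_isUnit_det B).mpr hdet
  have h1 : g⁻¹ * h = B⁻¹ * (Bᵀ⁻¹ * h * B⁻¹) * B := by
    rw [hBT, Matrix.mul_inv_rev]
    simp only [Matrix.mul_assoc, nonsing_inv_mul _ hdet, Matrix.mul_one]
  rw [h1]
  have := charpoly_units_conj' U (Bᵀ⁻¹ * h * B⁻¹)
  rw [hU] at this
  rw [this]
  refine IsHermitian.splits_charpoly ?_
  rw [IsHermitian, conjTranspose_eq_transpose_of_trivial, transpose_mul, transpose_mul, hh.eq,
    transpose_nonsing_inv, transpose_nonsing_inv, transpose_transpose, Matrix.mul_assoc]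

theorem det_add_smul_eq_sum {n : ℕ} {g h : Matrix (Fin n) (Fin n) ℝ} (hg : g.PosDef)
    (hh : h.IsSymm) (t : ℝ) :
    (g + t • h).det =
      g.det * ∑ k ∈ Finset.range (n + 1), (g⁻¹ * h).charpoly.roots.esymm k * t ^ k := by
  have hu : IsUnit g.det := (isUnit_iff_ne_zero).mpr hg.det_pos.ne'
  rw [← det_one_add_smul_eq_sum_esymm (splits_charpoly_inv_mul hg hh), ← det_mul, Matrix.mul_add,
    Matrix.mul_one, Matrix.mul_smul, mul_nonsing_inv_cancel_left _ _ hu]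

/-- Both sides are the derivative of det (g + t h) in t, one by Jacobi's formula and one by
differentiating the expansion in powers of t. -/
theorem trace_mul_adjugate_add_smul {n : ℕ} {g h : Matrix (Fin n) (Fin n) ℝ} (hg : g.PosDef)
    (hh : h.IsSymm) (t : ℝ) :
    (h * (g + t • h).adjugate).trace = g.det *
      ∑ k ∈ Finset.range n, ((k : ℝ) + 1) * (g⁻¹ * h).charpoly.roots.esymm (k + 1) * t ^ k := by
  have h1 := hasDerivAt_det_add_smul g h t
  have h2 : HasDerivAt (fun s : ℝ => g.det * ∑ k ∈ Finset.range (n + 1),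
      (g⁻¹ * h).charpoly.roots.esymm k * s ^ k) (g.det * ∑ k ∈ Finset.range (n + 1),
      (g⁻¹ * h).charpoly.roots.esymm k * ((k : ℝ) * t ^ (k - 1))) t := by
    refine HasDerivAt.const_mul _ ?_
    refine HasDerivAt.fun_sum fun k _ => ?_
    exact (hasDerivAt_pow k t).const_mul _
  have h3 : (fun s : ℝ => (g + s • h).det) = _ := funext (det_add_smul_eq_sum hg hh)
  rw [h3] at h1
  rw [h1.unique h2, Finset.sum_range_succ']
  simp only [Nat.cast_zero, zero_mul, mul_zero, add_zero, Nat.cast_add, Nat.cast_one,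
    Nat.add_sub_cancel]
  congr 1
  exact Finset.sum_congr rfl fun k _ => by ring

/-- Since (g + t h) adj (g + t h) is det (g + t h) times the identity, this trace and t times the
previous one add up to n det (g + t h). -/
theorem trace_mul_adjugate_add_smul' {n : ℕ} {g h : Matrix (Fin n) (Fin n) ℝ} (hg : g.PosDef)
    (hh : h.IsSymm) (t : ℝ) :
    (g * (g + t • h).adjugate).trace = g.det *
      ∑ k ∈ Finset.range n, ((n : ℝ) - k) * (g⁻¹ * h).charpoly.roots.esymm k * t ^ k := by
  have h1 : (g * (g + t • h).adjugate).trace + t * (h * (g + t • h).adjugate).trace =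
      n * (g + t • h).det := by
    rw [← smul_eq_mul t, ← trace_smul, ← trace_add, ← Matrix.smul_mul, ← Matrix.add_mul,
      mul_adjugate]
    simp [mul_comm]
  rw [trace_mul_adjugate_add_smul hg hh, det_add_smul_eq_sum hg hh] at h1
  have h2 : (g * (g + t • h).adjugate).trace = g.det * (n * ∑ k ∈ Finset.range (n + 1),
      (g⁻¹ * h).charpoly.roots.esymm k * t ^ k - t * ∑ k ∈ Finset.range n,
      ((k : ℝ) + 1) * (g⁻¹ * h).charpoly.roots.esymm (k + 1) * t ^ k) := by
    linear_combination h1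
  rw [h2]
  congr 1
  have h3 : t * ∑ k ∈ Finset.range n,
      ((k : ℝ) + 1) * (g⁻¹ * h).charpoly.roots.esymm (k + 1) * t ^ k =
      ∑ k ∈ Finset.range (n + 1), (k : ℝ) * (g⁻¹ * h).charpoly.roots.esymm k * t ^ k := by
    rw [Finset.sum_range_succ', Finset.mul_sum]
    simp only [Nat.cast_zero, zero_mul, add_zero, Nat.cast_add, Nat.cast_one]
    exact Finset.sum_congr rfl fun k _ => by ring
  rw [h3, Finset.mul_sum, ← Finset.sum_sub_distrib, Finset.sum_range_succ]
  simp only [sub_self, add_zero, ← mul_assoc, ← sub_mul]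

end LinearAlgebra

/-! ### The divergence identity at a point -/

section PointwiseIdentity

open Matrix

/-- The infinitesimal rotation `v ↦ ⟨v, e⟩ a - ⟨v, a⟩ e`. -/
def infRot {m : ℕ} (e a v : Fin m → ℝ) : Fin m → ℝ := (v ⬝ᵥ e) • a - (v ⬝ᵥ a) • e

theorem infRot_add {m : ℕ} (e a v w : Fin m → ℝ) :
    infRot e a (v + w) = infRot e a v + infRot e a w := by
  simp only [infRot, add_dotProduct]; module

theorem infRot_smul {m : ℕ} (e a v : Fin m → ℝ) (s : ℝ) :
    infRot e a (s • v) = s • infRot e a v := by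
  simp only [infRot, smul_dotProduct, smul_eq_mul]; module

theorem infRot_dotProduct_antisymm {m : ℕ} (e a v w : Fin m → ℝ) :
    infRot e a v ⬝ᵥ w = -(infRot e a w ⬝ᵥ v) := by
  simp only [infRot, sub_dotProduct, smul_dotProduct, smul_eq_mul, dotProduct_comm a,
    dotProduct_comm e]
  ring

theorem infRot_dotProduct_self {m : ℕ} (e a v : Fin m → ℝ) : infRot e a v ⬝ᵥ v = 0 := by
  have := infRot_dotProduct_antisymm e a v v; linarith

theorem isSymm_dotMatrix_self {n m : ℕ} (e : Fin n → Fin m → ℝ) : (dotMatrix e e).IsSymm := by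
  ext i j; simp [dotMatrix, dotProduct_comm]

theorem dotMatrix_add_smul {n m : ℕ} (e f : Fin n → Fin m → ℝ) (t : ℝ) :
    dotMatrix (fun i => e i + t • f i) e = dotMatrix e e + t • dotMatrix f e := by
  ext i j; simp [dotMatrix, add_dotProduct]

/-- `p` is the position vector of a hypersurface of the unit sphere of `ℝ^{n+2}`, `ν` its unit
normal, and `e`, `f` are the partial derivatives of the position vector and of the normal. -/
structure IsHypersurfaceFrame {n : ℕ} (p ν : Fin (n + 2) → ℝ) (e f : Fin n → Fin (n + 2) → ℝ) :
    Prop where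
  pp : p ⬝ᵥ p = 1
  νν : ν ⬝ᵥ ν = 1
  pν : p ⬝ᵥ ν = 0
  ep : ∀ i, e i ⬝ᵥ p = 0
  eν : ∀ i, e i ⬝ᵥ ν = 0
  fp : ∀ i, f i ⬝ᵥ p = 0
  fν : ∀ i, f i ⬝ᵥ ν = 0
  posDef : (dotMatrix e e).PosDef
  symm : (dotMatrix f e).IsSymm

namespace IsHypersurfaceFrame

variable {n : ℕ} {p ν : Fin (n + 2) → ℝ} {e f : Fin n → Fin (n + 2) → ℝ}
  (H : IsHypersurfaceFrame p ν e f)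
include H

theorem frameDet_mul (v : Fin n → Fin (n + 2) → ℝ) :
    frameDet p ν v * frameDet p ν e = (dotMatrix v e).det :=
  frameDet_mul_of_normal H.pp H.νν H.pν (fun i => by rw [dotProduct_comm, H.ep])
    (fun i => by rw [dotProduct_comm, H.eν]) v

theorem frameDet_sq : frameDet p ν e ^ 2 = (dotMatrix e e).det := by
  rw [sq, H.frameDet_mul]

theorem frameDet_ne_zero : frameDet p ν e ≠ 0 := by
  intro h
  have := H.frameDet_sq
  have h2 := H.posDef.det_pos
  rw [← this, h] at h2
  simp at h2

/-- Weingarten's equation: the difference of the two sides is orthogonal to p, ν and all e_j, which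
form a basis. -/
theorem derivNormal_eq (i : Fin n) :
    f i = ∑ l, (dotMatrix f e * (dotMatrix e e)⁻¹) i l • e l := by
  rw [← sub_eq_zero]
  have hu : IsUnit (dotMatrix e e).det := (isUnit_iff_ne_zero).mpr H.posDef.det_pos.ne'
  refine eq_zero_of_frameDet_ne_zero H.frameDet_ne_zero ?_ ?_ fun j => ?_
  · simp [dotProduct_comm p, sub_dotProduct, sum_dotProduct, H.fp, H.ep]
  · simp [dotProduct_comm ν, sub_dotProduct, sum_dotProduct, H.fν, H.eν]
  · rw [dotProduct_comm, sub_dotProduct, sum_dotProduct, sub_eq_zero]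
    have h1 : (dotMatrix f e * (dotMatrix e e)⁻¹) * dotMatrix e e = dotMatrix f e := by
      rw [Matrix.mul_assoc, nonsing_inv_mul _ hu, Matrix.mul_one]
    have h2 := congrFun (congrFun h1 i) j
    rw [mul_apply] at h2
    simp only [smul_dotProduct, smul_eq_mul]
    exact h2.symm

theorem isSymm_add_smul (t : ℝ) : (dotMatrix e e + t • dotMatrix f e).IsSymm :=
  (isSymm_dotMatrix_self e).add (H.symm.smul t)

theorem sum_frameDet_update (t : ℝ) (w : Fin n → Fin (n + 2) → ℝ) :
    (∑ i, frameDet p ν (Function.update (fun i => e i + t • f i) i (w i))) * frameDet p ν e =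
      (dotMatrix w e * (dotMatrix e e + t • dotMatrix f e).adjugate).trace := by
  rw [← sum_det_updateRow, Finset.sum_mul]
  refine Finset.sum_congr rfl fun i _ => ?_
  rw [H.frameDet_mul, dotMatrix_update, dotMatrix_add_smul]
  rfl

/-- The derivative of the rotation part of Z does not contribute. Let M = g + t h and let S be the
antisymmetric matrix of the rotation in the frame e. The r-part is tr (S adj M) = 0. In the c-part,
t h g⁻¹ S = M g⁻¹ S - S, and M cancels against adj M, which leaves a multiple of tr (g⁻¹ S) = 0.
Dividing by t is where t ≠ 0 enters. -/
theorem sum_frameDet_update_infRot {t : ℝ} (ht : t ≠ 0) (b a : Fin (n + 2) → ℝ) (r c : ℝ) :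
    ∑ i, frameDet p ν (Function.update (fun i => e i + t • f i) i
      (infRot b a (r • e i + c • f i))) = 0 := by
  have h0 := H.frameDet_ne_zero
  refine (mul_eq_zero.mp ?_).resolve_right h0
  rw [H.sum_frameDet_update]
  set g := dotMatrix e e with hg
  set h := dotMatrix f e with hh
  set S := dotMatrix (fun i => infRot b a (e i)) e with hS
  set M := g + t • h with hM
  have hu : IsUnit g.det := (isUnit_iff_ne_zero).mpr H.posDef.det_pos.ne'
  have hSanti : Sᵀ = -S := by
    ext i j
    exact infRot_dotProduct_antisymm b a (e j) (e i)
  have hMsymm : M.IsSymm := H.isSymm_add_smul t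
  have hB : dotMatrix (fun i => infRot b a (r • e i + c • f i)) e =
      r • S + c • (h * g⁻¹ * S) := by
    ext i j
    have h1 : infRot b a (f i) ⬝ᵥ e j = (h * g⁻¹ * S) i j := by
      rw [Matrix.mul_apply]
      conv_lhs => rw [H.derivNormal_eq i]
      rw [infRot_dotProduct_antisymm, dotProduct_sum, ← Finset.sum_neg_distrib]
      refine Finset.sum_congr rfl fun l _ => ?_
      rw [dotProduct_smul, infRot_dotProduct_antisymm b a (e j), smul_eq_mul, hS, dotMatrix_apply]
      ring
    rw [dotMatrix_apply, infRot_add, infRot_smul, infRot_smul, add_dotProduct, smul_dotProduct,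
      smul_dotProduct, h1]
    rfl
  have h1 : (S * M.adjugate).trace = 0 := trace_mul_eq_zero_of_symm_antisymm hMsymm.adjugate hSanti
  have h2 : t • (h * g⁻¹ * S) = M * g⁻¹ * S - S := by
    rw [hM, Matrix.add_mul, Matrix.add_mul, mul_nonsing_inv _ hu, Matrix.one_mul, Matrix.smul_mul,
      Matrix.smul_mul]
    abel
  have h3 : t * (h * g⁻¹ * S * M.adjugate).trace = 0 := by
    rw [← smul_eq_mul, ← trace_smul, ← Matrix.smul_mul, h2, Matrix.sub_mul, trace_sub, h1,
      trace_mul_comm, ← Matrix.mul_assoc, ← Matrix.mul_assoc, adjugate_mul, Matrix.smul_mul,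
      Matrix.smul_mul, Matrix.one_mul, trace_smul, trace_mul_comm,
      trace_mul_eq_zero_of_symm_antisymm _ hSanti]
    · simp
    · rw [IsSymm, transpose_nonsing_inv, (isSymm_dotMatrix_self e).eq]
  have h4 := (mul_eq_zero.mp h3).resolve_left ht
  rw [hB, Matrix.add_mul, trace_add, Matrix.smul_mul, Matrix.smul_mul, trace_smul, trace_smul, h1,
    h4]
  simp

/-- The divergence of the Newton-type vector field, evaluated pointwise. -/
theorem sum_frameDet_eq {t : ℝ} (ht : t ≠ 0) (b a z : Fin (n + 2) → ℝ) (r c : ℝ) :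
    (∑ i, (frameDet (e i) ν (Function.update (fun i => e i + t • f i) i z) +
      frameDet p (f i) (Function.update (fun i => e i + t • f i) i z) +
      frameDet p ν (Function.update (fun i => e i + t • f i) i
        (infRot b a (r • e i + c • f i))))) * frameDet p ν e =
      (dotMatrix e e).det * ∑ k ∈ Finset.range n, t ^ k *
        (((n : ℝ) - k) * ((dotMatrix e e)⁻¹ * dotMatrix f e).charpoly.roots.esymm k * -(z ⬝ᵥ p) -
          ((k : ℝ) + 1) * ((dotMatrix e e)⁻¹ * dotMatrix f e).charpoly.roots.esymm (k + 1) *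
            (z ⬝ᵥ ν)) := by
  have hνp : ν ⬝ᵥ p = 0 := by rw [dotProduct_comm, H.pν]
  have hφp : ∀ w : Fin (n + 2) → ℝ, w ⬝ᵥ p = 0 → ∀ i j,
      (Function.update (fun i => e i + t • f i) i w) j ⬝ᵥ p = 0 := by
    intro w hw i j
    by_cases hj : j = i
    · subst hj; simpa using hw
    · simp [hj, add_dotProduct, H.ep, H.fp]
  have hφν : ∀ w : Fin (n + 2) → ℝ, w ⬝ᵥ ν = 0 → ∀ i j,
      (Function.update (fun i => e i + t • f i) i w) j ⬝ᵥ ν = 0 := by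
    intro w hw i j
    by_cases hj : j = i
    · subst hj; simpa using hw
    · simp [hj, add_dotProduct, H.eν, H.fν]
  rw [Finset.sum_add_distrib, Finset.sum_add_distrib, H.sum_frameDet_update_infRot ht, add_zero,
    add_mul, Finset.sum_mul, Finset.sum_mul]
  -- Exchanging `e i` with `z` brings `z` to the first slot and leaves tangential vectors in the
  -- others, so only ⟨z, p⟩ remains. For `f i` in the slot of the normal the same exchange leaves
  -- only ⟨z, ν⟩.
  have h1 : ∀ i, frameDet (e i) ν (Function.update (fun i => e i + t • f i) i z) *
      frameDet p ν e = -(z ⬝ᵥ p) *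
        ((dotMatrix e e + t • dotMatrix f e).updateRow i (dotMatrix e e i)).det := by
    intro i
    rw [frameDet_update_swap, neg_mul, frameDet_mul_of_tangent H.νν H.pν (hφp _ (H.ep i) i)
      (hφν _ (H.eν i) i), dotMatrix_update, dotMatrix_add_smul, neg_mul]
    rfl
  have h2 : ∀ i, frameDet p (f i) (Function.update (fun i => e i + t • f i) i z) *
      frameDet p ν e = -(z ⬝ᵥ ν) *
        ((dotMatrix e e + t • dotMatrix f e).updateRow i (dotMatrix f e i)).det := by
    intro i
    rw [frameDet_swap p (f i), frameDet_update_swap, frameDet_swap p ν, neg_neg, mul_neg,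
      frameDet_mul_of_tangent H.pp hνp (hφν _ (H.fν i) i)
      (hφp _ (H.fp i) i), dotMatrix_update, dotMatrix_add_smul, neg_mul]
    rfl
  rw [Finset.sum_congr rfl fun i _ => h1 i, Finset.sum_congr rfl fun i _ => h2 i,
    ← Finset.mul_sum, ← Finset.mul_sum, sum_det_updateRow, sum_det_updateRow,
    trace_mul_adjugate_add_smul H.posDef H.symm, trace_mul_adjugate_add_smul' H.posDef H.symm,
    mul_left_comm, mul_left_comm (-(z ⬝ᵥ ν)), ← mul_add, Finset.mul_sum, Finset.mul_sum,
    ← Finset.sum_add_distrib]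
  congr 1
  exact Finset.sum_congr rfl fun k _ => by ring

end IsHypersurfaceFrame

end PointwiseIdentity

/-! ### Invariance under change of frame -/

section ChangeOfFrame

open Matrix

/-- The pairing of the vector field `T(z)` with a covector `r`, where `T` is the generating function
`adj (g + t h) / det g` of the Newton tensors. -/
def newtonPairing {n : ℕ} (g h : Matrix (Fin n) (Fin n) ℝ) (t : ℝ) (z r : Fin n → ℝ) : ℝ :=
  (vecMulVec r z * (g + t • h).adjugate).trace / g.det

/-- Numerator and denominator both acquire the factor (det J)². The pairing is therefore independent
of the chart and defines a function on the manifold. -/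
theorem newtonPairing_conj {n : ℕ} (g h J : Matrix (Fin n) (Fin n) ℝ) (hJ : J.det ≠ 0) (t : ℝ)
    (z r : Fin n → ℝ) :
    newtonPairing (J * g * Jᵀ) (J * h * Jᵀ) t (J *ᵥ z) (J *ᵥ r) = newtonPairing g h t z r := by
  unfold newtonPairing
  have h1 : J * g * Jᵀ + t • (J * h * Jᵀ) = J * (g + t • h) * Jᵀ := by
    rw [Matrix.mul_add, Matrix.add_mul, Matrix.mul_smul, Matrix.smul_mul]
  have h2 : vecMulVec (J *ᵥ r) (J *ᵥ z) = J * vecMulVec r z * Jᵀ := by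
    rw [mul_vecMulVec, vecMulVec_mul, vecMul_transpose]
  rw [h1, h2, adjugate_mul_distrib, adjugate_mul_distrib, det_mul, det_mul, det_transpose]
  have h3 : J * vecMulVec r z * Jᵀ * (Jᵀ.adjugate * ((g + t • h).adjugate * J.adjugate)) =
      J.det • (J * (vecMulVec r z * (g + t • h).adjugate) * J.adjugate) := by
    calc _ = J * vecMulVec r z * (Jᵀ * Jᵀ.adjugate) * ((g + t • h).adjugate * J.adjugate) := by
          simp only [Matrix.mul_assoc]
      _ = _ := by
          rw [mul_adjugate, det_transpose]
          simp only [Matrix.mul_assoc, Matrix.mul_smul, Matrix.smul_mul, Matrix.one_mul]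
  rw [h3, trace_smul, trace_mul_comm, ← Matrix.mul_assoc, adjugate_mul, Matrix.smul_mul,
    Matrix.one_mul, trace_smul]
  simp only [smul_eq_mul]
  field_simp

theorem newtonPairing_sum {n : ℕ} (g h : Matrix (Fin n) (Fin n) ℝ) (t : ℝ) (z : Fin n → ℝ)
    {ι : Type*} (s : Finset ι) (r : ι → Fin n → ℝ) :
    newtonPairing g h t z (∑ i ∈ s, r i) = ∑ i ∈ s, newtonPairing g h t z (r i) := by
  unfold newtonPairing
  rw [← Finset.sum_div, ← trace_sum, ← Finset.sum_mul]
  congr 4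
  ext i j
  rw [Matrix.sum_apply]
  simp [vecMulVec_apply, Finset.sum_mul]

theorem newtonPairing_zero {n : ℕ} (g h : Matrix (Fin n) (Fin n) ℝ) (t : ℝ) (z : Fin n → ℝ) :
    newtonPairing g h t z 0 = 0 := by
  simp [newtonPairing]

/-- A change of frame conjugates g⁻¹h by Jᵀ, so the principal curvatures do not depend on the chart.
-/
theorem charpoly_inv_mul_conj {n : ℕ} (g h J : Matrix (Fin n) (Fin n) ℝ) (hJ : J.det ≠ 0) :
    ((J * g * Jᵀ)⁻¹ * (J * h * Jᵀ)).charpoly = (g⁻¹ * h).charpoly := by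
  have hu : IsUnit J.det := (isUnit_iff_ne_zero).mpr hJ
  obtain ⟨U, hU⟩ := (isUnit_iff_isUnit_det Jᵀ).mpr (by rwa [det_transpose])
  have := charpoly_units_conj' U (g⁻¹ * h)
  rw [hU] at this
  rw [← this, Matrix.mul_inv_rev, Matrix.mul_inv_rev]
  congr 1
  simp only [Matrix.mul_assoc]
  rw [nonsing_inv_mul_cancel_left _ _ hu]

namespace IsHypersurfaceFrame

variable {n : ℕ} {p ν : Fin (n + 2) → ℝ} {e f : Fin n → Fin (n + 2) → ℝ}
  (H : IsHypersurfaceFrame p ν e f)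
include H

theorem sum_mul_frameDet_update (t : ℝ) (z : Fin (n + 2) → ℝ) (r : Fin n → ℝ) :
    (∑ i, r i * frameDet p ν (Function.update (fun i => e i + t • f i) i z)) * frameDet p ν e =
      (dotMatrix e e).det *
        newtonPairing (dotMatrix e e) (dotMatrix f e) t (fun j => z ⬝ᵥ e j) r := by
  unfold newtonPairing
  rw [mul_div_cancel₀ _ H.posDef.det_pos.ne', ← sum_det_updateRow, Finset.sum_mul]
  refine Finset.sum_congr rfl fun i _ => ?_
  rw [mul_assoc, H.frameDet_mul, dotMatrix_update, dotMatrix_add_smul]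
  have : vecMulVec r (fun j => z ⬝ᵥ e j) i = r i • fun j => z ⬝ᵥ e j := by
    ext j; simp [vecMulVec_apply]
  rw [this, det_updateRow_smul]

end IsHypersurfaceFrame

end ChangeOfFrame

/-! ### Differentiating the determinant field -/

section LocalDivergence

open Matrix

variable {n : ℕ} {V : Type*} [NormedAddCommGroup V] [NormedSpace ℝ V]

theorem hasFDerivAt_frameDet {p ν : V → Fin (n + 2) → ℝ} {w : Fin n → V → Fin (n + 2) → ℝ}
    {p' ν' : V →L[ℝ] Fin (n + 2) → ℝ} {w' : Fin n → V →L[ℝ] Fin (n + 2) → ℝ} {y : V}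
    (hp : HasFDerivAt p p' y) (hν : HasFDerivAt ν ν' y)
    (hw : ∀ j, HasFDerivAt (w j) (w' j) y) :
    ∃ L : V →L[ℝ] ℝ, HasFDerivAt (fun y => frameDet (p y) (ν y) (fun j => w j y)) L y ∧
      ∀ v, L v = frameDet (p' v) (ν y) (fun j => w j y) + frameDet (p y) (ν' v) (fun j => w j y) +
        ∑ j, frameDet (p y) (ν y) (Function.update (fun j => w j y) j (w' j v)) := by
  have hrow : ∀ i : Fin (n + 2),
      HasFDerivAt (vecCons p (vecCons ν w) i) (vecCons p' (vecCons ν' w') i) y := by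
    intro i
    refine Fin.cases ?_ (fun j => Fin.cases ?_ (fun k => ?_) j) i
    · exact hp
    · exact hν
    · exact hw k
  have key := HasFDerivAt.multilinear_comp (f := detRows (n + 2)) hrow
  have hcons : ∀ y, (fun i => vecCons p (vecCons ν w) i y) =
      vecCons (p y) (vecCons (ν y) (fun j => w j y)) := by
    intro y
    funext i
    refine Fin.cases ?_ (fun j => Fin.cases ?_ (fun k => ?_) j) i <;> rfl
  refine ⟨_, key.congr_of_eventuallyEq (Filter.Eventually.of_forall fun y => ?_), fun v => ?_⟩
  · simp only [hcons]; rfl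
  · simp only [hcons]
    rw [_root_.sum_apply, Fin.sum_univ_succ, Fin.sum_univ_succ, ← add_assoc]
    congr 1
    · congr 1
      · simp only [detRows_apply, frameDet, ContinuousLinearMap.comp_apply,
          ContinuousMultilinearMap.toContinuousLinearMap_apply]
        congr 2
        funext i
        refine Fin.cases ?_ (fun j => ?_) i <;> simp
      · simp only [detRows_apply, frameDet, ContinuousLinearMap.comp_apply,
          ContinuousMultilinearMap.toContinuousLinearMap_apply]
        congr 2
        funext i
        refine Fin.cases ?_ (fun j => Fin.cases ?_ (fun k => ?_) j) i <;> simp [Fin.ext_iff]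
    · refine Finset.sum_congr rfl fun j _ => ?_
      simp only [detRows_apply, frameDet, ContinuousLinearMap.comp_apply,
          ContinuousMultilinearMap.toContinuousLinearMap_apply]
      congr 2
      funext i
      refine Fin.cases ?_ (fun l => Fin.cases ?_ (fun k => ?_) l) i
      · simp [Fin.ext_iff]
      · simp [Fin.ext_iff]
      · by_cases hk : k = j
        · subst hk; simp
        · simp [hk]

/-- Exchanging i and j changes the sign of the determinant but fixes the symmetric `s`. With `s` the
mixed second derivatives, this cancellation plays the role of the Codazzi equation. -/
theorem sum_offDiag_frameDet_eq_zero (p ν z : Fin (n + 2) → ℝ) (w : Fin n → Fin (n + 2) → ℝ)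
    (s : Fin n → Fin n → Fin (n + 2) → ℝ) (hs : ∀ i j, s i j = s j i) :
    ∑ i, ∑ j, (if j = i then 0 else
      frameDet p ν (Function.update (Function.update w i z) j (s i j))) = 0 := by
  set T : Fin n → Fin n → ℝ := fun i j => if j = i then 0 else
      frameDet p ν (Function.update (Function.update w i z) j (s i j)) with hT
  have hanti : ∀ i j, T i j = -T j i := by
    intro i j
    by_cases hij : j = i
    · simp [hT, hij]
    · simp only [hT, hij, if_false, Ne.symm hij]
      rw [frameDet_update_update p ν w (Ne.symm hij), hs]
  have h1 : ∑ i, ∑ j, T i j = -∑ i, ∑ j, T i j := by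
    conv_rhs => rw [Finset.sum_comm]
    rw [← Finset.sum_neg_distrib]
    refine Finset.sum_congr rfl fun i _ => ?_
    rw [← Finset.sum_neg_distrib]
    exact Finset.sum_congr rfl fun j _ => hanti i j
  change ∑ i, ∑ j, T i j = 0
  linarith

/-- The divergence of the vector field `det (p, ν, w 0, …, z, …, w (n - 1))`, with `z` in the `i`-th
place, when the `w i` are partial derivatives of a function. -/
theorem exists_hasFDerivAt_frameDet_update {p ν z : V → Fin (n + 2) → ℝ}
    {w : Fin n → V → Fin (n + 2) → ℝ} {p' ν' z' : V →L[ℝ] Fin (n + 2) → ℝ}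
    {w' : Fin n → V →L[ℝ] Fin (n + 2) → ℝ} {y : V}
    (hp : HasFDerivAt p p' y) (hν : HasFDerivAt ν ν' y) (hz : HasFDerivAt z z' y)
    (hw : ∀ j, HasFDerivAt (w j) (w' j) y) (b : Fin n → V)
    (hsymm : ∀ i j, w' j (b i) = w' i (b j)) :
    ∃ L : Fin n → V →L[ℝ] ℝ,
      (∀ i, HasFDerivAt (fun y => frameDet (p y) (ν y)
        (Function.update (fun j => w j y) i (z y))) (L i) y) ∧
      ∑ i, L i (b i) = ∑ i,
        (frameDet (p' (b i)) (ν y) (Function.update (fun j => w j y) i (z y)) +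
          frameDet (p y) (ν' (b i)) (Function.update (fun j => w j y) i (z y)) +
          frameDet (p y) (ν y) (Function.update (fun j => w j y) i (z' (b i)))) := by
  have hupd : ∀ i y, (fun j => Function.update w i z j y) =
      Function.update (fun j => w j y) i (z y) := by
    intro i y
    funext j
    by_cases hj : j = i
    · subst hj; simp
    · simp [hj]
  have hw2 : ∀ i j, HasFDerivAt (Function.update w i z j) (Function.update w' i z' j) y := by
    intro i j
    by_cases hj : j = i
    · subst hj; simpa using hz
    · simpa [hj] using hw j
  choose L hL hLv using fun i => hasFDerivAt_frameDet hp hν (hw2 i)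
  simp only [hupd] at hL hLv
  refine ⟨L, hL, ?_⟩
  have hsum := sum_offDiag_frameDet_eq_zero (p y) (ν y) (z y) (fun j => w j y)
    (fun i j => w' j (b i)) hsymm
  rw [Finset.sum_congr rfl fun i _ => hLv i (b i), Finset.sum_add_distrib,
    Finset.sum_add_distrib (f := fun i => _ + _)]
  congr 1
  rw [← sub_eq_zero, ← Finset.sum_sub_distrib, ← hsum]
  refine Finset.sum_congr rfl fun i _ => ?_
  -- The entry j = i is the derivative falling on z and accounts for the claimed term; the entries j
  -- ≠ i form a row of the vanishing off-diagonal sum.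
  rw [← Finset.sum_erase_add _ _ (Finset.mem_univ i)]
  conv_rhs => rw [← Finset.sum_erase_add _ _ (Finset.mem_univ i)]
  simp only [Function.update_self, Function.update_idem, if_true, add_zero, add_sub_cancel_right]
  refine Finset.sum_congr rfl fun j hj => ?_
  have hji : j ≠ i := (Finset.mem_erase.mp hj).1
  simp [hji]

end LocalDivergence

/-! ### Partial derivatives in charts modelled on the half-space -/

section ChartDerivatives

open Set Filter Topology

theorem hasFDerivWithinAt_dotProduct {V : Type*} [NormedAddCommGroup V] [NormedSpace ℝ V] {m : ℕ}
    {f g : V → Fin m → ℝ} {f' g' : V →L[ℝ] Fin m → ℝ} {s : Set V} {y : V}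
    (hf : HasFDerivWithinAt f f' s y) (hg : HasFDerivWithinAt g g' s y) :
    ∃ D : V →L[ℝ] ℝ, HasFDerivWithinAt (fun y => f y ⬝ᵥ g y) D s y ∧
      ∀ v, D v = f' v ⬝ᵥ g y + f y ⬝ᵥ g' v := by
  have h := HasFDerivWithinAt.fun_sum (u := Finset.univ) fun i _ =>
    ((hasFDerivWithinAt_pi'.mp hf i).mul (hasFDerivWithinAt_pi'.mp hg i))
  refine ⟨_, h, fun v => ?_⟩
  rw [_root_.sum_apply, dotProduct, dotProduct, ← Finset.sum_add_distrib]
  refine Finset.sum_congr rfl fun i _ => ?_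
  simp only [_root_.add_apply, _root_.smul_apply,
    ContinuousLinearMap.comp_apply, ContinuousLinearMap.proj_apply, smul_eq_mul]
  ring


variable {n : ℕ} [NeZero n] {M : Type*} [TopologicalSpace M]
  [ChartedSpace (EuclideanHalfSpace n) M]
  {F : Type*} [NormedAddCommGroup F] [NormedSpace ℝ F]

/-- The partial derivative `∂_i f` of a vector-valued function in the preferred chart around `q`. -/
def chartDeriv (f : M → F) (q : M) (y : EuclideanSpace ℝ (Fin n)) (i : Fin n) : F :=
  fderivWithin ℝ (f ∘ (extChartAt (𝓡∂ n) q).symm) (Set.range (𝓡∂ n)) y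
    (EuclideanSpace.single i 1)

theorem coordDeriv_eq_chartDeriv (f : M → Ambient n) (q : M) (y : EuclideanSpace ℝ (Fin n))
    (i : Fin n) : coordDeriv f q y i = chartDeriv f q y i := rfl

theorem uniqueDiffWithinAt_range {q : M} {y : EuclideanSpace ℝ (Fin n)}
    (hy : y ∈ (extChartAt (𝓡∂ n) q).target) :
    UniqueDiffWithinAt ℝ (Set.range (𝓡∂ n)) y :=
  (𝓡∂ n).uniqueDiffOn y (extChartAt_target_subset_range q hy)

theorem chartDeriv_eq_fderivWithin_target (f : M → F) (q : M) {y : EuclideanSpace ℝ (Fin n)}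
    (hy : y ∈ (extChartAt (𝓡∂ n) q).target) (i : Fin n) :
    chartDeriv f q y i = fderivWithin ℝ (f ∘ (extChartAt (𝓡∂ n) q).symm)
      (extChartAt (𝓡∂ n) q).target y (EuclideanSpace.single i 1) := by
  unfold chartDeriv
  rw [fderivWithin_congr_set (extChartAt_target_eventuallyEq_of_mem hy)]

theorem target_mem_nhds_of_pos {q : M} {y : EuclideanSpace ℝ (Fin n)}
    (hy : y ∈ (extChartAt (𝓡∂ n) q).target) (h0 : 0 < y 0) :
    (extChartAt (𝓡∂ n) q).target ∈ 𝓝 y := by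
  have h1 : Set.range (𝓡∂ n) ∈ 𝓝 y := by
    rw [mem_nhds_iff]
    refine ⟨_, interior_subset, isOpen_interior, ?_⟩
    rw [interior_range_modelWithCornersEuclideanHalfSpace]
    exact h0
  have h2 := extChartAt_target_mem_nhdsWithin_of_mem hy
  rwa [nhdsWithin_eq_nhds.mpr h1] at h2

theorem nonneg_of_mem_target {q : M} {y : EuclideanSpace ℝ (Fin n)}
    (hy : y ∈ (extChartAt (𝓡∂ n) q).target) : 0 ≤ y 0 := by
  have := extChartAt_target_subset_range q hy
  rwa [range_modelWithCornersEuclideanHalfSpace] at this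

theorem measurableSet_extChartAt_target (q : M) :
    MeasurableSet (extChartAt (𝓡∂ n) q).target := by
  rw [extChartAt_target]
  refine MeasurableSet.inter ?_ ?_
  · exact ((chartAt (EuclideanHalfSpace n) q).open_target.preimage
      (𝓡∂ n).continuous_symm).measurableSet
  · exact (𝓡∂ n).isClosed_range.measurableSet

theorem chartDeriv_eq_of_hasFDerivWithinAt {f : M → F} {q : M}
    {y : EuclideanSpace ℝ (Fin n)} (hy : y ∈ (extChartAt (𝓡∂ n) q).target)
    {D : EuclideanSpace ℝ (Fin n) →L[ℝ] F}
    (hD : HasFDerivWithinAt (f ∘ (extChartAt (𝓡∂ n) q).symm) D (extChartAt (𝓡∂ n) q).target y)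
    (i : Fin n) : chartDeriv f q y i = D (EuclideanSpace.single i 1) := by
  rw [chartDeriv_eq_fderivWithin_target f q hy,
    hD.fderivWithin (uniqueDiffOn_extChartAt_target q y hy)]

theorem chartDeriv_const (c : F) (q : M) (y : EuclideanSpace ℝ (Fin n)) (i : Fin n) :
    chartDeriv (fun _ : M => c) q y i = 0 := by
  unfold chartDeriv
  rw [show (fun _ : M => c) ∘ (extChartAt (𝓡∂ n) q).symm = fun _ => c from rfl]
  simp

variable [IsManifold (𝓡∂ n) ∞ M]

theorem contDiffOn_comp_extChartAt_symm {f : M → F} (hf : ContMDiff (𝓡∂ n) 𝓘(ℝ, F) ∞ f) (q : M) :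
    ContDiffOn ℝ ∞ (f ∘ (extChartAt (𝓡∂ n) q).symm) (extChartAt (𝓡∂ n) q).target := by
  rw [← contMDiffOn_iff_contDiffOn]
  exact hf.comp_contMDiffOn (contMDiffOn_extChartAt_symm q)

theorem contDiffOn_chartDeriv {f : M → F} (hf : ContMDiff (𝓡∂ n) 𝓘(ℝ, F) ∞ f) (q : M)
    (i : Fin n) :
    ContDiffOn ℝ ∞ (fun y => chartDeriv f q y i) (extChartAt (𝓡∂ n) q).target := by
  have h1 := (contDiffOn_comp_extChartAt_symm hf q).fderivWithin (m := ∞)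
    (uniqueDiffOn_extChartAt_target q) (by simp)
  refine (h1.clm_apply (contDiffOn_const (c := EuclideanSpace.single i (1 : ℝ)))).congr ?_
  intro y hy
  exact chartDeriv_eq_fderivWithin_target f q hy i

theorem hasFDerivWithinAt_comp_symm {f : M → F} (hf : ContMDiff (𝓡∂ n) 𝓘(ℝ, F) ∞ f) (q : M)
    {y : EuclideanSpace ℝ (Fin n)} (hy : y ∈ (extChartAt (𝓡∂ n) q).target) :
    HasFDerivWithinAt (f ∘ (extChartAt (𝓡∂ n) q).symm)
      (fderivWithin ℝ (f ∘ (extChartAt (𝓡∂ n) q).symm) (extChartAt (𝓡∂ n) q).target y)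
      (extChartAt (𝓡∂ n) q).target y :=
  ((contDiffOn_comp_extChartAt_symm hf q).differentiableOn (by simp) y hy).hasFDerivWithinAt

/-- Symmetry holds up to the boundary, since the chart target is a set of unique differentiability
contained in the closure of its interior. -/
theorem chartDeriv_chartDeriv_symm {f : M → F} (hf : ContMDiff (𝓡∂ n) 𝓘(ℝ, F) ∞ f) (q : M)
    {y : EuclideanSpace ℝ (Fin n)} (hy : y ∈ (extChartAt (𝓡∂ n) q).target) (i j : Fin n) :
    fderivWithin ℝ (fun y => chartDeriv f q y j) (extChartAt (𝓡∂ n) q).target y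
        (EuclideanSpace.single i 1) =
      fderivWithin ℝ (fun y => chartDeriv f q y i) (extChartAt (𝓡∂ n) q).target y
        (EuclideanSpace.single j 1) := by
  have hu := uniqueDiffOn_extChartAt_target (I := 𝓡∂ n) (𝕜 := ℝ) q
  have hs := (contDiffOn_comp_extChartAt_symm hf q y hy).isSymmSndFDerivWithinAt
    (by rw [minSmoothness_of_isRCLikeNormedField]; exact WithTop.coe_le_coe.mpr le_top) hu
    (by
      have := extChartAt_target_subset_closure_interior (I := 𝓡∂ n) (x := q) hy
      exact this) hy
  have h1 := ((contDiffOn_comp_extChartAt_symm hf q).fderivWithin (m := ∞) hu (by simp)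
    |>.differentiableOn (by simp) y hy).hasFDerivWithinAt
  have h2 : ∀ k l : Fin n, fderivWithin ℝ (fun y => chartDeriv f q y k)
      (extChartAt (𝓡∂ n) q).target y (EuclideanSpace.single l 1) =
      fderivWithin ℝ (fderivWithin ℝ (f ∘ (extChartAt (𝓡∂ n) q).symm) (extChartAt (𝓡∂ n) q).target)
        (extChartAt (𝓡∂ n) q).target y (EuclideanSpace.single l 1)
        (EuclideanSpace.single k 1) := by
    intro k l
    have h3 := (h1.clm_apply (hasFDerivWithinAt_const (EuclideanSpace.single k (1 : ℝ)) y _))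
    have h4 := h3.congr (f₁ := fun y => chartDeriv f q y k)
      (fun z hz => chartDeriv_eq_fderivWithin_target f q hz k)
      (chartDeriv_eq_fderivWithin_target f q hy k)
    rw [h4.fderivWithin (hu y hy)]
    simp
  rw [h2, h2]
  exact hs _ _

theorem chartDeriv_dotProduct {m : ℕ} {f g : M → Fin m → ℝ}
    (hf : ContMDiff (𝓡∂ n) 𝓘(ℝ, Fin m → ℝ) ∞ f) (hg : ContMDiff (𝓡∂ n) 𝓘(ℝ, Fin m → ℝ) ∞ g)
    (q : M) {y : EuclideanSpace ℝ (Fin n)} (hy : y ∈ (extChartAt (𝓡∂ n) q).target) (i : Fin n) :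
    chartDeriv (fun m => f m ⬝ᵥ g m) q y i =
      chartDeriv f q y i ⬝ᵥ g ((extChartAt (𝓡∂ n) q).symm y) +
        f ((extChartAt (𝓡∂ n) q).symm y) ⬝ᵥ chartDeriv g q y i := by
  obtain ⟨D, hD, hDv⟩ := hasFDerivWithinAt_dotProduct (hasFDerivWithinAt_comp_symm hf q hy)
    (hasFDerivWithinAt_comp_symm hg q hy)
  rw [chartDeriv_eq_of_hasFDerivWithinAt (f := fun m => f m ⬝ᵥ g m) hy hD i, hDv,
    chartDeriv_eq_fderivWithin_target f q hy, chartDeriv_eq_fderivWithin_target g q hy]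
  rfl

/-- The matrix of the coordinate change between two preferred charts. -/
def transMatrix (q' q z : M) : Matrix (Fin n) (Fin n) ℝ :=
  Matrix.of fun i j => tangentCoordChange (𝓡∂ n) q' q z (EuclideanSpace.single i 1) j

theorem det_transMatrix (q' q z : M) :
    (transMatrix (n := n) q' q z).det = (tangentCoordChange (𝓡∂ n) q' q z).det := by
  rw [ContinuousLinearMap.det, ← LinearMap.det_toMatrix (EuclideanSpace.basisFun (Fin n) ℝ).toBasis,
    ← Matrix.det_transpose]
  congr 1

theorem det_transMatrix_ne_zero {q' q z : M} (hz' : z ∈ (extChartAt (𝓡∂ n) q').source)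
    (hz : z ∈ (extChartAt (𝓡∂ n) q).source) : (transMatrix (n := n) q' q z).det ≠ 0 := by
  have h1 : (tangentCoordChange (𝓡∂ n) q q' z).comp (tangentCoordChange (𝓡∂ n) q' q z) =
      ContinuousLinearMap.id ℝ _ := by
    ext1 v
    rw [ContinuousLinearMap.comp_apply, tangentCoordChange_comp ⟨⟨hz', hz⟩, hz'⟩,
      tangentCoordChange_self hz']
    rfl
  intro h0
  rw [det_transMatrix] at h0
  have h2 := congrArg ContinuousLinearMap.det h1
  unfold ContinuousLinearMap.det at h2 h0
  rw [ContinuousLinearMap.toLinearMap_comp, LinearMap.det_comp, h0] at h2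
  simp at h2

theorem chartDeriv_change {f : M → F} (hf : ContMDiff (𝓡∂ n) 𝓘(ℝ, F) ∞ f) {q' q z : M}
    (hz' : z ∈ (extChartAt (𝓡∂ n) q').source) (hz : z ∈ (extChartAt (𝓡∂ n) q).source) (i : Fin n) :
    chartDeriv f q' (extChartAt (𝓡∂ n) q' z) i =
      ∑ j, transMatrix (n := n) q' q z i j • chartDeriv f q (extChartAt (𝓡∂ n) q z) j := by
  have hy' := (extChartAt (𝓡∂ n) q').map_source hz'
  have hy := (extChartAt (𝓡∂ n) q).map_source hz
  have h1 := hasFDerivWithinAt_comp_symm hf q hy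
  have h1' : HasFDerivWithinAt (f ∘ (extChartAt (𝓡∂ n) q).symm)
      (fderivWithin ℝ (f ∘ (extChartAt (𝓡∂ n) q).symm) (extChartAt (𝓡∂ n) q).target
        (extChartAt (𝓡∂ n) q z)) (Set.range (𝓡∂ n)) (extChartAt (𝓡∂ n) q z) :=
    h1.mono_of_mem_nhdsWithin (extChartAt_target_mem_nhdsWithin_of_mem hy)
  have h2 := hasFDerivWithinAt_tangentCoordChange (I := 𝓡∂ n) ⟨hz', hz⟩
  have hzz : extChartAt (𝓡∂ n) q z = (extChartAt (𝓡∂ n) q ∘ (extChartAt (𝓡∂ n) q').symm)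
      (extChartAt (𝓡∂ n) q' z) := by
    simp only [Function.comp_apply, (extChartAt (𝓡∂ n) q').left_inv hz']
  have h1'' := h1'
  rw [hzz] at h1''
  have h3 := h1''.comp (extChartAt (𝓡∂ n) q' z) h2 (fun y _ => by
    simp only [Function.comp_apply, extChartAt_coe]
    exact mem_range_self _)
  have hev : f ∘ (extChartAt (𝓡∂ n) q').symm =ᶠ[𝓝[Set.range (𝓡∂ n)] (extChartAt (𝓡∂ n) q' z)]
      (f ∘ (extChartAt (𝓡∂ n) q).symm) ∘
        (extChartAt (𝓡∂ n) q ∘ (extChartAt (𝓡∂ n) q').symm) := by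
    have hcont : Tendsto (extChartAt (𝓡∂ n) q').symm
        (𝓝[Set.range (𝓡∂ n)] (extChartAt (𝓡∂ n) q' z)) (𝓝 z) := by
      have := (continuousAt_extChartAt_symm' (I := 𝓡∂ n) hz').tendsto
      rw [(extChartAt (𝓡∂ n) q').left_inv hz'] at this
      exact this.mono_left nhdsWithin_le_nhds
    filter_upwards [hcont (extChartAt_source_mem_nhds' hz)] with y hy
    simp only [Function.comp_apply]
    rw [(extChartAt (𝓡∂ n) q).left_inv hy]
  have h4 := h3.congr_of_eventuallyEq hev (by
    simp only [Function.comp_apply, (extChartAt (𝓡∂ n) q').left_inv hz',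
      (extChartAt (𝓡∂ n) q).left_inv hz])
  unfold chartDeriv
  rw [h4.fderivWithin (uniqueDiffWithinAt_range hy'), ← hzz,
    h1'.fderivWithin (uniqueDiffWithinAt_range hy), ContinuousLinearMap.comp_apply]
  have hv : tangentCoordChange (𝓡∂ n) q' q z (EuclideanSpace.single i 1) =
      ∑ j, transMatrix (n := n) q' q z i j • EuclideanSpace.single j (1 : ℝ) := by
    ext k
    simp [transMatrix, Pi.single_apply]
  rw [hv, map_sum]
  simp

/-- Being a boundary point may be tested in any chart of the atlas, and a point of the target with
vanishing zeroth coordinate is not interior to the half-space. -/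
theorem mem_boundary_of_chart_eq_zero {q : M} {y : EuclideanSpace ℝ (Fin n)}
    (hy : y ∈ (extChartAt (𝓡∂ n) q).target) (h0 : y 0 = 0) :
    (extChartAt (𝓡∂ n) q).symm y ∈ (𝓡∂ n).boundary M := by
  have hsrc : (extChartAt (𝓡∂ n) q).symm y ∈ (chartAt (EuclideanHalfSpace n) q).source := by
    rw [← extChartAt_source (𝓡∂ n)]
    exact (extChartAt (𝓡∂ n) q).map_target hy
  refine ((𝓡∂ n).isBoundaryPoint_iff_of_mem_atlas (n := ∞) (by simp)
    (chart_mem_atlas (EuclideanHalfSpace n) q) hsrc).mpr ?_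
  have h1 : (chartAt (EuclideanHalfSpace n) q).extend (𝓡∂ n) ((extChartAt (𝓡∂ n) q).symm y) = y :=
    (extChartAt (𝓡∂ n) q).right_inv hy
  rw [h1, frontier, Set.mem_sdiff]
  refine ⟨subset_closure hy, fun hint => ?_⟩
  have h2 := interior_mono (extChartAt_target_subset_range (I := 𝓡∂ n) q) hint
  rw [interior_range_modelWithCornersEuclideanHalfSpace] at h2
  exact absurd h0 (ne_of_gt h2)

end ChartDerivatives

/-! ### The area measure in charts -/

section Area

open Set Filter Topology MeasureTheory

theorem gbar_sum_left {n : ℕ} (p : Ambient n) {ι : Type*} (s : Finset ι) (c : ι → ℝ) (u : ι → Ambient n)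
    (w : Ambient n) : gbar p (∑ i ∈ s, c i • u i) w = ∑ i ∈ s, c i * gbar p (u i) w := by
  simp only [gbar, sum_inner, inner_smul_left, Finset.mul_sum]
  exact Finset.sum_congr rfl fun i _ => by simp; ring

theorem gbar_comm {n : ℕ} (p u w : Ambient n) : gbar p u w = gbar p w u := by
  unfold gbar; rw [real_inner_comm]

variable {n : ℕ} [NeZero n] {M : Type*} [TopologicalSpace M]
  [ChartedSpace (EuclideanHalfSpace n) M]

section Charts

variable [IsManifold (𝓡∂ n) ∞ M]

theorem gramMatrix_change {x : M → Ambient n} (hx : ContMDiff (𝓡∂ n) 𝓘(ℝ, Ambient n) ∞ x)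
    {q' q z : M} (hz' : z ∈ (extChartAt (𝓡∂ n) q').source)
    (hz : z ∈ (extChartAt (𝓡∂ n) q).source) :
    gramMatrix x q' (extChartAt (𝓡∂ n) q' z) = transMatrix (n := n) q' q z *
      gramMatrix x q (extChartAt (𝓡∂ n) q z) * (transMatrix (n := n) q' q z).transpose := by
  ext i j
  simp only [gramMatrix, Matrix.of_apply, (extChartAt (𝓡∂ n) q').left_inv hz',
    (extChartAt (𝓡∂ n) q).left_inv hz, coordDeriv_eq_chartDeriv, chartDeriv_change hx hz' hz]
  rw [gbar_sum_left]
  simp only [gbar_comm (x z) _ (∑ j, _), gbar_sum_left, Matrix.mul_apply, Matrix.transpose_apply,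
    Finset.mul_sum, Finset.sum_mul, Matrix.of_apply]
  rw [Finset.sum_comm]
  refine Finset.sum_congr rfl fun k _ => Finset.sum_congr rfl fun l _ => ?_
  rw [gbar_comm]
  ring

theorem continuousOn_gramMatrix {x : M → Ambient n} (hx : ContMDiff (𝓡∂ n) 𝓘(ℝ, Ambient n) ∞ x)
    (q : M) : ContinuousOn (gramMatrix x q) (extChartAt (𝓡∂ n) q).target := by
  refine continuousOn_pi.mpr fun i => continuousOn_pi.mpr fun j => ?_
  have h1 := (contDiffOn_comp_extChartAt_symm hx q).continuousOn
  have h2 := fun i => (contDiffOn_chartDeriv hx q i).continuousOn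
  unfold gramMatrix gbar
  simp only [Matrix.of_apply, coordDeriv_eq_chartDeriv]
  refine ContinuousOn.mul (ContinuousOn.div continuousOn_const ?_ ?_) ((h2 i).inner (h2 j))
  · exact (continuousOn_const.add ((h1.norm).pow 2)).pow 2
  · intro y _; positivity

theorem continuousOn_sqrt_det_gramMatrix {x : M → Ambient n}
    (hx : ContMDiff (𝓡∂ n) 𝓘(ℝ, Ambient n) ∞ x) (q : M) :
    ContinuousOn (fun y => Real.sqrt (gramMatrix x q y).det) (extChartAt (𝓡∂ n) q).target := by
  refine ContinuousOn.sqrt ?_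
  exact (continuous_id.matrix_det).comp_continuousOn (continuousOn_gramMatrix hx q)

end Charts

theorem measurableSet_inter_preimage_of_continuousOn {α β : Type*} [TopologicalSpace α]
    [MeasurableSpace α] [BorelSpace α] [TopologicalSpace β] [MeasurableSpace β] [BorelSpace β]
    {f : α → β} {s : Set α} (hs : MeasurableSet s) (hf : ContinuousOn f s) {A : Set β}
    (hA : MeasurableSet A) : MeasurableSet (s ∩ f ⁻¹' A) := by
  have h1 := (continuousOn_iff_continuous_domRestrict.mp hf).measurable hA
  have h2 := hs.subtype_image h1
  convert h2 using 1
  ext y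
  simp only [mem_inter_iff, mem_preimage, mem_image, Subtype.exists]
  constructor
  · rintro ⟨h, h'⟩
    exact ⟨y, h, h', rfl⟩
  · rintro ⟨z, h, h', rfl⟩
    exact ⟨h, h'⟩

variable [MeasurableSpace M] [BorelSpace M]

theorem aemeasurable_extChartAt_symm (q : M) :
    AEMeasurable (extChartAt (𝓡∂ n) q).symm
      (volume.restrict (extChartAt (𝓡∂ n) q).target) :=
  (continuousOn_extChartAt_symm q).aemeasurable (measurableSet_extChartAt_target q)

theorem aemeasurable_extChartAt_symm_withDensity (q : M)
    (ρ : EuclideanSpace ℝ (Fin n) → ENNReal) :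
    AEMeasurable (extChartAt (𝓡∂ n) q).symm
      ((volume.restrict (extChartAt (𝓡∂ n) q).target).withDensity ρ) :=
  (aemeasurable_extChartAt_symm q).mono_ac (withDensity_absolutelyContinuous _ _)

theorem chartArea_apply (x : M → Ambient n) (q : M) {A : Set M} (hA : MeasurableSet A) :
    chartArea x q A =
      ∫⁻ y in (extChartAt (𝓡∂ n) q).target ∩ (extChartAt (𝓡∂ n) q).symm ⁻¹' A,
        ENNReal.ofReal (Real.sqrt (gramMatrix x q y).det) := by
  unfold chartArea
  rw [Measure.map_apply_of_aemeasurable (aemeasurable_extChartAt_symm_withDensity q _) hA,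
    withDensity_apply', Measure.restrict_restrict' (measurableSet_extChartAt_target q), inter_comm]

theorem chartArea_compl_source (x : M → Ambient n) (q : M) :
    chartArea x q (extChartAt (𝓡∂ n) q).sourceᶜ = 0 := by
  rw [chartArea_apply x q (isOpen_extChartAt_source q).measurableSet.compl]
  have : (extChartAt (𝓡∂ n) q).target ∩
      (extChartAt (𝓡∂ n) q).symm ⁻¹' (extChartAt (𝓡∂ n) q).sourceᶜ = ∅ := by
    rw [eq_empty_iff_forall_notMem]
    rintro y ⟨h1, h2⟩
    exact h2 ((extChartAt (𝓡∂ n) q).map_target h1)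
  rw [this]
  simp

variable [IsManifold (𝓡∂ n) ∞ M]

/-- Change of variables: the Gram determinant is multiplied by (det J)², so its root supplies
exactly the Jacobian factor |det J|. -/
theorem chartArea_eq_of_subset {x : M → Ambient n} (hx : ContMDiff (𝓡∂ n) 𝓘(ℝ, Ambient n) ∞ x)
    {q' q : M} {A : Set M} (hA : MeasurableSet A) (hA' : A ⊆ (extChartAt (𝓡∂ n) q').source)
    (hAq : A ⊆ (extChartAt (𝓡∂ n) q).source) : chartArea x q' A = chartArea x q A := by
  rw [chartArea_apply x q' hA, chartArea_apply x q hA]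
  set s := (extChartAt (𝓡∂ n) q').target ∩ (extChartAt (𝓡∂ n) q').symm ⁻¹' A with hs
  set τ := extChartAt (𝓡∂ n) q ∘ (extChartAt (𝓡∂ n) q').symm with hτ
  have hsm : MeasurableSet s := measurableSet_inter_preimage_of_continuousOn
    (measurableSet_extChartAt_target q') (continuousOn_extChartAt_symm q') hA
  have himg : (extChartAt (𝓡∂ n) q).target ∩ (extChartAt (𝓡∂ n) q).symm ⁻¹' A = τ '' s := by
    ext y
    constructor
    · rintro ⟨h1, h2⟩
      refine ⟨extChartAt (𝓡∂ n) q' ((extChartAt (𝓡∂ n) q).symm y), ⟨?_, ?_⟩, ?_⟩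
      · exact (extChartAt (𝓡∂ n) q').map_source (hA' h2)
      · rw [mem_preimage, (extChartAt (𝓡∂ n) q').left_inv (hA' h2)]
        exact h2
      · rw [hτ, Function.comp_apply, (extChartAt (𝓡∂ n) q').left_inv (hA' h2),
          (extChartAt (𝓡∂ n) q).right_inv h1]
    · rintro ⟨y, ⟨h1, h2⟩, rfl⟩
      refine ⟨(extChartAt (𝓡∂ n) q).map_source (hAq h2), ?_⟩
      rw [mem_preimage, hτ, Function.comp_apply, (extChartAt (𝓡∂ n) q).left_inv (hAq h2)]
      exact h2
  have hinj : InjOn τ s := by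
    rintro y ⟨h1, h2⟩ y' ⟨h1', h2'⟩ hyy
    have h3 := (extChartAt (𝓡∂ n) q).injOn (hAq h2) (hAq h2') hyy
    exact (extChartAt (𝓡∂ n) q').symm.injOn h1 h1' h3
  have hder : ∀ y ∈ s, HasFDerivWithinAt τ
      (tangentCoordChange (𝓡∂ n) q' q ((extChartAt (𝓡∂ n) q').symm y)) s y := by
    rintro y ⟨h1, h2⟩
    have h3 := hasFDerivWithinAt_tangentCoordChange (I := 𝓡∂ n) ⟨hA' h2, hAq h2⟩
    rw [(extChartAt (𝓡∂ n) q').right_inv h1] at h3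
    exact h3.mono (fun z hz => extChartAt_target_subset_range q' hz.1)
  rw [himg, lintegral_image_eq_lintegral_abs_det_fderiv_mul volume hsm hder hinj]
  refine setLIntegral_congr_fun hsm ?_
  rintro y ⟨h1, h2⟩
  have h3 := gramMatrix_change hx (hA' h2) (hAq h2)
  rw [(extChartAt (𝓡∂ n) q').right_inv h1] at h3
  simp only
  rw [h3, Matrix.det_mul, Matrix.det_mul, Matrix.det_transpose, ← det_transMatrix,
    ← ENNReal.ofReal_mul (abs_nonneg _)]
  congr 1
  rw [mul_right_comm, ← sq, Real.sqrt_mul (sq_nonneg _), Real.sqrt_sq_eq_abs]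
  rfl

/-- The measure `chartArea x q`, plus `area x` restricted to the complement of the chart domain,
dominates every chart measure and hence their supremum. On subsets of the domain the second summand
vanishes. -/
theorem area_apply_of_subset_source {x : M → Ambient n}
    (hx : ContMDiff (𝓡∂ n) 𝓘(ℝ, Ambient n) ∞ x) (q : M) {A : Set M} (hA : MeasurableSet A)
    (hAq : A ⊆ (extChartAt (𝓡∂ n) q).source) : area x A = chartArea x q A := by
  have hS : MeasurableSet (extChartAt (𝓡∂ n) q).source := (isOpen_extChartAt_source q).measurableSet
  refine le_antisymm ?_ (Measure.le_iff'.mp (le_iSup (chartArea x) q) A)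
  have h1 : area x ≤ chartArea x q + (area x).restrict (extChartAt (𝓡∂ n) q).sourceᶜ := by
    refine iSup_le fun q' => Measure.le_iff.mpr fun B hB => ?_
    rw [← measure_inter_add_sdiff B hS, Measure.add_apply, Measure.restrict_apply hB]
    refine add_le_add ?_ ?_
    · have hq' : chartArea x q' (B ∩ (extChartAt (𝓡∂ n) q).source) =
          chartArea x q' (B ∩ (extChartAt (𝓡∂ n) q).source ∩ (extChartAt (𝓡∂ n) q').source) := by
        refine (measure_inter_conull' ?_).symm
        exact measure_mono_null (fun z hz => hz.2) (chartArea_compl_source x q')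
      rw [hq', chartArea_eq_of_subset hx
        ((hB.inter hS).inter (isOpen_extChartAt_source q').measurableSet) inter_subset_right
        (fun z hz => hz.1.2)]
      exact measure_mono (fun z hz => hz.1.1)
    · exact Measure.le_iff'.mp (le_iSup (chartArea x) q') _
  have h2 := Measure.le_iff'.mp h1 A
  rw [Measure.add_apply, Measure.restrict_apply hA] at h2
  have h3 : A ∩ (extChartAt (𝓡∂ n) q).sourceᶜ = ∅ := by
    rw [← sdiff_eq, sdiff_eq_empty.mpr hAq]
  rw [h3] at h2
  simpa using h2

theorem area_restrict_source {x : M → Ambient n}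
    (hx : ContMDiff (𝓡∂ n) 𝓘(ℝ, Ambient n) ∞ x) (q : M) :
    (area x).restrict (extChartAt (𝓡∂ n) q).source = chartArea x q := by
  have hS : MeasurableSet (extChartAt (𝓡∂ n) q).source := (isOpen_extChartAt_source q).measurableSet
  ext A hA
  rw [Measure.restrict_apply hA, area_apply_of_subset_source hx q (hA.inter hS) inter_subset_right]
  exact measure_inter_conull' (measure_mono_null (fun z hz => hz.2) (chartArea_compl_source x q))

theorem chartArea_lt_top_of_isCompact [T2Space M] {x : M → Ambient n}
    (hx : ContMDiff (𝓡∂ n) 𝓘(ℝ, Ambient n) ∞ x) (q : M) {K : Set M} (hK : IsCompact K)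
    (hKq : K ⊆ (extChartAt (𝓡∂ n) q).source) : chartArea x q K < ⊤ := by
  rw [chartArea_apply x q hK.measurableSet]
  have h1 : (extChartAt (𝓡∂ n) q).target ∩ (extChartAt (𝓡∂ n) q).symm ⁻¹' K =
      extChartAt (𝓡∂ n) q '' K := by
    rw [(extChartAt (𝓡∂ n) q).image_eq_target_inter_inv_preimage hKq]
  have hcomp : IsCompact (extChartAt (𝓡∂ n) q '' K) :=
    hK.image_of_continuousOn ((continuousOn_extChartAt q).mono hKq)
  rw [h1]
  have hsub : extChartAt (𝓡∂ n) q '' K ⊆ (extChartAt (𝓡∂ n) q).target := by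
    rw [← h1]; exact inter_subset_left
  have h2 := (continuousOn_sqrt_det_gramMatrix hx q).mono hsub
  exact (h2.integrableOn_compact (μ := volume) hcomp).lintegral_lt_top

theorem isFiniteMeasure_area [T2Space M] [CompactSpace M] {x : M → Ambient n}
    (hx : ContMDiff (𝓡∂ n) 𝓘(ℝ, Ambient n) ∞ x) : IsFiniteMeasure (area x) := by
  have : LocallyCompactSpace M := inferInstance
  constructor
  refine isCompact_univ.induction_on (p := fun s => area x s < ⊤) (by simp)
    (fun s t hst ht => (measure_mono hst).trans_lt ht)
    (fun s t hs ht => (measure_union_le s t).trans_lt (ENNReal.add_lt_top.mpr ⟨hs, ht⟩)) ?_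
  intro z _
  obtain ⟨K, hKn, hKs, hKc⟩ := local_compact_nhds (extChartAt_source_mem_nhds (I := 𝓡∂ n) z)
  refine ⟨K, mem_nhdsWithin_of_mem_nhds hKn, ?_⟩
  rw [area_apply_of_subset_source hx z hKc.measurableSet hKs]
  exact chartArea_lt_top_of_isCompact hx z hKc hKs

theorem integral_area_eq_of_support_subset {x : M → Ambient n}
    (hx : ContMDiff (𝓡∂ n) 𝓘(ℝ, Ambient n) ∞ x) (q : M) {G : M → ℝ} (hG : Continuous G)
    (hGq : ∀ z ∉ (extChartAt (𝓡∂ n) q).source, G z = 0) :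
    ∫ z, G z ∂(area x) = ∫ y in (extChartAt (𝓡∂ n) q).target,
      Real.sqrt (gramMatrix x q y).det * G ((extChartAt (𝓡∂ n) q).symm y) := by
  rw [← setIntegral_eq_integral_of_forall_compl_eq_zero hGq, area_restrict_source hx q]
  unfold chartArea
  rw [integral_map (aemeasurable_extChartAt_symm_withDensity q _) hG.aestronglyMeasurable,
    integral_withDensity_eq_integral_toReal_smul₀]
  · refine integral_congr_ae (Eventually.of_forall fun y => ?_)
    simp only [smul_eq_mul, ENNReal.toReal_ofReal (Real.sqrt_nonneg _)]
  · exact ((continuousOn_sqrt_det_gramMatrix hx q).aemeasurable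
      (measurableSet_extChartAt_target q)).ennreal_ofReal
  · exact Eventually.of_forall fun y => ENNReal.ofReal_lt_top

end Area

/-! ### The divergence theorem on a half-space -/

section HalfSpace

open Set Filter Topology MeasureTheory

/-- The divergence theorem on a half-space, for a vector field with compact support that is
tangential on the boundary. -/
theorem integral_divergence_halfSpace {n : ℕ} [NeZero n]
    (F : Fin n → EuclideanSpace ℝ (Fin n) → ℝ)
    (F' : Fin n → EuclideanSpace ℝ (Fin n) → EuclideanSpace ℝ (Fin n) →L[ℝ] ℝ)
    {K : Set (EuclideanSpace ℝ (Fin n))} (hK : IsCompact K)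
    (hF : ∀ i, ContinuousOn (F i) {y | 0 ≤ y 0})
    (hFK : ∀ i y, 0 ≤ y 0 → y ∉ K → F i y = 0)
    (hFK' : ∀ y, 0 ≤ y 0 → y ∉ K → ∑ i, F' i y (EuclideanSpace.single i 1) = 0)
    (hd : ∀ i y, 0 < y 0 → HasFDerivAt (F i) (F' i y) y)
    (h0 : ∀ y, y 0 = 0 → F 0 y = 0)
    (hint : IntegrableOn (fun y => ∑ i, F' i y (EuclideanSpace.single i 1)) {y | 0 ≤ y 0}) :
    ∫ y in {y : EuclideanSpace ℝ (Fin n) | 0 ≤ y 0},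
      ∑ i, F' i y (EuclideanSpace.single i 1) = 0 := by
  obtain ⟨m, rfl⟩ := Nat.exists_eq_succ_of_ne_zero (NeZero.ne n)
  obtain ⟨r, hr⟩ := hK.isBounded.subset_closedBall 0
  set L : ℝ := max r 0 + 1 with hL
  have hLpos : 0 < L := by positivity
  have hKL : ∀ y ∈ K, ∀ i, |y i| < L := by
    intro y hy i
    have h1 := hr hy
    rw [mem_closedBall_zero_iff] at h1
    have h2 := PiLp.norm_apply_le y i
    rw [Real.norm_eq_abs] at h2
    have : r ≤ max r 0 := le_max_left _ _
    linarith
  set e := (EuclideanSpace.equiv (Fin (m + 1)) ℝ).symm with he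
  have hei : ∀ x i, e x i = x i := fun x i => rfl
  -- The box is [0, L] in the zeroth direction and [-L, L] in the others. Since |y i| < L on K, the
  -- field vanishes on every face except possibly y 0 = 0, where the tangency condition applies.
  set a : Fin (m + 1) → ℝ := fun i => if i = 0 then 0 else -L with ha
  set b : Fin (m + 1) → ℝ := fun _ => L with hb
  have hab : a ≤ b := by
    intro i
    by_cases hi : i = 0 <;> simp [ha, hb, hi] <;> linarith
  have hmp : MeasurePreserving (e : (Fin (m + 1) → ℝ) → EuclideanSpace ℝ (Fin (m + 1)))
      volume volume := PiLp.volume_preserving_toLp (Fin (m + 1))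
  have hemb : MeasurableEmbedding e := e.toHomeomorph.measurableEmbedding
  have hpre : e ⁻¹' {y | 0 ≤ y 0} = {x | 0 ≤ x 0} := rfl
  have hH : MeasurableSet {x : Fin (m + 1) → ℝ | 0 ≤ x 0} :=
    (isClosed_le continuous_const (continuous_apply 0)).measurableSet
  have hIccH : Icc a b ⊆ {x | 0 ≤ x 0} := by
    intro x hx
    have := hx.1 0
    simpa [ha] using this
  have hout : ∀ x : Fin (m + 1) → ℝ, 0 ≤ x 0 → x ∉ Icc a b → e x ∉ K := by
    intro x hx0 hx hxK
    apply hx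
    constructor <;> intro i <;> have h1 := abs_lt.mp (hKL _ hxK i) <;> rw [hei] at h1
    · by_cases hi : i = 0
      · subst hi; simpa [ha] using hx0
      · simp only [ha, hi, if_false]; exact h1.1.le
    · exact h1.2.le
  rw [← hmp.setIntegral_preimage_emb hemb, hpre]
  rw [setIntegral_eq_of_subset_of_forall_sdiff_eq_zero hH hIccH
    (fun x hx => hFK' (e x) hx.1 (hout x hx.1 hx.2))]
  have hint' : IntegrableOn (fun x => ∑ i, F' i (e x) (EuclideanSpace.single i 1)) (Icc a b) := by
    have h1 := (hmp.integrableOn_comp_preimage hemb).mpr hint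
    exact h1.mono_set hIccH
  have key := integral_divergence_of_hasFDerivAt_off_countable' a b hab (fun i x => F i (e x))
    (fun i x => (F' i (e x)).comp (e : (Fin (m + 1) → ℝ) →L[ℝ] EuclideanSpace ℝ (Fin (m + 1))))
    ∅ countable_empty
    (fun i => (hF i).comp e.continuous.continuousOn (fun x hx => hIccH hx))
    (fun x hx i => by
      refine HasFDerivAt.comp x (hd i (e x) ?_) e.hasFDerivAt
      have h1 : a 0 < x 0 := (hx.1 0 (mem_univ _)).1
      rw [hei]
      simpa [ha] using h1)
    hint'
  refine key.trans (Finset.sum_eq_zero fun i _ => ?_)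
  have hzero : ∀ x : Fin (m + 1) → ℝ, 0 ≤ x 0 → (∃ j, L ≤ |x j|) → ∀ i, F i (e x) = 0 := by
    rintro x hx ⟨j, hj⟩ i
    refine hFK i (e x) hx fun hxK => ?_
    exact absurd (hKL _ hxK j) (not_lt.mpr hj)
  have hface0 : ∀ (i : Fin (m + 1)) (v : ℝ) (x : Fin m → ℝ),
      x ∈ Icc (a ∘ i.succAbove) (b ∘ i.succAbove) → i ≠ 0 →
      0 ≤ i.insertNth (α := fun _ => ℝ) v x 0 := by
    intro i v x hx hi
    obtain ⟨k, hk⟩ := Fin.exists_succAbove_eq hi.symm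
    have := hx.1 k
    rw [Function.comp_apply, hk] at this
    rw [← hk]
    simpa [ha] using this
  rw [sub_eq_zero, setIntegral_eq_zero_of_forall_eq_zero, setIntegral_eq_zero_of_forall_eq_zero]
  · intro x hx
    by_cases hi : i = 0
    · subst hi
      exact h0 _ (by simp [hei, ha])
    · refine hzero _ (hface0 i _ x hx hi) ⟨i, ?_⟩ i
      simp [ha, hi, abs_of_pos hLpos]
  · intro x hx
    refine hzero _ ?_ ⟨i, ?_⟩ i
    · by_cases hi : i = 0
      · subst hi; simpa [hb] using hLpos.le
      · exact hface0 i _ x hx hi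
    · simp [hb, abs_of_pos hLpos]

theorem integral_eq_zero_of_eq_divergence {n : ℕ} [NeZero n]
    (F : Fin n → EuclideanSpace ℝ (Fin n) → ℝ) (D : EuclideanSpace ℝ (Fin n) → ℝ)
    {K : Set (EuclideanSpace ℝ (Fin n))} (hK : IsCompact K)
    (hF : ∀ i, ContinuousOn (F i) {y | 0 ≤ y 0})
    (hFK : ∀ i y, 0 ≤ y 0 → y ∉ K → F i y = 0)
    (hDK : ∀ y, 0 ≤ y 0 → y ∉ K → D y = 0)
    (hd : ∀ y, 0 < y 0 → ∃ L : Fin n → EuclideanSpace ℝ (Fin n) →L[ℝ] ℝ,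
      (∀ i, HasFDerivAt (F i) (L i) y) ∧ ∑ i, L i (EuclideanSpace.single i 1) = D y)
    (h0 : ∀ y, y 0 = 0 → F 0 y = 0) (hint : IntegrableOn D {y | 0 ≤ y 0}) :
    ∫ y in {y : EuclideanSpace ℝ (Fin n) | 0 ≤ y 0}, D y = 0 := by
  choose! L hL hLD using hd
  -- Differentiability is only required where y 0 > 0. Elsewhere `F'` is an arbitrary filler, chosen
  -- so that its trace is `D y` and the divergence equals `D` at every point.
  set F' : Fin n → EuclideanSpace ℝ (Fin n) → EuclideanSpace ℝ (Fin n) →L[ℝ] ℝ := fun i y =>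
    if 0 < y 0 then L y i else
      if i = 0 then D y • EuclideanSpace.proj (0 : Fin n) else 0 with hF'
  have hsum : ∀ y, ∑ i, F' i y (EuclideanSpace.single i 1) = D y := by
    intro y
    by_cases hy : 0 < y 0
    · simp only [hF', hy, if_true]
      exact hLD y hy
    · simp only [hF', hy, if_false]
      rw [Finset.sum_eq_single 0]
      · simp
      · intro i _ hi
        simp [hi]
      · simp
  have key := integral_divergence_halfSpace F F' hK hF hFK
    (fun y h h' => by rw [hsum]; exact hDK y h h')
    (fun i y hy => by simp only [hF', hy, if_true]; exact hL y hy i) h0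
    (by simpa only [hsum] using hint)
  simpa only [hsum] using key

end HalfSpace

/-! ### Rules of calculus for chart derivatives -/

section ChartCalculus

open Set Filter Topology

variable {n : ℕ} [NeZero n] {M : Type*} [TopologicalSpace M]
  [ChartedSpace (EuclideanHalfSpace n) M] [IsManifold (𝓡∂ n) ∞ M]
  {F : Type*} [NormedAddCommGroup F] [NormedSpace ℝ F]
  {F' : Type*} [NormedAddCommGroup F'] [NormedSpace ℝ F']

theorem chartDeriv_add {f g : M → F} (hf : ContMDiff (𝓡∂ n) 𝓘(ℝ, F) ∞ f)
    (hg : ContMDiff (𝓡∂ n) 𝓘(ℝ, F) ∞ g) (q : M) {y : EuclideanSpace ℝ (Fin n)}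
    (hy : y ∈ (extChartAt (𝓡∂ n) q).target) (i : Fin n) :
    chartDeriv (fun m => f m + g m) q y i = chartDeriv f q y i + chartDeriv g q y i := by
  have h := (hasFDerivWithinAt_comp_symm hf q hy).add (hasFDerivWithinAt_comp_symm hg q hy)
  rw [chartDeriv_eq_of_hasFDerivWithinAt (f := fun m => f m + g m) hy h i,
    chartDeriv_eq_fderivWithin_target f q hy, chartDeriv_eq_fderivWithin_target g q hy]
  rfl

theorem chartDeriv_clm {f : M → F} (hf : ContMDiff (𝓡∂ n) 𝓘(ℝ, F) ∞ f) (A : F →L[ℝ] F')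
    (q : M) {y : EuclideanSpace ℝ (Fin n)}
    (hy : y ∈ (extChartAt (𝓡∂ n) q).target) (i : Fin n) :
    chartDeriv (fun m => A (f m)) q y i = A (chartDeriv f q y i) := by
  have h := A.hasFDerivAt.comp_hasFDerivWithinAt y (hasFDerivWithinAt_comp_symm hf q hy)
  rw [chartDeriv_eq_of_hasFDerivWithinAt (f := fun m => A (f m)) hy h i,
    chartDeriv_eq_fderivWithin_target f q hy]
  rfl

theorem chartDeriv_const_smul {f : M → F} (hf : ContMDiff (𝓡∂ n) 𝓘(ℝ, F) ∞ f) (c : ℝ)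
    (q : M) {y : EuclideanSpace ℝ (Fin n)}
    (hy : y ∈ (extChartAt (𝓡∂ n) q).target) (i : Fin n) :
    chartDeriv (fun m => c • f m) q y i = c • chartDeriv f q y i :=
  chartDeriv_clm hf (c • ContinuousLinearMap.id ℝ F) q hy i

theorem chartDeriv_smul {f : M → F} {r : M → ℝ} (hr : ContMDiff (𝓡∂ n) 𝓘(ℝ, ℝ) ∞ r)
    (hf : ContMDiff (𝓡∂ n) 𝓘(ℝ, F) ∞ f) (q : M) {y : EuclideanSpace ℝ (Fin n)}
    (hy : y ∈ (extChartAt (𝓡∂ n) q).target) (i : Fin n) :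
    chartDeriv (fun m => r m • f m) q y i =
      r ((extChartAt (𝓡∂ n) q).symm y) • chartDeriv f q y i +
        chartDeriv r q y i • f ((extChartAt (𝓡∂ n) q).symm y) := by
  have h := (hasFDerivWithinAt_comp_symm hr q hy).smul (hasFDerivWithinAt_comp_symm hf q hy)
  rw [chartDeriv_eq_of_hasFDerivWithinAt (f := fun m => r m • f m) hy h i,
    chartDeriv_eq_fderivWithin_target f q hy, chartDeriv_eq_fderivWithin_target r q hy]
  rfl

/-- For j ≠ 0 the line y + s e_j stays in the hyperplane y 0 = 0, so near s = 0 it runs through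
boundary points, where `f` is constant. -/
theorem chartDeriv_tangential_eq_zero {f : M → ℝ} (hf : ContMDiff (𝓡∂ n) 𝓘(ℝ, ℝ) ∞ f) {c : ℝ}
    (hfc : ∀ m ∈ (𝓡∂ n).boundary M, f m = c) (q : M) {y : EuclideanSpace ℝ (Fin n)}
    (hy : y ∈ (extChartAt (𝓡∂ n) q).target) (h0 : y 0 = 0) {j : Fin n} (hj : j ≠ 0) :
    chartDeriv f q y j = 0 := by
  set γ : ℝ → EuclideanSpace ℝ (Fin n) := fun s => y + s • EuclideanSpace.single j (1 : ℝ) with hγ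
  have hγ0 : γ 0 = y := by simp [hγ]
  have hγ00 : ∀ s, γ s 0 = 0 := by
    intro s
    simp [hγ, h0, Ne.symm hj]
  have hγr : ∀ s, γ s ∈ Set.range (𝓡∂ n) := by
    intro s
    rw [range_modelWithCornersEuclideanHalfSpace]
    exact (hγ00 s).ge
  have hγd : HasDerivAt γ (EuclideanSpace.single j 1) 0 := by
    have := ((hasDerivAt_id (0 : ℝ)).smul_const (EuclideanSpace.single j (1 : ℝ))).const_add y
    rw [one_smul] at this
    exact this
  have h1 := (hasFDerivWithinAt_comp_symm hf q hy).mono_of_mem_nhdsWithin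
    (extChartAt_target_mem_nhdsWithin_of_mem hy)
  have h2 : HasDerivAt ((f ∘ (extChartAt (𝓡∂ n) q).symm) ∘ γ)
      (fderivWithin ℝ (f ∘ (extChartAt (𝓡∂ n) q).symm) (extChartAt (𝓡∂ n) q).target y
        (EuclideanSpace.single j 1)) 0 := by
    rw [← hγ0] at h1
    have h3 := HasFDerivWithinAt.comp_hasDerivWithinAt (s := univ) (0 : ℝ) h1
      hγd.hasDerivWithinAt (fun s _ => hγr s)
    rw [hasDerivWithinAt_univ, hγ0] at h3
    exact h3
  have h4 : (f ∘ (extChartAt (𝓡∂ n) q).symm) ∘ γ =ᶠ[𝓝 0] fun _ => c := by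
    have hlim : Tendsto γ (𝓝 0) (𝓝[Set.range (𝓡∂ n)] y) := by
      refine tendsto_nhdsWithin_iff.mpr ⟨?_, Eventually.of_forall hγr⟩
      have := hγd.continuousAt.tendsto
      rwa [hγ0] at this
    filter_upwards [hlim (extChartAt_target_mem_nhdsWithin_of_mem hy)] with s hs
    exact hfc _ (mem_boundary_of_chart_eq_zero hs (hγ00 s))
  rw [chartDeriv_eq_fderivWithin_target f q hy]
  exact (h2.congr_of_eventuallyEq h4.symm).unique (hasDerivAt_const _ _)

omit [IsManifold (𝓡∂ n) ∞ M] in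
theorem continuous_of_continuousOn_charts {G : M → ℝ}
    (hG : ∀ q, ContinuousOn (fun y => G ((extChartAt (𝓡∂ n) q).symm y))
      (extChartAt (𝓡∂ n) q).target) : Continuous G := by
  rw [continuous_iff_continuousAt]
  intro m
  have h1 := (hG m).comp (continuousOn_extChartAt m) (fun z hz => (extChartAt (𝓡∂ n) m).map_source hz)
  have h2 := h1.continuousAt (extChartAt_source_mem_nhds m)
  refine h2.congr ?_
  filter_upwards [extChartAt_source_mem_nhds (I := 𝓡∂ n) m] with z hz
  simp only [Function.comp_apply, (extChartAt (𝓡∂ n) m).left_inv hz]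

end ChartCalculus

/-! ### Continuity of characteristic coefficients and of the inverse -/

section MatrixContinuity

open Matrix

theorem continuous_charpoly_coeff (n k : ℕ) :
    Continuous fun A : Matrix (Fin n) (Fin n) ℝ => A.charpoly.coeff k := by
  have h : (fun A : Matrix (Fin n) (Fin n) ℝ => A.charpoly.coeff k) = fun A =>
      MvPolynomial.eval (fun ij : Fin n × Fin n => A ij.1 ij.2)
        ((Matrix.charpoly.univ ℝ (Fin n)).coeff k) := by
    funext A
    exact (Matrix.charpoly.univ_coeff_eval₂Hom (R := ℝ) (S := ℝ) (Fin n)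
      (RingHom.id ℝ) (fun ij => A ij.1 ij.2) k).symm
  rw [h]
  exact (MvPolynomial.continuous_eval _).comp
    (continuous_pi fun ij => continuous_id.matrix_elem ij.1 ij.2)

theorem continuousOn_matrix_inv {X : Type*} [TopologicalSpace X] {s : Set X} {n : ℕ}
    {A : X → Matrix (Fin n) (Fin n) ℝ} (hA : ContinuousOn A s) (hdet : ∀ y ∈ s, (A y).det ≠ 0) :
    ContinuousOn (fun y => (A y)⁻¹) s := by
  simp only [Matrix.inv_def, Ring.inverse_eq_inv']
  exact ((continuous_id.matrix_det.comp_continuousOn hA).inv₀ hdet).smul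
    (continuous_id.matrix_adjugate.comp_continuousOn hA)

end MatrixContinuity

/-! ### Hypersurfaces of the unit sphere of ℝ^{n+2} -/

section SphericalHypersurface

open Set Filter Topology

variable {n : ℕ} [NeZero n] {M : Type*} [TopologicalSpace M]
  [ChartedSpace (EuclideanHalfSpace n) M]

/-- `P` is an immersion into the unit sphere of `ℝ^{n+2}` with unit normal field `N`. -/
structure IsSphericalHypersurface (P N : M → Fin (n + 2) → ℝ) : Prop where
  contMDiff : ContMDiff (𝓡∂ n) 𝓘(ℝ, Fin (n + 2) → ℝ) ∞ P
  contMDiff_normal : ContMDiff (𝓡∂ n) 𝓘(ℝ, Fin (n + 2) → ℝ) ∞ N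
  pp : ∀ m, P m ⬝ᵥ P m = 1
  νν : ∀ m, N m ⬝ᵥ N m = 1
  pν : ∀ m, P m ⬝ᵥ N m = 0
  tangent : ∀ q, ∀ y ∈ (extChartAt (𝓡∂ n) q).target, ∀ i,
    chartDeriv P q y i ⬝ᵥ N ((extChartAt (𝓡∂ n) q).symm y) = 0
  posDef : ∀ q, ∀ y ∈ (extChartAt (𝓡∂ n) q).target,
    (dotMatrix (chartDeriv P q y) (chartDeriv P q y)).PosDef

/-- The Weingarten matrix of a hypersurface of the sphere of `ℝ^{n+2}`, in a chart. -/
def shapeMatrix (P N : M → Fin (n + 2) → ℝ) (q : M) (y : EuclideanSpace ℝ (Fin n)) :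
    Matrix (Fin n) (Fin n) ℝ :=
  (dotMatrix (chartDeriv P q y) (chartDeriv P q y))⁻¹ *
    dotMatrix (chartDeriv N q y) (chartDeriv P q y)

/-- The `k`-th mean curvature of a hypersurface of the sphere of `ℝ^{n+2}`. -/
def meanCurvature (P N : M → Fin (n + 2) → ℝ) (k : ℕ) (m : M) : ℝ :=
  (shapeMatrix P N m (extChartAt (𝓡∂ n) m m)).charpoly.roots.esymm k

/-- The pairing of `dρ` with the image of the tangential part of `Z` under the generating function
of the Newton tensors, in the chart around `q`. -/
def chartPairing (P N Z : M → Fin (n + 2) → ℝ) (t : ℝ) (ρ : M → ℝ) (q : M)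
    (y : EuclideanSpace ℝ (Fin n)) : ℝ :=
  newtonPairing (dotMatrix (chartDeriv P q y) (chartDeriv P q y))
    (dotMatrix (chartDeriv N q y) (chartDeriv P q y)) t
    (fun j => Z ((extChartAt (𝓡∂ n) q).symm y) ⬝ᵥ chartDeriv P q y j) (chartDeriv ρ q y)

variable [IsManifold (𝓡∂ n) ∞ M]

theorem dotMatrix_change {k : ℕ} {f g : M → Fin k → ℝ}
    (hf : ContMDiff (𝓡∂ n) 𝓘(ℝ, Fin k → ℝ) ∞ f) (hg : ContMDiff (𝓡∂ n) 𝓘(ℝ, Fin k → ℝ) ∞ g)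
    {q' q z : M} (hz' : z ∈ (extChartAt (𝓡∂ n) q').source)
    (hz : z ∈ (extChartAt (𝓡∂ n) q).source) :
    dotMatrix (chartDeriv f q' (extChartAt (𝓡∂ n) q' z))
        (chartDeriv g q' (extChartAt (𝓡∂ n) q' z)) =
      transMatrix (n := n) q' q z * dotMatrix (chartDeriv f q (extChartAt (𝓡∂ n) q z))
        (chartDeriv g q (extChartAt (𝓡∂ n) q z)) * (transMatrix (n := n) q' q z).transpose := by
  ext i j
  simp only [dotMatrix_apply, chartDeriv_change hf hz' hz, chartDeriv_change hg hz' hz,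
    Matrix.mul_apply, Matrix.transpose_apply, sum_dotProduct, dotProduct_sum, smul_dotProduct,
    dotProduct_smul, smul_eq_mul, Finset.sum_mul, Finset.mul_sum]
  exact Finset.sum_congr rfl fun k _ => Finset.sum_congr rfl fun l _ => by ring

omit [IsManifold (𝓡∂ n) ∞ M] [NeZero n] [ChartedSpace (EuclideanHalfSpace n) M]
  [TopologicalSpace M] in
theorem continuousOn_dotProduct {X : Type*} [TopologicalSpace X] {s : Set X} {k : ℕ}
    {f g : X → Fin k → ℝ} (hf : ContinuousOn f s) (hg : ContinuousOn g s) :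
    ContinuousOn (fun y => f y ⬝ᵥ g y) s := by
  unfold dotProduct
  exact continuousOn_finsetSum _ fun l _ =>
    (continuousOn_pi.mp hf l).mul (continuousOn_pi.mp hg l)

theorem continuousOn_dotMatrix {k : ℕ} {f g : M → Fin k → ℝ}
    (hf : ContMDiff (𝓡∂ n) 𝓘(ℝ, Fin k → ℝ) ∞ f) (hg : ContMDiff (𝓡∂ n) 𝓘(ℝ, Fin k → ℝ) ∞ g)
    (q : M) : ContinuousOn (fun y => dotMatrix (chartDeriv f q y) (chartDeriv g q y))
      (extChartAt (𝓡∂ n) q).target := by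
  refine continuousOn_pi.mpr fun i => continuousOn_pi.mpr fun j => ?_
  exact continuousOn_dotProduct (contDiffOn_chartDeriv hf q i).continuousOn
    (contDiffOn_chartDeriv hg q j).continuousOn

namespace IsSphericalHypersurface

variable {P N : M → Fin (n + 2) → ℝ} (H : IsSphericalHypersurface P N)
include H

theorem isHypersurfaceFrame (q : M) {y : EuclideanSpace ℝ (Fin n)}
    (hy : y ∈ (extChartAt (𝓡∂ n) q).target) :
    IsHypersurfaceFrame (P ((extChartAt (𝓡∂ n) q).symm y)) (N ((extChartAt (𝓡∂ n) q).symm y))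
      (chartDeriv P q y) (chartDeriv N q y) := by
  have hself : ∀ {f : M → Fin (n + 2) → ℝ}, ContMDiff (𝓡∂ n) 𝓘(ℝ, Fin (n + 2) → ℝ) ∞ f →
      (∀ m, f m ⬝ᵥ f m = 1) →
      ∀ i, chartDeriv f q y i ⬝ᵥ f ((extChartAt (𝓡∂ n) q).symm y) = 0 := by
    intro f hf h1 i
    have h2 := chartDeriv_dotProduct hf hf q hy i
    rw [funext h1, chartDeriv_const, dotProduct_comm (f _)] at h2
    linarith
  have hPN : ∀ i, chartDeriv N q y i ⬝ᵥ P ((extChartAt (𝓡∂ n) q).symm y) = 0 := by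
    intro i
    have h2 := chartDeriv_dotProduct H.contMDiff H.contMDiff_normal q hy i
    rw [funext H.pν, chartDeriv_const, H.tangent q y hy, zero_add, dotProduct_comm] at h2
    exact h2.symm
  refine ⟨H.pp _, H.νν _, H.pν _, hself H.contMDiff H.pp, H.tangent q y hy, hPN,
    hself H.contMDiff_normal H.νν, H.posDef q y hy, ?_⟩
  have hu := uniqueDiffOn_extChartAt_target (I := 𝓡∂ n) (𝕜 := ℝ) q
  -- Differentiating ⟨∂_j P, N⟩ = 0 expresses h_ij as -⟨N, ∂_i ∂_j P⟩, which is symmetric in i and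
  -- j.
  have hkey : ∀ i j, chartDeriv N q y i ⬝ᵥ chartDeriv P q y j =
      -(N ((extChartAt (𝓡∂ n) q).symm y) ⬝ᵥ
        fderivWithin ℝ (fun y => chartDeriv P q y j) (extChartAt (𝓡∂ n) q).target y
          (EuclideanSpace.single i 1)) := by
    intro i j
    have h1 := ((contDiffOn_chartDeriv H.contMDiff q j).differentiableOn (by simp) y
      hy).hasFDerivWithinAt
    obtain ⟨D, hD, hDv⟩ := hasFDerivWithinAt_dotProduct h1
      (hasFDerivWithinAt_comp_symm H.contMDiff_normal q hy)
    have h2 : HasFDerivWithinAt (fun y => chartDeriv P q y j ⬝ᵥ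
        (N ∘ (extChartAt (𝓡∂ n) q).symm) y) (0 : EuclideanSpace ℝ (Fin n) →L[ℝ] ℝ)
        (extChartAt (𝓡∂ n) q).target y :=
      (hasFDerivWithinAt_const (0 : ℝ) y _).congr (fun z hz => H.tangent q z hz j)
        (H.tangent q y hy j)
    have h3 := congrArg (fun L => L (EuclideanSpace.single i (1 : ℝ))) ((hu y hy).eq hD h2)
    simp only [hDv] at h3
    rw [chartDeriv_eq_fderivWithin_target N q hy, dotProduct_comm,
      dotProduct_comm (N ((extChartAt (𝓡∂ n) q).symm y)), eq_neg_iff_add_eq_zero, add_comm]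
    exact h3
  ext i j
  simp only [Matrix.transpose_apply, dotMatrix_apply]
  rw [hkey, hkey, chartDeriv_chartDeriv_symm H.contMDiff q hy]

theorem meanCurvature_eq {q z : M} (hz : z ∈ (extChartAt (𝓡∂ n) q).source) (k : ℕ) :
    meanCurvature P N k z =
      (shapeMatrix P N q (extChartAt (𝓡∂ n) q z)).charpoly.roots.esymm k := by
  unfold meanCurvature shapeMatrix
  rw [dotMatrix_change H.contMDiff H.contMDiff (mem_extChartAt_source z) hz,
    dotMatrix_change H.contMDiff_normal H.contMDiff (mem_extChartAt_source z) hz,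
    charpoly_inv_mul_conj _ _ _ (det_transMatrix_ne_zero (mem_extChartAt_source z) hz)]

/-- No continuity of the individual roots is needed: as the characteristic polynomial splits, `esymm
k` of the roots is up to sign its coefficient of degree n - k, a polynomial in the entries of the
Weingarten matrix. -/
theorem continuous_meanCurvature {k : ℕ} (hk : k ≤ n) : Continuous (meanCurvature P N k) := by
  refine continuous_of_continuousOn_charts (n := n) fun q => ?_
  have h1 : ContinuousOn (shapeMatrix P N q) (extChartAt (𝓡∂ n) q).target :=
    (continuousOn_matrix_inv (continuousOn_dotMatrix H.contMDiff H.contMDiff q)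
      (fun y hy => (H.posDef q y hy).det_pos.ne')).mul
      (continuousOn_dotMatrix H.contMDiff_normal H.contMDiff q)
  have h2 := ((continuous_charpoly_coeff n (n - k)).comp_continuousOn h1).const_smul ((-1 : ℝ) ^ k)
  refine h2.congr fun y hy => ?_
  rw [H.meanCurvature_eq ((extChartAt (𝓡∂ n) q).map_target hy), (extChartAt (𝓡∂ n) q).right_inv hy,
    shapeMatrix, esymm_roots_charpoly (splits_charpoly_inv_mul (H.posDef q y hy)
      (H.isHypersurfaceFrame q hy).symm) hk]
  rfl

theorem chartPairing_eq {Z : M → Fin (n + 2) → ℝ} (t : ℝ) {ρ : M → ℝ}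
    (hρ : ContMDiff (𝓡∂ n) 𝓘(ℝ, ℝ) ∞ ρ) {q z : M} (hz : z ∈ (extChartAt (𝓡∂ n) q).source) :
    chartPairing P N Z t ρ z (extChartAt (𝓡∂ n) z z) =
      chartPairing P N Z t ρ q (extChartAt (𝓡∂ n) q z) := by
  have hz' := mem_extChartAt_source (I := 𝓡∂ n) z
  unfold chartPairing
  rw [dotMatrix_change H.contMDiff H.contMDiff hz' hz,
    dotMatrix_change H.contMDiff_normal H.contMDiff hz' hz, (extChartAt (𝓡∂ n) z).left_inv hz',
    (extChartAt (𝓡∂ n) q).left_inv hz]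
  have h1 : (fun j => Z z ⬝ᵥ chartDeriv P z (extChartAt (𝓡∂ n) z z) j) =
      (transMatrix (n := n) z q z).mulVec
        (fun j => Z z ⬝ᵥ chartDeriv P q (extChartAt (𝓡∂ n) q z) j) := by
    funext i
    rw [chartDeriv_change H.contMDiff hz' hz, dotProduct_sum]
    simp only [dotProduct_smul]
    rfl
  have h2 : chartDeriv ρ z (extChartAt (𝓡∂ n) z z) =
      (transMatrix (n := n) z q z).mulVec (chartDeriv ρ q (extChartAt (𝓡∂ n) q z)) := by
    funext i
    rw [chartDeriv_change hρ hz' hz]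
    rfl
  rw [h1, h2, newtonPairing_conj _ _ _ (det_transMatrix_ne_zero hz' hz)]

theorem continuous_chartPairing {Z : M → Fin (n + 2) → ℝ}
    (hZ : ContMDiff (𝓡∂ n) 𝓘(ℝ, Fin (n + 2) → ℝ) ∞ Z) (t : ℝ) {ρ : M → ℝ}
    (hρ : ContMDiff (𝓡∂ n) 𝓘(ℝ, ℝ) ∞ ρ) :
    Continuous fun z => chartPairing P N Z t ρ z (extChartAt (𝓡∂ n) z z) := by
  refine continuous_of_continuousOn_charts (n := n) fun q => ?_
  have hg := continuousOn_dotMatrix H.contMDiff H.contMDiff q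
  have hh := continuousOn_dotMatrix H.contMDiff_normal H.contMDiff q
  have h1 : ContinuousOn (chartPairing P N Z t ρ q) (extChartAt (𝓡∂ n) q).target := by
    unfold chartPairing newtonPairing
    refine ContinuousOn.div ?_ (continuous_id.matrix_det.comp_continuousOn hg)
      (fun y hy => (H.posDef q y hy).det_pos.ne')
    refine continuous_id.matrix_trace.comp_continuousOn (ContinuousOn.mul ?_
      (continuous_id.matrix_adjugate.comp_continuousOn (hg.add (hh.const_smul t))))
    refine continuousOn_pi.mpr fun i => continuousOn_pi.mpr fun j => ?_
    refine (contDiffOn_chartDeriv hρ q i).continuousOn.mul ?_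
    exact continuousOn_dotProduct (contDiffOn_comp_extChartAt_symm hZ q).continuousOn
      (contDiffOn_chartDeriv H.contMDiff q j).continuousOn
  refine h1.congr fun y hy => ?_
  rw [H.chartPairing_eq t hρ ((extChartAt (𝓡∂ n) q).map_target hy),
    (extChartAt (𝓡∂ n) q).right_inv hy]

end IsSphericalHypersurface

end SphericalHypersurface

/-! ### Linearity and continuity of the frame determinant -/

section FrameDetLinear

open Matrix

variable {n : ℕ}

theorem frameDet_update_eq (p ν : Fin (n + 2) → ℝ) (v : Fin n → Fin (n + 2) → ℝ) (i : Fin n)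
    (w : Fin (n + 2) → ℝ) : frameDet p ν (Function.update v i w) =
      ((Matrix.of (vecCons p (vecCons ν v))).updateRow i.succ.succ w).det := by
  unfold frameDet
  congr 1
  funext j
  refine Fin.cases ?_ (fun l => Fin.cases ?_ (fun k => ?_) l) j
  · rw [updateRow_ne (by simp [Fin.ext_iff])]; rfl
  · rw [updateRow_ne (by simp [Fin.ext_iff])]; rfl
  · by_cases hk : k = i
    · subst hk
      rw [updateRow_self]
      exact Function.update_self ..
    · rw [updateRow_ne (by simpa using hk)]
      exact Function.update_of_ne hk ..

theorem frameDet_update_add (p ν : Fin (n + 2) → ℝ) (v : Fin n → Fin (n + 2) → ℝ) (i : Fin n)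
    (w w' : Fin (n + 2) → ℝ) : frameDet p ν (Function.update v i (w + w')) =
      frameDet p ν (Function.update v i w) + frameDet p ν (Function.update v i w') := by
  simp only [frameDet_update_eq, det_updateRow_add]

theorem frameDet_update_smul (p ν : Fin (n + 2) → ℝ) (v : Fin n → Fin (n + 2) → ℝ) (i : Fin n)
    (c : ℝ) (w : Fin (n + 2) → ℝ) : frameDet p ν (Function.update v i (c • w)) =
      c * frameDet p ν (Function.update v i w) := by
  simp only [frameDet_update_eq, det_updateRow_smul]

theorem continuousOn_frameDet {X : Type*} [TopologicalSpace X] {s : Set X}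
    {p ν : X → Fin (n + 2) → ℝ} {v : X → Fin n → Fin (n + 2) → ℝ} (hp : ContinuousOn p s)
    (hν : ContinuousOn ν s) (hv : ∀ i, ContinuousOn (fun y => v y i) s) :
    ContinuousOn (fun y => frameDet (p y) (ν y) (v y)) s := by
  have h : ContinuousOn (fun y => Matrix.of (vecCons (p y) (vecCons (ν y) (v y)))) s := by
    refine continuousOn_pi.mpr fun i => ?_
    refine Fin.cases ?_ (fun l => Fin.cases ?_ (fun k => ?_) l) i
    · exact hp
    · exact hν
    · exact hv k
  exact continuous_id.matrix_det.comp_continuousOn h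

end FrameDetLinear

/-! ### The ambient field Z -/

section RotationField

/-- `infRot` as a continuous linear map. -/
def infRotL {m : ℕ} (e a : Fin m → ℝ) : (Fin m → ℝ) →L[ℝ] (Fin m → ℝ) :=
  LinearMap.toContinuousLinearMap
    { toFun := infRot e a
      map_add' := infRot_add e a
      map_smul' := fun s v => infRot_smul e a v s }

theorem infRotL_apply {m : ℕ} (e a v : Fin m → ℝ) : infRotL e a v = infRot e a v := rfl

/-- The field `-a + ⟨u, e⟩ a - ⟨u, a⟩ e`, where `u = r P + c N`. -/
def capillaryField {m : ℕ} {M : Type*} (e a : Fin m → ℝ) (r c : ℝ) (P N : M → Fin m → ℝ) (z : M) :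
    Fin m → ℝ :=
  -a + infRot e a (r • P z + c • N z)

end RotationField

/-! ### The divergence identity in a chart -/

section LocalIdentity

open Set Filter Topology

variable {n : ℕ} [NeZero n] {M : Type*} [TopologicalSpace M]
  [ChartedSpace (EuclideanHalfSpace n) M]

/-- The generating function of the integrands in the Minkowski-type formulas. -/
def minkowskiIntegrand (P N Z : M → Fin (n + 2) → ℝ) (t : ℝ) (z : M) : ℝ :=
  ∑ k ∈ Finset.range n, t ^ k * (((n : ℝ) - k) * meanCurvature P N k z * -(Z z ⬝ᵥ P z) -
    ((k : ℝ) + 1) * meanCurvature P N (k + 1) z * (Z z ⬝ᵥ N z))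

/-- The divergence of the vector field `ρ T(Z)`. -/
def localizedIntegrand (P N Z : M → Fin (n + 2) → ℝ) (t : ℝ) (ρ : M → ℝ) (z : M) : ℝ :=
  ρ z * minkowskiIntegrand P N Z t z + chartPairing P N Z t ρ z (extChartAt (𝓡∂ n) z z)

variable [IsManifold (𝓡∂ n) ∞ M]

omit [IsManifold (𝓡∂ n) ∞ M] in
theorem contMDiff_capillaryField {m : ℕ} {P N : M → Fin m → ℝ}
    (hP : ContMDiff (𝓡∂ n) 𝓘(ℝ, Fin m → ℝ) ∞ P) (hN : ContMDiff (𝓡∂ n) 𝓘(ℝ, Fin m → ℝ) ∞ N)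
    (e a : Fin m → ℝ) (r c : ℝ) :
    ContMDiff (𝓡∂ n) 𝓘(ℝ, Fin m → ℝ) ∞ (capillaryField e a r c P N) := by
  have hr := (contDiff_const_smul r).contMDiff.comp hP
  have hc := (contDiff_const_smul c).contMDiff.comp hN
  exact contMDiff_const.add ((infRotL e a).contDiff.contMDiff.comp (hr.add hc))

theorem chartDeriv_capillaryField {m : ℕ} {P N : M → Fin m → ℝ}
    (hP : ContMDiff (𝓡∂ n) 𝓘(ℝ, Fin m → ℝ) ∞ P) (hN : ContMDiff (𝓡∂ n) 𝓘(ℝ, Fin m → ℝ) ∞ N)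
    (e a : Fin m → ℝ) (r c : ℝ) (q : M) {y : EuclideanSpace ℝ (Fin n)}
    (hy : y ∈ (extChartAt (𝓡∂ n) q).target) (i : Fin n) :
    chartDeriv (capillaryField e a r c P N) q y i =
      infRot e a (r • chartDeriv P q y i + c • chartDeriv N q y i) := by
  have hr := (contDiff_const_smul r).contMDiff.comp hP
  have hc := (contDiff_const_smul c).contMDiff.comp hN
  have h1 := chartDeriv_add hr hc q hy i
  have h2 := chartDeriv_clm (hr.add hc) (infRotL e a) q hy i
  have h3 := chartDeriv_add (f := fun _ => -a) contMDiff_const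
    ((infRotL e a).contDiff.contMDiff.comp (hr.add hc)) q hy i
  refine h3.trans ?_
  rw [chartDeriv_const, zero_add]
  refine h2.trans ?_
  rw [infRotL_apply]
  congr 1
  refine h1.trans ?_
  congr 1
  · exact chartDeriv_const_smul hP r q hy i
  · exact chartDeriv_const_smul hN c q hy i

namespace IsSphericalHypersurface

variable {P N : M → Fin (n + 2) → ℝ} (H : IsSphericalHypersurface P N)
include H

/-- The charts need not be compatible with the orientation given by `N`. The frame determinant is a
square root of det g whose sign is locally constant, so multiplying the field by this sign commutes
with differentiation. -/
theorem eventually_sign_eq (q : M) {y : EuclideanSpace ℝ (Fin n)}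
    (hy : y ∈ (extChartAt (𝓡∂ n) q).target) :
    ∀ᶠ y' in 𝓝[(extChartAt (𝓡∂ n) q).target] y,
      Real.sign (frameDet (P ((extChartAt (𝓡∂ n) q).symm y')) (N ((extChartAt (𝓡∂ n) q).symm y'))
        (chartDeriv P q y')) =
      Real.sign (frameDet (P ((extChartAt (𝓡∂ n) q).symm y)) (N ((extChartAt (𝓡∂ n) q).symm y))
        (chartDeriv P q y)) := by
  have hcont := continuousOn_frameDet
    (contDiffOn_comp_extChartAt_symm H.contMDiff q).continuousOn
    (contDiffOn_comp_extChartAt_symm H.contMDiff_normal q).continuousOn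
    (fun i => (contDiffOn_chartDeriv H.contMDiff q i).continuousOn) y hy
  rcases lt_or_gt_of_ne (H.isHypersurfaceFrame q hy).frameDet_ne_zero with h | h
  · filter_upwards [hcont.tendsto.eventually (gt_mem_nhds h)] with y' hy'
    rw [Real.sign_of_neg h]
    exact Real.sign_of_neg hy'
  · filter_upwards [hcont.tendsto.eventually (lt_mem_nhds h)] with y' hy'
    rw [Real.sign_of_pos h]
    exact Real.sign_of_pos hy'

/-- The rows other than Z are partial derivatives of the one function P + t N, so mixed derivatives
cancel. In the product rule for ρ Z, the terms with ρ give the pointwise identity and those with dρ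
give the Newton pairing. -/
theorem exists_hasFDerivAt_localized {t : ℝ} (ht : t ≠ 0) (e a : Fin (n + 2) → ℝ) (r c : ℝ)
    {ρ : M → ℝ} (hρ : ContMDiff (𝓡∂ n) 𝓘(ℝ, ℝ) ∞ ρ) (q : M) {y : EuclideanSpace ℝ (Fin n)}
    (hy : y ∈ (extChartAt (𝓡∂ n) q).target) (hy0 : 0 < y 0) :
    ∃ L : Fin n → EuclideanSpace ℝ (Fin n) →L[ℝ] ℝ,
      (∀ i, HasFDerivAt (fun y => frameDet (P ((extChartAt (𝓡∂ n) q).symm y))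
        (N ((extChartAt (𝓡∂ n) q).symm y))
        (Function.update (fun j => chartDeriv P q y j + t • chartDeriv N q y j) i
          (ρ ((extChartAt (𝓡∂ n) q).symm y) •
            capillaryField e a r c P N ((extChartAt (𝓡∂ n) q).symm y)))) (L i) y) ∧
      (∑ i, L i (EuclideanSpace.single i 1)) * frameDet (P ((extChartAt (𝓡∂ n) q).symm y))
        (N ((extChartAt (𝓡∂ n) q).symm y)) (chartDeriv P q y) =
        (dotMatrix (chartDeriv P q y) (chartDeriv P q y)).det *
          localizedIntegrand P N (capillaryField e a r c P N) t ρ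
            ((extChartAt (𝓡∂ n) q).symm y) := by
  set Z := capillaryField e a r c P N with hZdef
  have hZ : ContMDiff (𝓡∂ n) 𝓘(ℝ, Fin (n + 2) → ℝ) ∞ Z :=
    contMDiff_capillaryField H.contMDiff H.contMDiff_normal e a r c
  have hT := target_mem_nhds_of_pos hy hy0
  have hF := H.isHypersurfaceFrame q hy
  have htN : ContMDiff (𝓡∂ n) 𝓘(ℝ, Fin (n + 2) → ℝ) ∞ fun m => t • N m :=
    (contDiff_const_smul t).contMDiff.comp H.contMDiff_normal
  have hQ : ContMDiff (𝓡∂ n) 𝓘(ℝ, Fin (n + 2) → ℝ) ∞ fun m => P m + t • N m :=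
    H.contMDiff.add htN
  have hQd : ∀ y' ∈ (extChartAt (𝓡∂ n) q).target, ∀ j,
      chartDeriv (fun m => P m + t • N m) q y' j = chartDeriv P q y' j + t • chartDeriv N q y' j := by
    intro y' hy' j
    rw [chartDeriv_add H.contMDiff htN q hy' j, chartDeriv_const_smul H.contMDiff_normal t q hy']
  have hρZ : ContMDiff (𝓡∂ n) 𝓘(ℝ, Fin (n + 2) → ℝ) ∞ fun m => ρ m • Z m := hρ.smul hZ
  have hw : ∀ j, HasFDerivAt (fun y => chartDeriv P q y j + t • chartDeriv N q y j)
      (fderivWithin ℝ (fun y => chartDeriv (fun m => P m + t • N m) q y j)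
        (extChartAt (𝓡∂ n) q).target y) y := by
    intro j
    have h1 := ((contDiffOn_chartDeriv hQ q j).differentiableOn (by simp) y hy).hasFDerivWithinAt
    refine (h1.hasFDerivAt hT).congr_of_eventuallyEq ?_
    filter_upwards [hT] with y' hy'
    exact (hQd y' hy' j).symm
  obtain ⟨L, hL, hLsum⟩ := exists_hasFDerivAt_frameDet_update
    ((hasFDerivWithinAt_comp_symm H.contMDiff q hy).hasFDerivAt hT)
    ((hasFDerivWithinAt_comp_symm H.contMDiff_normal q hy).hasFDerivAt hT)
    ((hasFDerivWithinAt_comp_symm hρZ q hy).hasFDerivAt hT) hw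
    (fun i => EuclideanSpace.single i (1 : ℝ))
    (fun i j => chartDeriv_chartDeriv_symm hQ q hy i j)
  refine ⟨L, hL, ?_⟩
  simp only [← chartDeriv_eq_fderivWithin_target _ q hy, Function.comp_apply] at hLsum
  rw [hLsum]
  simp only [chartDeriv_smul hρ hZ q hy, frameDet_update_add, frameDet_update_smul]
  have h1 := hF.sum_frameDet_eq ht e a (Z ((extChartAt (𝓡∂ n) q).symm y)) r c
  have h2 := hF.sum_mul_frameDet_update t (Z ((extChartAt (𝓡∂ n) q).symm y)) (chartDeriv ρ q y)
  have hsrc := (extChartAt (𝓡∂ n) q).map_target hy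
  have h3 : localizedIntegrand P N Z t ρ ((extChartAt (𝓡∂ n) q).symm y) =
      ρ ((extChartAt (𝓡∂ n) q).symm y) * (∑ k ∈ Finset.range n, t ^ k *
        (((n : ℝ) - k) * (shapeMatrix P N q y).charpoly.roots.esymm k *
          -(Z ((extChartAt (𝓡∂ n) q).symm y) ⬝ᵥ P ((extChartAt (𝓡∂ n) q).symm y)) -
          ((k : ℝ) + 1) * (shapeMatrix P N q y).charpoly.roots.esymm (k + 1) *
            (Z ((extChartAt (𝓡∂ n) q).symm y) ⬝ᵥ N ((extChartAt (𝓡∂ n) q).symm y)))) +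
        chartPairing P N Z t ρ q y := by
    unfold localizedIntegrand minkowskiIntegrand
    rw [H.chartPairing_eq t hρ hsrc, (extChartAt (𝓡∂ n) q).right_inv hy]
    simp only [H.meanCurvature_eq hsrc, (extChartAt (𝓡∂ n) q).right_inv hy]
  rw [h3, mul_add, mul_left_comm]
  unfold chartPairing shapeMatrix
  rw [← h1, ← h2, ← mul_assoc, ← add_mul]
  congr 1
  rw [Finset.mul_sum, ← Finset.sum_add_distrib]
  refine Finset.sum_congr rfl fun i _ => ?_
  rw [hZdef, chartDeriv_capillaryField H.contMDiff H.contMDiff_normal e a r c q hy]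
  ring

end IsSphericalHypersurface

end LocalIdentity

/-! ### Boundary condition and integration of one localized piece -/

section GlobalIdentity

open Set Filter Topology MeasureTheory

variable {n : ℕ} [NeZero n] {M : Type*} [TopologicalSpace M]
  [ChartedSpace (EuclideanHalfSpace n) M] [IsManifold (𝓡∂ n) ∞ M]

namespace IsSphericalHypersurface

variable {P N : M → Fin (n + 2) → ℝ} (H : IsSphericalHypersurface P N)
include H

/-- With u = r P + c N, every row is orthogonal to e - u. For P and N these are the boundary
conditions. For ∂_j P and ∂_j N with j ≠ 0 they follow because ⟨P, e⟩ and ⟨N, e⟩ are constant along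
the boundary. For Z, both ⟨Z, u⟩ and ⟨Z, e⟩ equal -⟨a, u⟩; the field is designed for this. -/
theorem frameDet_capillaryField_eq_zero {e a : Fin (n + 2) → ℝ} {r c : ℝ} (hee : e ⬝ᵥ e = 1)
    (hea : e ⬝ᵥ a = 0) (hrc : r ^ 2 + c ^ 2 ≠ 1)
    (hb : ∀ m ∈ (𝓡∂ n).boundary M, P m ⬝ᵥ e = r ∧ N m ⬝ᵥ e = c) (t s : ℝ) (q : M)
    {y : EuclideanSpace ℝ (Fin n)} (hy : y ∈ (extChartAt (𝓡∂ n) q).target) (hy0 : y 0 = 0) :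
    frameDet (P ((extChartAt (𝓡∂ n) q).symm y)) (N ((extChartAt (𝓡∂ n) q).symm y))
      (Function.update (fun j => chartDeriv P q y j + t • chartDeriv N q y j) 0
        (s • capillaryField e a r c P N ((extChartAt (𝓡∂ n) q).symm y))) = 0 := by
  have hF := H.isHypersurfaceFrame q hy
  have htan : ∀ {f : M → Fin (n + 2) → ℝ} {κ : ℝ}, ContMDiff (𝓡∂ n) 𝓘(ℝ, Fin (n + 2) → ℝ) ∞ f →
      (∀ m ∈ (𝓡∂ n).boundary M, f m ⬝ᵥ e = κ) → ∀ j ≠ 0, chartDeriv f q y j ⬝ᵥ e = 0 := by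
    intro f κ hf hfκ j hj
    have hsm : ContMDiff (𝓡∂ n) 𝓘(ℝ, ℝ) ∞ fun m => f m ⬝ᵥ e := by
      have : ContDiff ℝ ∞ fun v : Fin (n + 2) → ℝ => v ⬝ᵥ e := by
        unfold dotProduct; fun_prop
      exact this.contMDiff.comp hf
    have h1 := chartDeriv_tangential_eq_zero hsm hfκ q hy hy0 hj
    rw [chartDeriv_dotProduct hf (contMDiff_const (c := e)) q hy, chartDeriv_const] at h1
    simpa using h1
  have hP := htan H.contMDiff fun m hm => (hb m hm).1
  have hN := htan H.contMDiff_normal fun m hm => (hb m hm).2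
  obtain ⟨hPe, hNe⟩ := hb _ (mem_boundary_of_chart_eq_zero hy hy0)
  set p := P ((extChartAt (𝓡∂ n) q).symm y) with hp
  set ν := N ((extChartAt (𝓡∂ n) q).symm y) with hν
  have hνp : ν ⬝ᵥ p = 0 := by rw [dotProduct_comm, hF.pν]
  refine frameDet_eq_zero_of_orthogonal (q := e - (r • p + c • ν)) ?_ ?_ ?_ fun j => ?_
  -- Pairing e - u with e gives 1 - r² - c², which `hrc` keeps away from zero.
  · intro h0
    have h1 := congrArg (fun v => v ⬝ᵥ e) h0
    simp only [sub_dotProduct, add_dotProduct, smul_dotProduct, smul_eq_mul, hPe, hNe, hee,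
      zero_dotProduct] at h1
    exact hrc (by linarith)
  · simp [dotProduct_sub, dotProduct_add, dotProduct_smul, hPe, hF.pp, hF.pν]
  · simp [dotProduct_sub, dotProduct_add, dotProduct_smul, hNe, hF.νν, hνp]
  · by_cases hj : j = 0
    · subst hj
      have hu : capillaryField e a r c P N ((extChartAt (𝓡∂ n) q).symm y) ⬝ᵥ
          (r • p + c • ν) = -(a ⬝ᵥ (r • p + c • ν)) := by
        unfold capillaryField
        rw [← hp, ← hν, add_dotProduct, infRot_dotProduct_self, neg_dotProduct, add_zero]
      have he : capillaryField e a r c P N ((extChartAt (𝓡∂ n) q).symm y) ⬝ᵥ e =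
          -(a ⬝ᵥ (r • p + c • ν)) := by
        unfold capillaryField
        rw [← hp, ← hν, infRot, add_dotProduct, neg_dotProduct, sub_dotProduct, smul_dotProduct,
          smul_dotProduct, hee, dotProduct_comm a e, hea, dotProduct_comm _ a]
        simp
      rw [Function.update_self, smul_dotProduct, dotProduct_sub, hu, he, sub_self, smul_zero]
    · rw [Function.update_of_ne hj]
      simp [dotProduct_sub, dotProduct_add, add_dotProduct, dotProduct_smul, hP j hj, hN j hj,
        hF.ep, hF.eν, hF.fp, hF.fν]

theorem continuous_minkowskiIntegrand {Z : M → Fin (n + 2) → ℝ} (hZ : Continuous Z) (t : ℝ) :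
    Continuous (minkowskiIntegrand P N Z t) := by
  unfold minkowskiIntegrand
  refine continuous_finsetSum _ fun k hk => ?_
  have hk' := Finset.mem_range.mp hk
  have h1 := H.continuous_meanCurvature (k := k) hk'.le
  have h2 := H.continuous_meanCurvature (k := k + 1) hk'
  have h3 : Continuous fun z => Z z ⬝ᵥ P z := by
    rw [← continuousOn_univ] at hZ ⊢
    exact continuousOn_dotProduct hZ H.contMDiff.continuous.continuousOn
  have h4 : Continuous fun z => Z z ⬝ᵥ N z := by
    rw [← continuousOn_univ] at hZ ⊢
    exact continuousOn_dotProduct hZ H.contMDiff_normal.continuous.continuousOn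
  fun_prop

theorem continuous_localizedIntegrand {Z : M → Fin (n + 2) → ℝ}
    (hZ : ContMDiff (𝓡∂ n) 𝓘(ℝ, Fin (n + 2) → ℝ) ∞ Z) (t : ℝ) {ρ : M → ℝ}
    (hρ : ContMDiff (𝓡∂ n) 𝓘(ℝ, ℝ) ∞ ρ) : Continuous (localizedIntegrand P N Z t ρ) :=
  (hρ.continuous.mul (H.continuous_minkowskiIntegrand hZ.continuous t)).add
    (H.continuous_chartPairing hZ t hρ)

omit H [IsManifold (𝓡∂ n) ∞ M] in
theorem localizedIntegrand_eq_zero {Z : M → Fin (n + 2) → ℝ} (t : ℝ) {ρ : M → ℝ} {z : M}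
    (hz : z ∉ tsupport ρ) : localizedIntegrand P N Z t ρ z = 0 := by
  have h1 : ρ =ᶠ[𝓝 z] 0 := notMem_tsupport_iff_eventuallyEq.mp hz
  have h2 : chartDeriv ρ z (extChartAt (𝓡∂ n) z z) = 0 := by
    funext i
    unfold chartDeriv
    have h3 : ρ ∘ (extChartAt (𝓡∂ n) z).symm =ᶠ[𝓝 (extChartAt (𝓡∂ n) z z)] fun _ => 0 := by
      have h4 := (continuousAt_extChartAt_symm (I := 𝓡∂ n) z).tendsto
      rw [extChartAt_to_inv] at h4
      exact h4.eventually h1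
    rw [(h3.filter_mono nhdsWithin_le_nhds).fderivWithin_eq h3.self_of_nhds]
    simp
  unfold localizedIntegrand chartPairing
  rw [h1.self_of_nhds, h2, newtonPairing_zero]
  simp

variable [T2Space M] [CompactSpace M] [MeasurableSpace M] [BorelSpace M]

-- In the chart the integrand is the divergence of a compactly supported field that is tangential on
-- y 0 = 0. The divergence of the determinant field is δ G with δ² = det g, and the factor sign δ
-- turns δ into the area density.
omit [T2Space M] in
theorem integral_localizedIntegrand_eq_zero {x : M → Ambient n}
    (hx : ContMDiff (𝓡∂ n) 𝓘(ℝ, Ambient n) ∞ x)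
    (hgram : ∀ q, ∀ y ∈ (extChartAt (𝓡∂ n) q).target,
      gramMatrix x q y = dotMatrix (chartDeriv P q y) (chartDeriv P q y))
    {e a : Fin (n + 2) → ℝ} {r c : ℝ} (hee : e ⬝ᵥ e = 1)
    (hea : e ⬝ᵥ a = 0) (hrc : r ^ 2 + c ^ 2 ≠ 1)
    (hb : ∀ m ∈ (𝓡∂ n).boundary M, P m ⬝ᵥ e = r ∧ N m ⬝ᵥ e = c) {t : ℝ} (ht : t ≠ 0)
    {ρ : M → ℝ} (hρ : ContMDiff (𝓡∂ n) 𝓘(ℝ, ℝ) ∞ ρ) {q : M}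
    (hρq : tsupport ρ ⊆ (extChartAt (𝓡∂ n) q).source) :
    ∫ z, localizedIntegrand P N (capillaryField e a r c P N) t ρ z ∂(area x) = 0 := by
  set Z := capillaryField e a r c P N with hZdef
  have hZ : ContMDiff (𝓡∂ n) 𝓘(ℝ, Fin (n + 2) → ℝ) ∞ Z :=
    contMDiff_capillaryField H.contMDiff H.contMDiff_normal e a r c
  have hG := H.continuous_localizedIntegrand hZ t hρ
  set G := localizedIntegrand P N Z t ρ with hGdef
  have hG0 : ∀ z ∉ tsupport ρ, G z = 0 := fun z hz => localizedIntegrand_eq_zero t hz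
  rw [integral_area_eq_of_support_subset hx q hG fun z hz => hG0 z fun h => hz (hρq h)]
  set T := (extChartAt (𝓡∂ n) q).target with hTdef
  have hTm : MeasurableSet T := measurableSet_extChartAt_target q
  set K := extChartAt (𝓡∂ n) q '' tsupport ρ with hKdef
  have hKc : IsCompact K := (isClosed_tsupport ρ).isCompact.image_of_continuousOn
    ((continuousOn_extChartAt q).mono hρq)
  have hKT : K ⊆ T := by
    rintro _ ⟨z, hz, rfl⟩
    exact (extChartAt (𝓡∂ n) q).map_source (hρq hz)
  have hKρ : ∀ y ∈ T, y ∉ K → (extChartAt (𝓡∂ n) q).symm y ∉ tsupport ρ := by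
    intro y hy hyK h
    exact hyK ⟨_, h, (extChartAt (𝓡∂ n) q).right_inv hy⟩
  have hTH : T ⊆ {y | 0 ≤ y 0} := fun y hy => nonneg_of_mem_target hy
  have hTn : ∀ y ∈ T, T ∈ 𝓝[{y | 0 ≤ y 0}] y := by
    intro y hy
    rw [← range_modelWithCornersEuclideanHalfSpace]
    exact extChartAt_target_mem_nhdsWithin_of_mem hy
  set δ : EuclideanSpace ℝ (Fin n) → ℝ := fun y => frameDet (P ((extChartAt (𝓡∂ n) q).symm y))
    (N ((extChartAt (𝓡∂ n) q).symm y)) (chartDeriv P q y) with hδ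
  set E : Fin n → EuclideanSpace ℝ (Fin n) → ℝ := fun i y =>
    frameDet (P ((extChartAt (𝓡∂ n) q).symm y)) (N ((extChartAt (𝓡∂ n) q).symm y))
      (Function.update (fun j => chartDeriv P q y j + t • chartDeriv N q y j) i
        (ρ ((extChartAt (𝓡∂ n) q).symm y) • Z ((extChartAt (𝓡∂ n) q).symm y))) with hE
  have hEc : ∀ i, ContinuousOn (E i) T := by
    intro i
    refine continuousOn_frameDet (contDiffOn_comp_extChartAt_symm H.contMDiff q).continuousOn
      (contDiffOn_comp_extChartAt_symm H.contMDiff_normal q).continuousOn fun j => ?_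
    by_cases hj : j = i
    · subst hj
      simp only [Function.update_self]
      exact (contDiffOn_comp_extChartAt_symm hρ q).continuousOn.smul
        (contDiffOn_comp_extChartAt_symm hZ q).continuousOn
    · simp only [Function.update_of_ne hj]
      exact (contDiffOn_chartDeriv H.contMDiff q j).continuousOn.add
        ((contDiffOn_chartDeriv H.contMDiff_normal q j).continuousOn.const_smul t)
  have hE0 : ∀ i, ∀ y ∈ T, y ∉ K → E i y = 0 := by
    intro i y hy hyK
    have : ρ ((extChartAt (𝓡∂ n) q).symm y) = 0 := image_eq_zero_of_notMem_tsupport (hKρ y hy hyK)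
    simp only [hE]
    rw [frameDet_update_smul, this, zero_mul]
  -- Extension by zero to the half-space, with the sign correcting the orientation of the chart.
  set Fv : Fin n → EuclideanSpace ℝ (Fin n) → ℝ :=
    fun i => T.indicator fun y => Real.sign (δ y) * E i y with hFv
  set D : EuclideanSpace ℝ (Fin n) → ℝ := T.indicator fun y =>
    Real.sqrt (gramMatrix x q y).det * G ((extChartAt (𝓡∂ n) q).symm y) with hD
  have hDc : ContinuousOn (fun y => Real.sqrt (gramMatrix x q y).det *
      G ((extChartAt (𝓡∂ n) q).symm y)) T :=
    (continuousOn_sqrt_det_gramMatrix hx q).mul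
      (hG.comp_continuousOn (continuousOn_extChartAt_symm q))
  have hD0 : ∀ y, y ∉ K → D y = 0 := by
    intro y hyK
    by_cases hy : y ∈ T
    · simp only [hD, indicator_of_mem hy]
      rw [hG0 _ (hKρ y hy hyK), mul_zero]
    · exact indicator_of_notMem hy _
  have hsplit : ∀ y, 0 ≤ y 0 → y ∉ T → ∀ i, Fv i =ᶠ[𝓝[{y | 0 ≤ y 0}] y] fun _ => 0 := by
    intro y hy hyT i
    -- K is closed and contained in T, so a point outside T has a neighbourhood missing K, on which
    -- the extended field vanishes.
    have h1 : Kᶜ ∈ 𝓝 y := hKc.isClosed.isOpen_compl.mem_nhds fun h => hyT (hKT h)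
    filter_upwards [mem_nhdsWithin_of_mem_nhds h1] with y' hy'
    by_cases hy'T : y' ∈ T
    · simp only [hFv, indicator_of_mem hy'T, hE0 i y' hy'T hy', mul_zero]
    · exact indicator_of_notMem hy'T _
  have hlocal : ∀ y ∈ T, ∀ i, Fv i =ᶠ[𝓝[{y | 0 ≤ y 0}] y] fun y' => Real.sign (δ y) * E i y' := by
    intro y hy i
    have h1 : 𝓝[{y | 0 ≤ y 0}] y = 𝓝[T] y :=
      le_antisymm (nhdsWithin_le_of_mem (hTn y hy)) (nhdsWithin_mono y hTH)
    rw [h1]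
    filter_upwards [H.eventually_sign_eq q hy, self_mem_nhdsWithin] with y' hy' hy'T
    simp only [hFv, indicator_of_mem hy'T]
    rw [← hy']
  have hmain : ∫ y in {y : EuclideanSpace ℝ (Fin n) | 0 ≤ y 0}, D y = 0 := by
    refine integral_eq_zero_of_eq_divergence Fv D hKc ?_ ?_ (fun y _ h => hD0 y h) ?_ ?_ ?_
    · intro i y hy
      by_cases hyT : y ∈ T
      · have h1 : ContinuousWithinAt (fun y' => Real.sign (δ y) * E i y') {y | 0 ≤ y 0} y :=
          (continuousWithinAt_const.mul (hEc i y hyT)).mono_of_mem_nhdsWithin (hTn y hyT)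
        exact h1.congr_of_eventuallyEq (hlocal y hyT i)
          ((hlocal y hyT i).self_of_nhdsWithin hy)
      · exact continuousWithinAt_const.congr_of_eventuallyEq (hsplit y hy hyT i)
          ((hsplit y hy hyT i).self_of_nhdsWithin hy)
    · intro i y hy hyK
      by_cases hyT : y ∈ T
      · simp only [hFv, indicator_of_mem hyT, hE0 i y hyT hyK, mul_zero]
      · exact indicator_of_notMem hyT _
    · intro y hy0
      have hHn : {y : EuclideanSpace ℝ (Fin n) | 0 ≤ y 0} ∈ 𝓝 y := by
        have : IsOpen {y : EuclideanSpace ℝ (Fin n) | 0 < y 0} :=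
          isOpen_lt continuous_const (by fun_prop)
        exact mem_of_superset (this.mem_nhds hy0) fun z (hz : 0 < z 0) => hz.le
      have hnh := nhdsWithin_eq_nhds.mpr hHn
      by_cases hyT : y ∈ T
      · obtain ⟨L, hL, hLs⟩ := H.exists_hasFDerivAt_localized ht e a r c hρ q hyT hy0
        refine ⟨fun i => Real.sign (δ y) • L i, fun i => ?_, ?_⟩
        · have h1 := hlocal y hyT i
          rw [hnh] at h1
          exact ((hL i).const_mul (Real.sign (δ y))).congr_of_eventuallyEq h1
        · have hF := H.isHypersurfaceFrame q hyT
          have hne : δ y ≠ 0 := hF.frameDet_ne_zero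
          have hsq : δ y ^ 2 = (gramMatrix x q y).det := by
            rw [hgram q y hyT]; exact hF.frameDet_sq
          rw [← hgram q y hyT, ← hsq] at hLs
          have hLs' : ∑ i, L i (EuclideanSpace.single i 1) =
              δ y * G ((extChartAt (𝓡∂ n) q).symm y) := by
            have h2 : (∑ i, L i (EuclideanSpace.single i 1)) * δ y =
              δ y ^ 2 * G ((extChartAt (𝓡∂ n) q).symm y) := hLs
            refine mul_right_cancel₀ hne ?_
            rw [h2]; ring
          simp only [hD, indicator_of_mem hyT, _root_.smul_apply, smul_eq_mul]
          rw [← Finset.mul_sum, hLs', ← hsq, Real.sqrt_sq_eq_abs, ← mul_assoc]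
          congr 1
          rcases lt_or_gt_of_ne hne with h | h
          · rw [Real.sign_of_neg h, abs_of_neg h]; ring
          · rw [Real.sign_of_pos h, abs_of_pos h]; ring
      · refine ⟨0, fun i => ?_, ?_⟩
        · have h1 := hsplit y hy0.le hyT i
          rw [hnh] at h1
          exact (hasFDerivAt_const (0 : ℝ) y).congr_of_eventuallyEq h1
        · simp [hD, indicator_of_notMem hyT]
    · intro y hy0
      by_cases hyT : y ∈ T
      · simp only [hFv, indicator_of_mem hyT]
        rw [hE]
        simp only
        rw [H.frameDet_capillaryField_eq_zero hee hea hrc hb t _ q hyT hy0, mul_zero]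
      · exact indicator_of_notMem hyT _
    · have h1 : IntegrableOn D K := by
        refine ((hDc.mono hKT).integrableOn_compact hKc).congr_fun (fun y hy => ?_)
          hKc.measurableSet
        simp only [hD, indicator_of_mem (hKT hy)]
      have h2 : Integrable D := (integrableOn_iff_integrable_of_support_subset
        (fun y hy => by_contra fun h => hy (hD0 y h))).mp h1
      exact h2.integrableOn
  rw [setIntegral_indicator hTm, inter_eq_self_of_subset_right hTH] at hmain
  exact hmain

end IsSphericalHypersurface

end GlobalIdentity

/-! ### From local pieces to the formula for each k -/

section MinkowskiFormula

open Set Filter Topology MeasureTheory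

/-- A polynomial with infinitely many roots is zero, so excluding t = 0 costs nothing. -/
theorem eq_zero_of_sum_pow_mul_eq_zero {m : ℕ} {c : ℕ → ℝ}
    (h : ∀ t : ℝ, t ≠ 0 → ∑ k ∈ Finset.range m, t ^ k * c k = 0) {k : ℕ} (hk : k < m) :
    c k = 0 := by
  set p : Polynomial ℝ := ∑ k ∈ Finset.range m, Polynomial.monomial k (c k) with hp
  have h0 : p = 0 := by
    refine Polynomial.eq_zero_of_infinite_isRoot p
      ((finite_singleton (0 : ℝ)).infinite_compl.mono fun t ht => ?_)
    simp only [mem_ofPred_eq, Polynomial.IsRoot.def, hp, Polynomial.eval_finsetSum,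
      Polynomial.eval_monomial]
    rw [← h t ht]
    exact Finset.sum_congr rfl fun _ _ => mul_comm _ _
  have h1 := congrArg (fun q => Polynomial.coeff q k) h0
  simpa [hp, Polynomial.finsetSum_coeff, Polynomial.coeff_monomial, hk] using h1

variable {n : ℕ} [NeZero n] {M : Type*} [TopologicalSpace M]
  [ChartedSpace (EuclideanHalfSpace n) M] [IsManifold (𝓡∂ n) ∞ M]

theorem chartDeriv_sum {F : Type*} [NormedAddCommGroup F] [NormedSpace ℝ F] {ι : Type*}
    (s : Finset ι) {f : ι → M → F} (hf : ∀ i, ContMDiff (𝓡∂ n) 𝓘(ℝ, F) ∞ (f i)) (q : M)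
    {y : EuclideanSpace ℝ (Fin n)} (hy : y ∈ (extChartAt (𝓡∂ n) q).target) :
    chartDeriv (fun m => ∑ i ∈ s, f i m) q y = ∑ i ∈ s, chartDeriv (f i) q y := by
  funext j
  have h := HasFDerivWithinAt.fun_sum (u := s) fun i _ => hasFDerivWithinAt_comp_symm (hf i) q hy
  rw [chartDeriv_eq_of_hasFDerivWithinAt (f := fun m => ∑ i ∈ s, f i m) hy h j,
    _root_.sum_apply, Finset.sum_apply]
  exact Finset.sum_congr rfl fun i _ => (chartDeriv_eq_fderivWithin_target (f i) q hy j).symm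

variable [T2Space M] [CompactSpace M]

theorem exists_finset_partition : ∃ (s : Finset M) (ρ : M → M → ℝ),
    (∀ i, ContMDiff (𝓡∂ n) 𝓘(ℝ, ℝ) ∞ (ρ i)) ∧
    (∀ i, tsupport (ρ i) ⊆ (extChartAt (𝓡∂ n) i).source) ∧ ∀ z, ∑ i ∈ s, ρ i z = 1 := by
  obtain ⟨f, hf⟩ := SmoothPartitionOfUnity.exists_isSubordinate_chartAt_source (𝓡∂ n) M
  have hfin := f.locallyFinite.finite_nonempty_of_compact
  refine ⟨hfin.toFinset, fun i => f i, fun i => (f i).contMDiff, fun i => ?_, fun z => ?_⟩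
  · rw [extChartAt_source]; exact hf i
  · rw [← f.sum_eq_one (mem_univ z)]
    refine (finsum_eq_finsetSum_of_support_subset _ fun i hi => ?_).symm
    simp only [Finite.coe_toFinset, mem_ofPred_eq]
    exact ⟨z, hi⟩

variable [MeasurableSpace M] [BorelSpace M]

theorem integrable_area {x : M → Ambient n} (hx : ContMDiff (𝓡∂ n) 𝓘(ℝ, Ambient n) ∞ x)
    {G : M → ℝ} (hG : Continuous G) : Integrable G (area x) := by
  have := isFiniteMeasure_area hx
  exact hG.integrable_of_hasCompactSupport (HasCompactSupport.of_compactSpace G)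

namespace IsSphericalHypersurface

variable {P N : M → Fin (n + 2) → ℝ} (H : IsSphericalHypersurface P N)
include H

/-- Summed over the partition of unity, the terms with dρ pair with the differential of the constant
1 and disappear. -/
theorem integral_minkowskiIntegrand_eq_zero {x : M → Ambient n}
    (hx : ContMDiff (𝓡∂ n) 𝓘(ℝ, Ambient n) ∞ x)
    (hgram : ∀ q, ∀ y ∈ (extChartAt (𝓡∂ n) q).target,
      gramMatrix x q y = dotMatrix (chartDeriv P q y) (chartDeriv P q y))
    {e a : Fin (n + 2) → ℝ} {r c : ℝ} (hee : e ⬝ᵥ e = 1)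
    (hea : e ⬝ᵥ a = 0) (hrc : r ^ 2 + c ^ 2 ≠ 1)
    (hb : ∀ m ∈ (𝓡∂ n).boundary M, P m ⬝ᵥ e = r ∧ N m ⬝ᵥ e = c) {t : ℝ} (ht : t ≠ 0) :
    ∫ z, minkowskiIntegrand P N (capillaryField e a r c P N) t z ∂(area x) = 0 := by
  have hZ := contMDiff_capillaryField H.contMDiff H.contMDiff_normal e a r c
  obtain ⟨s, ρ, hρ, hsub, hsum⟩ := exists_finset_partition (n := n) (M := M)
  have hpt : ∀ z, minkowskiIntegrand P N (capillaryField e a r c P N) t z =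
      ∑ i ∈ s, localizedIntegrand P N (capillaryField e a r c P N) t (ρ i) z := by
    intro z
    unfold localizedIntegrand chartPairing
    rw [Finset.sum_add_distrib, ← Finset.sum_mul, hsum, one_mul, ← newtonPairing_sum,
      ← chartDeriv_sum s hρ z (mem_extChartAt_target z), funext hsum,
      funext (chartDeriv_const (1 : ℝ) z _)]
    exact (add_eq_left.mpr (newtonPairing_zero _ _ _ _)).symm
  simp only [hpt]
  rw [integral_finsetSum _ fun i _ =>
    integrable_area hx (H.continuous_localizedIntegrand hZ t (hρ i))]
  exact Finset.sum_eq_zero fun i _ =>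
    H.integral_localizedIntegrand_eq_zero hx hgram hee hea hrc hb ht (hρ i) (hsub i)

theorem integral_meanCurvature {x : M → Ambient n}
    (hx : ContMDiff (𝓡∂ n) 𝓘(ℝ, Ambient n) ∞ x)
    (hgram : ∀ q, ∀ y ∈ (extChartAt (𝓡∂ n) q).target,
      gramMatrix x q y = dotMatrix (chartDeriv P q y) (chartDeriv P q y))
    {e a : Fin (n + 2) → ℝ} {r c : ℝ} (hee : e ⬝ᵥ e = 1)
    (hea : e ⬝ᵥ a = 0) (hrc : r ^ 2 + c ^ 2 ≠ 1)
    (hb : ∀ m ∈ (𝓡∂ n).boundary M, P m ⬝ᵥ e = r ∧ N m ⬝ᵥ e = c) {k : ℕ} (hk : k < n) :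
    Integrable (fun z => meanCurvature P N k z * -(capillaryField e a r c P N z ⬝ᵥ P z))
      (area x) ∧
    Integrable (fun z => meanCurvature P N (k + 1) z * (capillaryField e a r c P N z ⬝ᵥ N z))
      (area x) ∧
    ((n : ℝ) - k) *
        ∫ z, meanCurvature P N k z * -(capillaryField e a r c P N z ⬝ᵥ P z) ∂(area x) =
      ((k : ℝ) + 1) *
        ∫ z, meanCurvature P N (k + 1) z * (capillaryField e a r c P N z ⬝ᵥ N z) ∂(area x) := by
  have hZ := (contMDiff_capillaryField H.contMDiff H.contMDiff_normal e a r c).continuous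
  have hdot : ∀ {f g : M → Fin (n + 2) → ℝ}, Continuous f → Continuous g →
      Continuous fun z => f z ⬝ᵥ g z := by
    intro f g hf hg
    rw [← continuousOn_univ] at hf hg ⊢
    exact continuousOn_dotProduct hf hg
  have hi : ∀ k < n,
      Integrable (fun z => meanCurvature P N k z * -(capillaryField e a r c P N z ⬝ᵥ P z))
        (area x) ∧
      Integrable (fun z => meanCurvature P N (k + 1) z * (capillaryField e a r c P N z ⬝ᵥ N z))
        (area x) := fun k hk =>
    ⟨integrable_area hx ((H.continuous_meanCurvature hk.le).mul
      (hdot hZ H.contMDiff.continuous).neg), integrable_area hx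
        ((H.continuous_meanCurvature hk).mul (hdot hZ H.contMDiff_normal.continuous))⟩
  refine ⟨(hi k hk).1, (hi k hk).2, sub_eq_zero.mp ?_⟩
  refine eq_zero_of_sum_pow_mul_eq_zero (m := n) (c := fun k => ((n : ℝ) - k) *
        ∫ z, meanCurvature P N k z * -(capillaryField e a r c P N z ⬝ᵥ P z) ∂(area x) -
      ((k : ℝ) + 1) *
        ∫ z, meanCurvature P N (k + 1) z * (capillaryField e a r c P N z ⬝ᵥ N z) ∂(area x))
    (fun t ht => ?_) hk
  rw [← H.integral_minkowskiIntegrand_eq_zero hx hgram hee hea hrc hb ht]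
  unfold minkowskiIntegrand
  simp only [mul_assoc]
  rw [integral_finsetSum _ fun k hk => ?_]
  · refine Finset.sum_congr rfl fun k hk => ?_
    have h := hi k (Finset.mem_range.mp hk)
    rw [integral_const_mul, integral_sub (h.1.const_mul _) (h.2.const_mul _), integral_const_mul,
      integral_const_mul]
  · have h := hi k (Finset.mem_range.mp hk)
    exact ((h.1.const_mul _).sub (h.2.const_mul _)).const_mul _

end IsSphericalHypersurface

end MinkowskiFormula

/-! ### Inverse stereographic projection and the fields X_a, Y_a, V_a -/

section Stereographic

open Set Filter Topology Matrix

section Model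

variable {n : ℕ}

/-- The linear isometry `ℝ × ℝ^{n+1} → ℝ^{n+2}`. -/
def consL (n : ℕ) : ℝ × Ambient n →L[ℝ] (Fin (n + 2) → ℝ) :=
  LinearMap.toContinuousLinearMap
    { toFun := fun p => vecCons p.1 p.2.ofLp
      map_add' := fun p q => by simp
      map_smul' := fun s p => by simp }

theorem consL_dotProduct (s s' : ℝ) (v v' : Ambient n) :
    consL n (s, v) ⬝ᵥ consL n (s', v') = s * s' + inner ℝ v v' := by
  change vecCons s v.ofLp ⬝ᵥ vecCons s' v'.ofLp = _
  rw [cons_dotProduct_cons, EuclideanSpace.inner_eq_star_dotProduct, dotProduct_comm]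
  simp

/-- The conformal factor of `gbar`. -/
def conf (x : Ambient n) : ℝ := 2 / (1 + ‖x‖ ^ 2)

theorem conf_pos (x : Ambient n) : 0 < conf x := by unfold conf; positivity

/-- Eliminating ‖x‖² turns the identities below into rational identities in `conf x` and inner
products. -/
theorem norm_sq_eq (x : Ambient n) : ‖x‖ ^ 2 = 2 / conf x - 1 := by
  unfold conf
  have : 1 + ‖x‖ ^ 2 ≠ 0 := by positivity
  field_simp
  ring

theorem gbar_eq (x u w : Ambient n) : gbar x u w = conf x ^ 2 * inner ℝ u w := by
  unfold gbar conf
  rw [div_pow]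
  norm_num

theorem christoffel_eq (x u w : Ambient n) :
    christoffel x u w = (-conf x) • (inner ℝ x u • w + inner ℝ x w • u - inner ℝ u w • x) := by
  unfold christoffel conf
  rw [neg_div]

theorem contDiff_conf : ContDiff ℝ ∞ (conf (n := n)) :=
  contDiff_const.div (contDiff_const.add (contDiff_norm_sq ℝ)) fun x => by positivity

/-- Inverse stereographic projection. -/
def stereoInv (x : Ambient n) : Fin (n + 2) → ℝ := consL n (conf x - 1, conf x • x)

/-- The differential of inverse stereographic projection. -/
def stereoDeriv (x v : Ambient n) : Fin (n + 2) → ℝ :=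
  consL n (-conf x ^ 2 * inner ℝ x v, conf x • v + (-conf x ^ 2 * inner ℝ x v) • x)

theorem contDiff_stereoInv : ContDiff ℝ ∞ (stereoInv (n := n)) :=
  (consL n).contDiff.comp ((contDiff_conf.sub contDiff_const).prodMk (contDiff_conf.smul contDiff_id))

theorem stereoInv_dotProduct_self (x : Ambient n) : stereoInv x ⬝ᵥ stereoInv x = 1 := by
  have h := (conf_pos x).ne'
  simp only [stereoInv, consL_dotProduct, inner_smul_left, inner_smul_right, conj_trivial,
    real_inner_self_eq_norm_sq, norm_sq_eq]
  field_simp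
  ring

theorem stereoInv_dotProduct_stereoDeriv (x v : Ambient n) :
    stereoInv x ⬝ᵥ stereoDeriv x v = 0 := by
  have h := (conf_pos x).ne'
  simp only [stereoInv, stereoDeriv, consL_dotProduct, inner_smul_left, inner_smul_right,
    inner_add_right, conj_trivial, real_inner_self_eq_norm_sq, norm_sq_eq]
  field_simp
  ring

theorem stereoDeriv_dotProduct (x v w : Ambient n) :
    stereoDeriv x v ⬝ᵥ stereoDeriv x w = gbar x v w := by
  have h := (conf_pos x).ne'
  simp only [stereoDeriv, consL_dotProduct, gbar_eq, inner_smul_left, inner_smul_right,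
    inner_add_left, inner_add_right, conj_trivial, real_inner_self_eq_norm_sq, norm_sq_eq,
    real_inner_comm x v]
  field_simp
  ring

/-- The left factor is the derivative of `stereoDeriv x v` when x moves with velocity u and v with
velocity w; `μ` is the derivative of the scalar -conf² ⟨x, v⟩. The identity is the Gauss formula:
the tangential part of the flat derivative is the Levi-Civita derivative. -/
theorem stereoDeriv_deriv_dotProduct (x v u w z : Ambient n) {μ : ℝ}
    (hμ : μ = 2 * conf x ^ 3 * inner ℝ x u * inner ℝ x v -
      conf x ^ 2 * (inner ℝ u v + inner ℝ x w)) :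
    consL n (μ, conf x • w + (-conf x ^ 2 * inner ℝ x u) • v +
        ((-conf x ^ 2 * inner ℝ x v) • u + μ • x)) ⬝ᵥ stereoDeriv x z =
      gbar x (w + christoffel x u v) z := by
  have h := (conf_pos x).ne'
  simp only [stereoDeriv, consL_dotProduct, gbar_eq, christoffel_eq, inner_smul_left,
    inner_smul_right, inner_add_left, inner_add_right, inner_sub_left, conj_trivial,
    real_inner_self_eq_norm_sq, norm_sq_eq, real_inner_comm x v, real_inner_comm x u,
    real_inner_comm x w, hμ]
  field_simp
  ring

/-- The north pole. -/
def pole (n : ℕ) : Fin (n + 2) → ℝ := consL n (1, 0)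

theorem pole_dotProduct_self : pole n ⬝ᵥ pole n = 1 := by simp [pole, consL_dotProduct]

theorem pole_dotProduct_consL_zero (a : Ambient n) : pole n ⬝ᵥ consL n (0, a) = 0 := by
  simp [pole, consL_dotProduct]

theorem stereoInv_dotProduct_pole (x : Ambient n) : stereoInv x ⬝ᵥ pole n = conf x - 1 := by
  simp [stereoInv, pole, consL_dotProduct]

theorem stereoDeriv_dotProduct_pole (x v : Ambient n) :
    stereoDeriv x v ⬝ᵥ pole n = -conf x ^ 2 * inner ℝ x v := by
  simp [stereoDeriv, pole, consL_dotProduct]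

theorem stereoInv_dotProduct_consL_zero (x a : Ambient n) :
    stereoInv x ⬝ᵥ consL n (0, a) = conf x * inner ℝ x a := by
  simp [stereoInv, consL_dotProduct, inner_smul_left]

theorem stereoDeriv_dotProduct_consL_zero (x v a : Ambient n) :
    stereoDeriv x v ⬝ᵥ consL n (0, a) =
      conf x * inner ℝ a v - conf x ^ 2 * inner ℝ x v * inner ℝ x a := by
  simp only [stereoDeriv, consL_dotProduct, inner_add_left, inner_smul_left, conj_trivial,
    real_inner_comm a v]
  ring

theorem fieldV_eq (a x : Ambient n) : fieldV a x = conf x * inner ℝ x a := by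
  unfold fieldV conf; ring

/-- On the sphere Y_a is the rotation field ⟨P, e⟩ a - ⟨P, a⟩ e; the factors on the right are its
dot products with the image of `v`, written out. -/
theorem gbar_fieldY (a x v : Ambient n) : gbar x (fieldY a x) v =
    (conf x - 1) * (conf x * inner ℝ a v - conf x ^ 2 * inner ℝ x v * inner ℝ x a) -
      conf x * inner ℝ x a * (-conf x ^ 2 * inner ℝ x v) := by
  have h := (conf_pos x).ne'
  simp only [gbar_eq, fieldY, inner_add_left, inner_smul_left, conj_trivial, norm_sq_eq]
  field_simp
  ring

theorem euclRadius_sq {R : ℝ} (hR : R ∈ Ioo 0 Real.pi) :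
    0 < 1 + Real.cos R ∧ euclRadius R ^ 2 = (1 - Real.cos R) / (1 + Real.cos R) := by
  have h1 : -1 < Real.cos R := by
    rw [← Real.cos_pi]
    exact Real.strictAntiOn_cos ⟨hR.1.le, hR.2.le⟩ ⟨Real.pi_pos.le, le_rfl⟩ hR.2
  have h2 : 0 < 1 + Real.cos R := by linarith
  refine ⟨h2, Real.sq_sqrt (div_nonneg ?_ h2.le)⟩
  linarith [Real.cos_le_one R]

/-- X_a is the negative of the tangential part of a, plus cos R times Y_a. This comes from 2 / (1 +
r₀²) = 1 + cos R. -/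
theorem gbar_fieldX {R : ℝ} (hR : R ∈ Ioo 0 Real.pi) (a x v : Ambient n) :
    gbar x (fieldX R a x) v =
      -(conf x * inner ℝ a v - conf x ^ 2 * inner ℝ x v * inner ℝ x a) +
        Real.cos R * gbar x (fieldY a x) v := by
  have h := (conf_pos x).ne'
  obtain ⟨h1, h2⟩ := euclRadius_sq hR
  have h3 : 2 / (1 + euclRadius R ^ 2) = 1 + Real.cos R := by
    rw [h2]; field_simp; ring
  simp only [gbar_fieldY]
  simp only [fieldX, h3]
  simp only [gbar_eq, inner_sub_left, inner_smul_left, conj_trivial, norm_sq_eq, h2]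
  field_simp
  ring

theorem pole_dotProduct_of_mem_geodesicSphere {R : ℝ} (hR : R ∈ Ioo 0 Real.pi) {x : Ambient n}
    (hx : x ∈ geodesicSphere n R) : stereoInv x ⬝ᵥ pole n = Real.cos R := by
  have hn : ‖x‖ = euclRadius R := by simpa [geodesicSphere] using hx
  obtain ⟨h1, h2⟩ := euclRadius_sq hR
  rw [stereoInv_dotProduct_pole, conf, hn, h2]
  field_simp
  ring

/-- On ∂B_R the tangential part of the pole is -sin R times the outward normal, so the contact angle
condition fixes ⟨N, e⟩ = -sin R cos (π - θ). -/
theorem pole_dotProduct_stereoDeriv_of_mem_geodesicSphere {R θ : ℝ} (hR : R ∈ Ioo 0 Real.pi)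
    {x v : Ambient n} (hx : x ∈ geodesicSphere n R)
    (hv : gbar x v (outwardNormal x) = Real.cos (Real.pi - θ)) :
    stereoDeriv x v ⬝ᵥ pole n = Real.sin R * Real.cos θ := by
  have hn : ‖x‖ = euclRadius R := by simpa [geodesicSphere] using hx
  obtain ⟨h1, h2⟩ := euclRadius_sq hR
  have hconf : conf x = 1 + Real.cos R := by
    rw [conf, hn, h2]; field_simp; ring
  have hsin := Real.sin_pos_of_mem_Ioo hR
  have hr : euclRadius R * (1 + Real.cos R) = Real.sin R := by
    have h4 : 0 ≤ euclRadius R := Real.sqrt_nonneg _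
    refine (sq_eq_sq₀ (by positivity) hsin.le).mp ?_
    rw [mul_pow, h2, Real.sin_sq]
    field_simp
    ring
  have hr0 : euclRadius R ≠ 0 := fun h => by rw [h, zero_mul] at hr; exact hsin.ne hr
  have hout : outwardNormal x = (1 / (conf x * euclRadius R)) • x := by
    unfold outwardNormal conf
    rw [hn]
    congr 1
    have : 1 + euclRadius R ^ 2 ≠ 0 := by positivity
    field_simp
  have hc := (conf_pos x).ne'
  rw [Real.cos_pi_sub, hout, gbar_eq, inner_smul_right, real_inner_comm] at hv
  rw [stereoDeriv_dotProduct_pole, ← hr, ← hconf]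
  field_simp at hv
  linear_combination (-conf x) * hv

end Model

end Stereographic

/-! ### Transfer of derivatives to the sphere -/

section StereographicHypersurface

open Set Filter Topology Matrix

variable {n : ℕ} [NeZero n] {M : Type*} [TopologicalSpace M]
  [ChartedSpace (EuclideanHalfSpace n) M]

theorem chartDeriv_self_eq_mfderiv {f : M → Ambient n}
    (hf : ContMDiff (𝓡∂ n) 𝓘(ℝ, Ambient n) ∞ f) (z : M) (i : Fin n) :
    chartDeriv f z (extChartAt (𝓡∂ n) z z) i =
      mfderiv (𝓡∂ n) 𝓘(ℝ, Ambient n) f z (EuclideanSpace.single i (1 : ℝ)) := by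
  rw [((hf z).mdifferentiableAt (by simp)).mfderiv]
  rfl

variable [IsManifold (𝓡∂ n) ∞ M]

theorem chartDeriv_inner {f g : M → Ambient n} (hf : ContMDiff (𝓡∂ n) 𝓘(ℝ, Ambient n) ∞ f)
    (hg : ContMDiff (𝓡∂ n) 𝓘(ℝ, Ambient n) ∞ g) (q : M) {y : EuclideanSpace ℝ (Fin n)}
    (hy : y ∈ (extChartAt (𝓡∂ n) q).target) (i : Fin n) :
    chartDeriv (fun m => (inner ℝ (f m) (g m) : ℝ)) q y i =
      inner ℝ (f ((extChartAt (𝓡∂ n) q).symm y)) (chartDeriv g q y i) +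
        inner ℝ (chartDeriv f q y i) (g ((extChartAt (𝓡∂ n) q).symm y)) := by
  have h := (hasFDerivWithinAt_comp_symm hf q hy).inner ℝ (hasFDerivWithinAt_comp_symm hg q hy)
  rw [chartDeriv_eq_of_hasFDerivWithinAt (f := fun m => (inner ℝ (f m) (g m) : ℝ)) hy h i,
    chartDeriv_eq_fderivWithin_target f q hy, chartDeriv_eq_fderivWithin_target g q hy]
  simp [fderivInnerCLM_apply]

theorem chartDeriv_mul {f g : M → ℝ} (hf : ContMDiff (𝓡∂ n) 𝓘(ℝ, ℝ) ∞ f)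
    (hg : ContMDiff (𝓡∂ n) 𝓘(ℝ, ℝ) ∞ g) (q : M) {y : EuclideanSpace ℝ (Fin n)}
    (hy : y ∈ (extChartAt (𝓡∂ n) q).target) (i : Fin n) :
    chartDeriv (fun m => f m * g m) q y i =
      f ((extChartAt (𝓡∂ n) q).symm y) * chartDeriv g q y i +
        chartDeriv f q y i * g ((extChartAt (𝓡∂ n) q).symm y) :=
  chartDeriv_smul hf hg q hy i

theorem chartDeriv_prodMk {F F' : Type*} [NormedAddCommGroup F] [NormedSpace ℝ F]
    [NormedAddCommGroup F'] [NormedSpace ℝ F'] {f : M → F} {g : M → F'}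
    (hf : ContMDiff (𝓡∂ n) 𝓘(ℝ, F) ∞ f)
    (hg : ContMDiff (𝓡∂ n) 𝓘(ℝ, F') ∞ g) (q : M) {y : EuclideanSpace ℝ (Fin n)}
    (hy : y ∈ (extChartAt (𝓡∂ n) q).target) (i : Fin n) :
    chartDeriv (fun m => (f m, g m)) q y i = (chartDeriv f q y i, chartDeriv g q y i) := by
  have h := (hasFDerivWithinAt_comp_symm hf q hy).prodMk (hasFDerivWithinAt_comp_symm hg q hy)
  rw [chartDeriv_eq_of_hasFDerivWithinAt (f := fun m => (f m, g m)) hy h i,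
    chartDeriv_eq_fderivWithin_target f q hy, chartDeriv_eq_fderivWithin_target g q hy]
  rfl

variable {x ν : M → Ambient n} (hx : ContMDiff (𝓡∂ n) 𝓘(ℝ, Ambient n) ∞ x)
  (hν : ContMDiff (𝓡∂ n) 𝓘(ℝ, Ambient n) ∞ ν)
include hx

omit [IsManifold (𝓡∂ n) ∞ M] in
theorem contMDiff_conf : ContMDiff (𝓡∂ n) 𝓘(ℝ, ℝ) ∞ fun m => conf (x m) :=
  contDiff_conf.contMDiff.comp hx

/-- Obtained by differentiating the relation conf x · (1 + |x|²) = 2. -/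
theorem chartDeriv_conf (q : M) {y : EuclideanSpace ℝ (Fin n)}
    (hy : y ∈ (extChartAt (𝓡∂ n) q).target) (i : Fin n) :
    chartDeriv (fun m => conf (x m)) q y i =
      -conf (x ((extChartAt (𝓡∂ n) q).symm y)) ^ 2 *
        inner ℝ (x ((extChartAt (𝓡∂ n) q).symm y)) (chartDeriv x q y i) := by
  have hi : ContMDiff (𝓡∂ n) 𝓘(ℝ, ℝ) ∞ fun m => (inner ℝ (x m) (x m) : ℝ) :=
    (contDiff_id.inner ℝ contDiff_id).contMDiff.comp hx
  have h1 := chartDeriv_mul (contMDiff_conf hx) (contMDiff_const (c := (1 : ℝ)).add hi) q hy i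
  have h2 := chartDeriv_add (contMDiff_const (c := (1 : ℝ))) hi q hy i
  rw [chartDeriv_const, chartDeriv_inner hx hx q hy] at h2
  have h3 : (fun m => conf (x m) * (1 + (inner ℝ (x m) (x m) : ℝ))) = fun _ => 2 := by
    funext m
    rw [real_inner_self_eq_norm_sq, conf]
    have : 1 + ‖x m‖ ^ 2 ≠ 0 := by positivity
    field_simp
  have h4 : chartDeriv (fun m => conf (x m) * (1 + (inner ℝ (x m) (x m) : ℝ))) q y i = 0 := by
    rw [h3, chartDeriv_const]
  have h5 := h1.symm.trans h4
  rw [real_inner_comm (x ((extChartAt (𝓡∂ n) q).symm y))] at h2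
  erw [h2] at h5
  simp only [Pi.add_apply, real_inner_self_eq_norm_sq, norm_sq_eq] at h5
  have hc := (conf_pos (x ((extChartAt (𝓡∂ n) q).symm y))).ne'
  field_simp at h5 ⊢
  linarith

theorem chartDeriv_stereoInv (q : M) {y : EuclideanSpace ℝ (Fin n)}
    (hy : y ∈ (extChartAt (𝓡∂ n) q).target) (i : Fin n) :
    chartDeriv (fun m => stereoInv (x m)) q y i =
      stereoDeriv (x ((extChartAt (𝓡∂ n) q).symm y)) (chartDeriv x q y i) := by
  have hc := contMDiff_conf hx
  have h1 := chartDeriv_clm (f := fun m => (conf (x m) + -1, conf (x m) • x m))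
    ((hc.add contMDiff_const).prodMk_space (hc.smul hx)) (consL n) q hy i
  have h2 := chartDeriv_prodMk (hc.add (contMDiff_const (c := (-1 : ℝ)))) (hc.smul hx) q hy i
  have h3 := chartDeriv_add hc (contMDiff_const (c := (-1 : ℝ))) q hy i
  have h4 := chartDeriv_smul hc hx q hy i
  rw [chartDeriv_const, add_zero, chartDeriv_conf hx q hy] at h3
  rw [chartDeriv_conf hx q hy] at h4
  refine Eq.trans h1 (congrArg _ (h2.trans ?_))
  exact Prod.ext h3 h4

include hν

theorem chartDeriv_stereoDeriv_dotProduct (q : M) {y : EuclideanSpace ℝ (Fin n)}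
    (hy : y ∈ (extChartAt (𝓡∂ n) q).target) (i : Fin n) (z : Ambient n) :
    chartDeriv (fun m => stereoDeriv (x m) (ν m)) q y i ⬝ᵥ
        stereoDeriv (x ((extChartAt (𝓡∂ n) q).symm y)) z =
      gbar (x ((extChartAt (𝓡∂ n) q).symm y)) (covDeriv x ν q y i) z := by
  have hc := contMDiff_conf hx
  have hi : ContMDiff (𝓡∂ n) 𝓘(ℝ, ℝ) ∞ fun m => (inner ℝ (x m) (ν m) : ℝ) :=
    (contDiff_fst.inner ℝ contDiff_snd).contMDiff.comp (hx.prodMk_space hν)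
  have hcc := hc.mul hc
  have hm0 := hcc.mul hi
  have hm : ContMDiff (𝓡∂ n) 𝓘(ℝ, ℝ) ∞ fun m => -conf (x m) ^ 2 * inner ℝ (x m) (ν m) :=
    ((contDiff_id.pow 2).neg.contMDiff.comp hc).mul hi
  have h1 := chartDeriv_clm
    (f := fun m => (-conf (x m) ^ 2 * inner ℝ (x m) (ν m),
      conf (x m) • ν m + (-conf (x m) ^ 2 * inner ℝ (x m) (ν m)) • x m))
    (hm.prodMk_space ((hc.smul hν).add (hm.smul hx))) (consL n) q hy i
  have h2 := chartDeriv_prodMk hm ((hc.smul hν).add (hm.smul hx)) q hy i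
  have h3 := chartDeriv_add (hc.smul hν) (hm.smul hx) q hy i
  have h4 := chartDeriv_smul hc hν q hy i
  have h5 := chartDeriv_smul hm hx q hy i
  have h6 : chartDeriv (fun m => -conf (x m) ^ 2 * inner ℝ (x m) (ν m)) q y i =
      2 * conf (x ((extChartAt (𝓡∂ n) q).symm y)) ^ 3 *
        inner ℝ (x ((extChartAt (𝓡∂ n) q).symm y)) (chartDeriv x q y i) *
        inner ℝ (x ((extChartAt (𝓡∂ n) q).symm y)) (ν ((extChartAt (𝓡∂ n) q).symm y)) -
      conf (x ((extChartAt (𝓡∂ n) q).symm y)) ^ 2 *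
        (inner ℝ (chartDeriv x q y i) (ν ((extChartAt (𝓡∂ n) q).symm y)) +
          inner ℝ (x ((extChartAt (𝓡∂ n) q).symm y)) (chartDeriv ν q y i)) := by
    have e1 := chartDeriv_const_smul hm0 (-1) q hy i
    have e2 := chartDeriv_mul hcc hi q hy i
    have e3 := chartDeriv_mul hc hc q hy i
    have e4 : (fun m => -conf (x m) ^ 2 * inner ℝ (x m) (ν m)) =
        fun m => (-1 : ℝ) • (conf (x m) * conf (x m) * inner ℝ (x m) (ν m)) := by
      funext m; rw [smul_eq_mul]; ring
    rw [e4]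
    refine Eq.trans e1 ?_
    erw [e2, e3]
    rw [chartDeriv_inner hx hν q hy, chartDeriv_conf hx q hy]
    simp only [smul_eq_mul, Pi.mul_apply]
    ring
  rw [chartDeriv_conf hx q hy] at h4
  have h7 : chartDeriv (fun m => stereoDeriv (x m) (ν m)) q y i = _ := Eq.trans h1
    (congrArg _ (h2.trans (congrArg (Prod.mk _) (h3.trans (congrArg₂ (· + ·) h4 h5)))))
  rw [h7]
  exact stereoDeriv_deriv_dotProduct _ _ _ _ _ h6

end StereographicHypersurface

/-! ### The given immersion as a hypersurface of the sphere -/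

section Capillary

open Set Filter Topology Matrix

variable {n : ℕ} [NeZero n] {M : Type*} [TopologicalSpace M]
  [ChartedSpace (EuclideanHalfSpace n) M] [IsManifold (𝓡∂ n) ∞ M]
  {x ν : M → Ambient n} (hx : ContMDiff (𝓡∂ n) 𝓘(ℝ, Ambient n) ∞ x)
include hx

theorem gramMatrix_eq_dotMatrix (q : M) {y : EuclideanSpace ℝ (Fin n)}
    (hy : y ∈ (extChartAt (𝓡∂ n) q).target) :
    gramMatrix x q y = dotMatrix (chartDeriv (fun m => stereoInv (x m)) q y)
      (chartDeriv (fun m => stereoInv (x m)) q y) := by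
  ext i j
  simp only [gramMatrix, Matrix.of_apply, dotMatrix_apply, chartDeriv_stereoInv hx q hy,
    stereoDeriv_dotProduct, coordDeriv_eq_chartDeriv]

theorem sigma_eq_meanCurvature (hν : ContMDiff (𝓡∂ n) 𝓘(ℝ, Ambient n) ∞ ν) (k : ℕ) (p : M) :
    sigma k x ν p =
      meanCurvature (fun m => stereoInv (x m)) (fun m => stereoDeriv (x m) (ν m)) k p := by
  unfold sigma principalCurvatures meanCurvature weingarten shapeMatrix
  have hy := mem_extChartAt_target (I := 𝓡∂ n) p
  rw [gramMatrix_eq_dotMatrix hx p hy]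
  congr 5
  ext i j
  rw [dotMatrix_apply, chartDeriv_stereoInv hx p hy,
    chartDeriv_stereoDeriv_dotProduct hx hν p hy]
  rfl

/-- `mfderiv` at a point is computed in the preferred chart of that point, so injectivity gives
definiteness there; congruence by the invertible transition matrix carries it to the other charts.
-/
theorem posDef_gramMatrix
    (hximm : ∀ p : M, Function.Injective (mfderiv (𝓡∂ n) 𝓘(ℝ, Ambient n) x p)) (q : M)
    {y : EuclideanSpace ℝ (Fin n)} (hy : y ∈ (extChartAt (𝓡∂ n) q).target) :
    (gramMatrix x q y).PosDef := by
  set z := (extChartAt (𝓡∂ n) q).symm y with hz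
  have hzq : z ∈ (extChartAt (𝓡∂ n) q).source := (extChartAt (𝓡∂ n) q).map_target hy
  have hyz : extChartAt (𝓡∂ n) q z = y := (extChartAt (𝓡∂ n) q).right_inv hy
  have hself : (gramMatrix x z (extChartAt (𝓡∂ n) z z)).PosDef := by
    have hinj : Function.Injective (fderivWithin ℝ (x ∘ (extChartAt (𝓡∂ n) z).symm)
        (Set.range (𝓡∂ n)) (extChartAt (𝓡∂ n) z z)) := by
      have h1 := hximm z
      rw [((hx z).mdifferentiableAt (by simp)).mfderiv] at h1
      exact h1
    have hli : LinearIndependent ℝ (chartDeriv x z (extChartAt (𝓡∂ n) z z)) := by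
      have h1 := (EuclideanSpace.basisFun (Fin n) ℝ).toBasis.linearIndependent.map'
        _ (LinearMap.ker_eq_bot.mpr hinj)
      have h2 : chartDeriv x z (extChartAt (𝓡∂ n) z z) =
          (fderivWithin ℝ (x ∘ (extChartAt (𝓡∂ n) z).symm) (Set.range (𝓡∂ n))
            (extChartAt (𝓡∂ n) z z)).toLinearMap ∘
              (EuclideanSpace.basisFun (Fin n) ℝ).toBasis := by
        funext i
        simp [chartDeriv]
      rw [h2]
      exact h1
    have h2 := (Matrix.posDef_gram_of_linearIndependent (𝕜 := ℝ) hli).smul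
      (pow_pos (conf_pos (x z)) 2)
    have h3 : gramMatrix x z (extChartAt (𝓡∂ n) z z) =
        conf (x z) ^ 2 • Matrix.gram ℝ (chartDeriv x z (extChartAt (𝓡∂ n) z z)) := by
      ext i j
      simp only [gramMatrix, Matrix.of_apply, Matrix.smul_apply, Matrix.gram_apply, gbar_eq,
        smul_eq_mul, coordDeriv_eq_chartDeriv, extChartAt_to_inv]
    rw [h3]
    exact h2
  have hdet := det_transMatrix_ne_zero hzq (mem_extChartAt_source (I := 𝓡∂ n) z)
  have h3 := hself.mul_mul_conjTranspose_same (B := transMatrix (n := n) q z z)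
    (Matrix.vecMul_injective_of_isUnit
      ((Matrix.isUnit_iff_isUnit_det _).mpr (isUnit_iff_ne_zero.mpr hdet)))
  rw [Matrix.conjTranspose_eq_transpose_of_trivial,
    ← gramMatrix_change hx hzq (mem_extChartAt_source z), hyz] at h3
  exact h3

omit [IsManifold (𝓡∂ n) ∞ M] in
theorem contMDiff_stereoDeriv (hν : ContMDiff (𝓡∂ n) 𝓘(ℝ, Ambient n) ∞ ν) :
    ContMDiff (𝓡∂ n) 𝓘(ℝ, Fin (n + 2) → ℝ) ∞ fun m => stereoDeriv (x m) (ν m) := by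
  have hc := contMDiff_conf hx
  have hi : ContMDiff (𝓡∂ n) 𝓘(ℝ, ℝ) ∞ fun m => (inner ℝ (x m) (ν m) : ℝ) :=
    (contDiff_fst.inner ℝ contDiff_snd).contMDiff.comp (hx.prodMk_space hν)
  have hm : ContMDiff (𝓡∂ n) 𝓘(ℝ, ℝ) ∞ fun m => -conf (x m) ^ 2 * inner ℝ (x m) (ν m) :=
    ((contDiff_id.pow 2).neg.contMDiff.comp hc).mul hi
  exact (consL n).contDiff.contMDiff.comp (hm.prodMk_space ((hc.smul hν).add (hm.smul hx)))

theorem gbar_normal_chartDeriv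
    (hνnormal : ∀ (p : M) (w : TangentSpace (𝓡∂ n) p),
      gbar (x p) (ν p) (mfderiv (𝓡∂ n) 𝓘(ℝ, Ambient n) x p w) = 0) (q : M)
    {y : EuclideanSpace ℝ (Fin n)} (hy : y ∈ (extChartAt (𝓡∂ n) q).target) (i : Fin n) :
    gbar (x ((extChartAt (𝓡∂ n) q).symm y)) (chartDeriv x q y i)
      (ν ((extChartAt (𝓡∂ n) q).symm y)) = 0 := by
  set z := (extChartAt (𝓡∂ n) q).symm y with hz
  have hzq : z ∈ (extChartAt (𝓡∂ n) q).source := (extChartAt (𝓡∂ n) q).map_target hy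
  have hyz : extChartAt (𝓡∂ n) q z = y := (extChartAt (𝓡∂ n) q).right_inv hy
  rw [← hyz, chartDeriv_change hx hzq (mem_extChartAt_source z), gbar_sum_left]
  refine Finset.sum_eq_zero fun j _ => ?_
  refine mul_eq_zero_of_right _ ((gbar_comm _ _ _).trans ?_)
  exact (congrArg _ (chartDeriv_self_eq_mfderiv hx z j)).trans (hνnormal z _)

theorem isSphericalHypersurface_stereoInv
    (hximm : ∀ p : M, Function.Injective (mfderiv (𝓡∂ n) 𝓘(ℝ, Ambient n) x p))
    (hν : ContMDiff (𝓡∂ n) 𝓘(ℝ, Ambient n) ∞ ν)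
    (hνunit : ∀ p : M, gbar (x p) (ν p) (ν p) = 1)
    (hνnormal : ∀ (p : M) (w : TangentSpace (𝓡∂ n) p),
      gbar (x p) (ν p) (mfderiv (𝓡∂ n) 𝓘(ℝ, Ambient n) x p w) = 0) :
    IsSphericalHypersurface (fun m => stereoInv (x m)) (fun m => stereoDeriv (x m) (ν m)) where
  contMDiff := contDiff_stereoInv.contMDiff.comp hx
  contMDiff_normal := contMDiff_stereoDeriv hx hν
  pp m := stereoInv_dotProduct_self _
  νν m := by rw [stereoDeriv_dotProduct, hνunit]
  pν m := stereoInv_dotProduct_stereoDeriv _ _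
  tangent q y hy i := by
    rw [chartDeriv_stereoInv hx q hy, stereoDeriv_dotProduct]
    exact gbar_normal_chartDeriv hx hνnormal q hy i
  posDef q y hy := by
    rw [← gramMatrix_eq_dotMatrix hx q hy]
    exact posDef_gramMatrix hx hximm q hy

-- The r-part of the rotation is orthogonal to P, and ⟨A N, P⟩ = -⟨A P, N⟩ produces the term with
-- Y_a.
omit hx [NeZero n] [ChartedSpace (EuclideanHalfSpace n) M] [IsManifold (𝓡∂ n) ∞ M]
  [TopologicalSpace M] in
theorem capillaryField_dotProduct_stereoInv (a : Ambient n) (r c : ℝ) (p : M) :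
    -(capillaryField (pole n) (consL n (0, a)) r c (fun m => stereoInv (x m))
        (fun m => stereoDeriv (x m) (ν m)) p ⬝ᵥ stereoInv (x p)) =
      fieldV a (x p) + c * gbar (x p) (fieldY a (x p)) (ν p) := by
  rw [gbar_fieldY, fieldV_eq]
  simp only [capillaryField, infRot, add_dotProduct, sub_dotProduct, neg_dotProduct,
    smul_dotProduct, smul_eq_mul, dotProduct_comm (consL n (0, a)) (stereoInv _),
    dotProduct_comm (pole n) (stereoInv _), stereoInv_dotProduct_pole,
    stereoDeriv_dotProduct_pole, stereoInv_dotProduct_consL_zero,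
    stereoDeriv_dotProduct_consL_zero]
  ring

-- Here the c-part drops out, since A N is orthogonal to N; the rest is -a + cos R · A P, that is
-- X_a.
omit hx [NeZero n] [ChartedSpace (EuclideanHalfSpace n) M] [IsManifold (𝓡∂ n) ∞ M]
  [TopologicalSpace M] in
theorem capillaryField_dotProduct_stereoDeriv {R : ℝ} (hR : R ∈ Ioo 0 Real.pi) (a : Ambient n)
    (c : ℝ) (p : M) :
    capillaryField (pole n) (consL n (0, a)) (Real.cos R) c (fun m => stereoInv (x m))
        (fun m => stereoDeriv (x m) (ν m)) p ⬝ᵥ stereoDeriv (x p) (ν p) =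
      gbar (x p) (fieldX R a (x p)) (ν p) := by
  rw [gbar_fieldX hR, gbar_fieldY]
  simp only [capillaryField, infRot, add_dotProduct, sub_dotProduct, neg_dotProduct,
    smul_dotProduct, smul_eq_mul, dotProduct_comm (consL n (0, a)) (stereoDeriv _ _),
    dotProduct_comm (pole n) (stereoDeriv _ _), stereoInv_dotProduct_pole,
    stereoDeriv_dotProduct_pole, stereoInv_dotProduct_consL_zero,
    stereoDeriv_dotProduct_consL_zero]
  ring

end Capillary

end SphericalCapillary

end

/-! ### The Minkowski-type formula for capillary hypersurfaces -/

theorem proposition2p2 {n : ℕ} [NeZero n]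
    {M : Type*} [TopologicalSpace M] [T2Space M] [CompactSpace M]
    [ChartedSpace (EuclideanHalfSpace n) M] [IsManifold (𝓡∂ n) ∞ M]
    [MeasurableSpace M] [BorelSpace M]
    (R θ : ℝ) (hR : R ∈ Set.Ioo 0 Real.pi) (hθ : θ ∈ Set.Ioo 0 Real.pi)
    (a : SphericalCapillary.Ambient n) (ha : ‖a‖ = 1)
    -- `x` is a smooth immersion of `M` into the ball that maps the boundary into the sphere
    (x : M → SphericalCapillary.Ambient n)
    (hx : ContMDiff (𝓡∂ n) 𝓘(ℝ, SphericalCapillary.Ambient n) ∞ x)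
    (hximm : ∀ p : M,
      Function.Injective (mfderiv (𝓡∂ n) 𝓘(ℝ, SphericalCapillary.Ambient n) x p))
    (hxball : ∀ p : M, x p ∈ SphericalCapillary.geodesicBall n R)
    (hxbdry : ∀ p ∈ (𝓡∂ n).boundary M, x p ∈ SphericalCapillary.geodesicSphere n R)
    -- `ν` is a smooth unit normal field along `x`
    (ν : M → SphericalCapillary.Ambient n)
    (hν : ContMDiff (𝓡∂ n) 𝓘(ℝ, SphericalCapillary.Ambient n) ∞ ν)
    (hνunit : ∀ p : M, SphericalCapillary.gbar (x p) (ν p) (ν p) = 1)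
    (hνnormal : ∀ (p : M) (w : TangentSpace (𝓡∂ n) p),
      SphericalCapillary.gbar (x p) (ν p)
        (mfderiv (𝓡∂ n) 𝓘(ℝ, SphericalCapillary.Ambient n) x p w) = 0)
    -- the contact angle is `θ`
    (hangle : ∀ p ∈ (𝓡∂ n).boundary M,
      SphericalCapillary.gbar (x p) (ν p) (SphericalCapillary.outwardNormal (x p)) =
        Real.cos (Real.pi - θ))
    (k : ℕ) (hk1 : 1 ≤ k) (hkn : k ≤ n) :
    MeasureTheory.Integrable
      (fun p => SphericalCapillary.sigma (k - 1) x ν p * SphericalCapillary.fieldV a (x p) +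
        Real.sin R * Real.cos θ * SphericalCapillary.sigma (k - 1) x ν p *
          SphericalCapillary.gbar (x p) (SphericalCapillary.fieldY a (x p)) (ν p))
      (SphericalCapillary.area x) ∧
    MeasureTheory.Integrable
      (fun p => SphericalCapillary.sigma k x ν p *
        SphericalCapillary.gbar (x p) (SphericalCapillary.fieldX R a (x p)) (ν p))
      (SphericalCapillary.area x) ∧
    ((n : ℝ) - (k : ℝ) + 1) *
        ∫ p, (SphericalCapillary.sigma (k - 1) x ν p * SphericalCapillary.fieldV a (x p) +
          Real.sin R * Real.cos θ * SphericalCapillary.sigma (k - 1) x ν p *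
            SphericalCapillary.gbar (x p) (SphericalCapillary.fieldY a (x p)) (ν p))
          ∂(SphericalCapillary.area x) =
      (k : ℝ) *
        ∫ p, SphericalCapillary.sigma k x ν p *
          SphericalCapillary.gbar (x p) (SphericalCapillary.fieldX R a (x p)) (ν p)
          ∂(SphericalCapillary.area x) := by
  have H := SphericalCapillary.isSphericalHypersurface_stereoInv hx hximm hν hνunit hνnormal
  -- The formula for k is the coefficient of t^j with j = k - 1, whence the factor n - j = n - k +
  -- 1.
  obtain ⟨j, rfl⟩ : ∃ j, k = j + 1 := ⟨k - 1, by omega⟩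
  -- The difference from 1 is (sin R sin θ)², positive because both angles lie strictly between 0
  -- and π.
  have hrc : Real.cos R ^ 2 + (Real.sin R * Real.cos θ) ^ 2 ≠ 1 := by
    have h1 := mul_pos (Real.sin_pos_of_mem_Ioo hR) (Real.sin_pos_of_mem_Ioo hθ)
    have h2 : Real.cos R ^ 2 + (Real.sin R * Real.cos θ) ^ 2 =
        1 - (Real.sin R * Real.sin θ) ^ 2 := by
      rw [mul_pow, mul_pow, Real.cos_sq' θ, Real.cos_sq' R]; ring
    rw [h2]
    exact (sub_lt_self _ (pow_pos h1 2)).ne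
  obtain ⟨h1, h2, h3⟩ := H.integral_meanCurvature hx
    (fun q y hy => SphericalCapillary.gramMatrix_eq_dotMatrix hx q hy)
    SphericalCapillary.pole_dotProduct_self (SphericalCapillary.pole_dotProduct_consL_zero a) hrc
    (fun m hm => ⟨SphericalCapillary.pole_dotProduct_of_mem_geodesicSphere hR (hxbdry m hm),
      SphericalCapillary.pole_dotProduct_stereoDeriv_of_mem_geodesicSphere hR (hxbdry m hm)
        (hangle m hm)⟩) (k := j) (by omega)
  simp only [SphericalCapillary.capillaryField_dotProduct_stereoInv,
    SphericalCapillary.capillaryField_dotProduct_stereoDeriv hR,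
    ← SphericalCapillary.sigma_eq_meanCurvature hx hν] at h1 h2 h3
  have h4 : ∀ p, SphericalCapillary.sigma j x ν p * (SphericalCapillary.fieldV a (x p) +
      Real.sin R * Real.cos θ *
        SphericalCapillary.gbar (x p) (SphericalCapillary.fieldY a (x p)) (ν p)) =
      SphericalCapillary.sigma j x ν p * SphericalCapillary.fieldV a (x p) +
        Real.sin R * Real.cos θ * SphericalCapillary.sigma j x ν p *
          SphericalCapillary.gbar (x p) (SphericalCapillary.fieldY a (x p)) (ν p) :=
    fun p => by ring
  simp only [h4] at h1 h3
  rw [Nat.add_sub_cancel]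
  refine ⟨h1, h2, ?_⟩
  rw [show (n : ℝ) - ((j + 1 : ℕ) : ℝ) + 1 = n - j by push_cast; ring, h3]
  push_cast
  rfl
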